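/- Let $q\in\mathbb{C}^*$ be not a root of unity, fix a square root $q^{1/2}$, let $k_\pm\in\mathbb{C}^*$ and $\rho=k_+k_-(q+q^{-1})^2$. Write $[X,Y]=XY-YX$, $[X,Y]_q=qXY-q^{-1}YX$, $[n]_q=\frac{q^n-q^{-n}}{q-q^{-1}}$, $c(t)=t-t^{-1}$, and $U=U(u)=\frac{qu^2+q^{-1}u^{-2}}{q+q^{-1}}$; $U^{-1}$ is always expanded as a power series in $u^{-1}$. All maps below act on series in $u^{-1}$ coefficientwise. **$U_q(sl_2)$.** $U_q(sl_2)$ is the $\mathbb{C}$-algebra generated by $E,F,K^{\pm1/2}$ with $K^{1/2}E=qEK^{1/2}$, $K^{1/2}F=q^{-1}FK^{1/2}$, $[E,F]=\frac{K-K^{-1}}{q-q^{-1}}$, $K^{1/2}K^{-1/2}=K^{-1/2}K^{1/2}=1$. For $j\in\frac12\mathbb{N}$, $\pi^j$ is its representation on $\mathbb{C}^{2j+1}$ with basis $|j,m\rangle$, $m=j,j-1,\dots,-j$, given by $F|j,m\rangle=B_{j,m}|j,m-1\rangle$, $E|j,m-1\rangle=B_{j,m}|j,m\rangle$, $K^{\pm1/2}|j,m\rangle=q^{\pm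 m}|j,m\rangle$, where $B_{j,m}=\sqrt{[j+m]_q[j-m+1]_q}$. **$R^{(1/2,j)}$, $\mathcal{E}$, $\mathcal{F}$.** For $j\in\frac12\mathbb{N}_+$ let $$R^{(\frac12,j)}(t)=\prod_{i=0}^{2j-2}c(tq^{j-\frac12-i})\Big((q-q^{-1})(\sigma_+\otimes\pi^j(F)+\sigma_-\otimes\pi^j(E))+tq^{\frac12(1+\sigma_z\otimes H)}-t^{-1}q^{-\frac12(1+\sigma_z\otimes H)}\Big),$$ $H|j,m\rangle=2m|j,m\rangle$. Let $\mathcal{E}^{(j+\frac12)}:\mathbb{C}^{2j+2}\to\mathbb{C}^2\otimes\mathbb{C}^{2j+1}$ and $\mathcal{F}^{(j+\frac12)}:\mathbb{C}^2\otimes\mathbb{C}^{2j+1}\to\mathbb{C}^{2j+2}$ be the matrices (ordered bases $|j+\frac12,j+\frac12\rangle,\dots,|j+\frac12,-j-\frac12\rangle$ and $|\uparrow\rangle\otimes|j,j\rangle,\dots,|\uparrow\rangle\otimes|j,-j\rangle,|\downarrow\rangle\otimes|j,j\rangle,\dots,|\downarrow\rangle\otimes|j,-j\rangle$) whose only nonzero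 entries are $$\mathcal{E}_{1+n,1+n}=\prod_{p=0}^{n-1}\frac{B_{j,j-p}}{B_{j+\frac12,j+\frac12-p}}\ (0\le n\le 2j),\qquad \mathcal{E}_{2j+1+m,1+m}=[m]_q\frac{\mathcal{E}_{m,m}}{B_{j+\frac12,j+\frac32-m}}\ (1\le m\le 2j+1),$$ $$\mathcal{F}_{1,1}=1,\quad \mathcal{F}_{2j+2,4j+2}=(\mathcal{E}_{4j+2,2j+2})^{-1},\quad \mathcal{F}_{n,n+2j}=\frac{\mathcal{E}_{n+2j,n}}{\mathcal{E}_{n,n}^2+\mathcal{E}_{n+2j,n}^2},\quad \mathcal{F}_{n,n}=\frac{1-\mathcal{F}_{n,n+2j}\mathcal{E}_{n+2j,n}}{\mathcal{E}_{n,n}}\ (2\le n\le 2j+1);$$ then $\mathcal{F}^{(j+\frac12)}\mathcal{E}^{(j+\frac12)}=1$. Indices $1,2$ on operators below denote the factor of $\mathbb{C}^2\otimes\mathbb{C}^{2j+1}$ on which they act. **The algebra $\mathcal{A}_q$.** $\mathcal{A}_q$ is the $\mathbb{C}$-algebra generated by $\mathsf{W}_{-k},\mathsf{W}_{k+1},\mathsf{G}_{k+1},\tilde{\mathsf{G}}_{k+1}$,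 $k\in\mathbb{N}$, whose defining relations are the coefficients of the reflection equation $$R^{(\frac12,\frac12)}(u/v)\mathcal{K}_1^{(\frac12)}(u)R^{(\frac12,\frac12)}(uv)\mathcal{K}_2^{(\frac12)}(v)=\mathcal{K}_2^{(\frac12)}(v)R^{(\frac12,\frac12)}(uv)\mathcal{K}_1^{(\frac12)}(u)R^{(\frac12,\frac12)}(u/v)$$ for $$\mathcal{K}^{(\frac12)}(u)=\begin{pmatrix}uq\mathcal{W}_+(u)-u^{-1}q^{-1}\mathcal{W}_-(u)&\frac{\mathcal{G}_+(u)}{k_-(q+q^{-1})}+\frac{k_+(q+q^{-1})}{q-q^{-1}}\\ \frac{\mathcal{G}_-(u)}{k_+(q+q^{-1})}+\frac{k_-(q+q^{-1})}{q-q^{-1}}&uq\mathcal{W}_-(u)-u^{-1}q^{-1}\mathcal{W}_+(u)\end{pmatrix},$$ $\mathcal{W}_+=\sum_k\mathsf{W}_{-k}U^{-k-1}$, $\mathcal{W}_-=\sum_k\mathsf{W}_{k+1}U^{-k-1}$, $\mathcal{G}_+=\sum_k\mathsf{G}_{k+1}U^{-k-1}$, $\mathcal{G}_-=\sum_k\tilde{\mathsf{G}}_{k+1}U^{-k-1}$.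 Put $\mathsf{G}_0=k_+k_-\frac{(q+q^{-1})^2}{q-q^{-1}}$. **Fused operators.** The fused K-operators $\mathcal{K}^{(j)}(u)\in\mathcal{A}_q((u^{-1}))\otimes\mathrm{End}(\mathbb{C}^{2j+1})$ and fused L-operators $\mathcal{L}^{(j)}(u)\in U_q(sl_2)[u,u^{-1}]\otimes\mathrm{End}(\mathbb{C}^{2j+1})$ are defined, for $j\in\frac12\mathbb{N}_+$, by the above $\mathcal{K}^{(\frac12)}$, by $$\mathcal{L}^{(\frac12)}(u)=\begin{pmatrix}uq^{\frac12}K^{\frac12}-u^{-1}q^{-\frac12}K^{-\frac12}&(q-q^{-1})F\\(q-q^{-1})E&uq^{\frac12}K^{-\frac12}-u^{-1}q^{-\frac12}K^{\frac12}\end{pmatrix},$$ and by the recursions $$\mathcal{K}^{(j+\frac12)}(u)=\mathcal{F}^{(j+\frac12)}\mathcal{K}_1^{(\frac12)}(uq^{-j})R^{(\frac12,j)}(u^2q^{-j+\frac12})\mathcal{K}_2^{(j)}(uq^{\frac12})\mathcal{E}^{(j+\frac12)},\qquad \mathcal{L}^{(j+\frac12)}(u)=\mathcal{F}^{(j+\frac12)}\mathcal{L}_2^{(j)}(uq^{-\frac12})\mathcal{L}_1^{(\frac12)}(uq^{j})\mathcal{E}^{(j+\frac12)}.$$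 **Proposition.** (a) There is a unique algebra homomorphism (the evaluated coaction) $\delta_w:\mathcal{A}_q\to\mathcal{A}_q\otimes U_q(sl_2)[w,w^{-1}]$, $w$ a formal variable, such that $$\delta_w(\mathsf{W}_0)=1\otimes(k_+q^{\frac12}w^{-1}EK^{\frac12}+k_-q^{-\frac12}wFK^{\frac12})+\mathsf{W}_0\otimes K,$$ $$\delta_w(\mathsf{W}_1)=1\otimes(k_+q^{-\frac12}wEK^{-\frac12}+k_-q^{\frac12}w^{-1}FK^{-\frac12})+\mathsf{W}_1\otimes K^{-1},$$ and, for all $k\in\mathbb{N}$, $$\begin{aligned}\delta_w(\mathsf{G}_{k+1})={}&\tfrac{k_-}{k_+}\tfrac{(q-q^{-1})^2}{q+q^{-1}}\Big(\mathsf{G}_k-\tfrac{q+q^{-1}}{\rho}[\mathsf{W}_0,[\mathsf{W}_0,\mathsf{G}_k]_q]\Big)\otimes F^2\\&+\tfrac{q-q^{-1}}{k_+(q+q^{-1})}\Big(q^{-\frac12}w^{-1}[\mathsf{W}_0,\mathsf{G}_k]_q\otimes FK^{\frac12}+q^{\frac12}w[\mathsf{G}_k,\mathsf{W}_1]_q\otimes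 FK^{-\frac12}\Big)\\&+\mathsf{G}_{k+1}\otimes1-\tfrac{\mathsf{G}_k}{q+q^{-1}}\otimes(w^2K^{-1}+w^{-2}K).\end{aligned}$$ (b) For this $\delta_w$ and every $j\in\frac12\mathbb{N}_+$, in $(\mathcal{A}_q\otimes U_q(sl_2)[w,w^{-1}])((u^{-1}))\otimes\mathrm{End}(\mathbb{C}^{2j+1})$, $$(\delta_w\otimes\mathrm{id})(\mathcal{K}^{(j)}(u))=\left(\prod_{p=1}^{2j}\frac{U^{-1}}{q+q^{-1}}\Big|_{u\to uq^{j+\frac12-p}}\right)\left(\mathcal{L}^{(j)}(u/w)\right)_{[2]}\left(\mathcal{K}^{(j)}(u)\right)_{[1]}\left(\mathcal{L}^{(j)}(uw)\right)_{[2]},$$ where $(T_{[2]}T'_{[1]}T''_{[2]})_{il}=\sum_{m,n}T'_{mn}\otimes T_{im}T''_{nl}$. -/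

import Mathlib

open scoped TensorProduct Kronecker LaurentPolynomial

noncomputable section

namespace QOnsager

/-! Throughout, `s` is a fixed square root `q^{1/2}`, so that `q = s ^ 2`. Half-integer spins `j` are
encoded by the natural number `N = 2 j`; the basis vector `|j, m⟩` of `ℂ^{2j+1}` has index
`a = j - m` in `Fin (N + 1)`.

`HahnSeries ℤ A` is the ring `A((u⁻¹))`: the coefficient at `n` is the coefficient of `u^{-n}`. -/

section Series

/-- The additive map `∑ aₙ u^{-n} ↦ ∑ gₙ(aₙ) u^{-n}`. -/
def coeffMap {R S : Type*} [AddCommMonoid R] [AddCommMonoid S] (g : ℤ → R →+ S) :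
    HahnSeries ℤ R →+ HahnSeries ℤ S where
  toFun x :=
    { coeff := fun n => g n (x.coeff n)
      isPWO_support' := x.isPWO_support.mono (fun n hn h0 => hn (by
        show g n (x.coeff n) = 0
        rw [h0, map_zero])) }
  map_zero' := by
    ext n
    simp
  map_add' x y := by
    ext n
    simp

/-- The substitution `u ↦ a u`, i.e. `x(u) ↦ x(a u)`. -/
def shift {A : Type*} [Ring A] [Algebra ℂ A] (a : ℂ) : HahnSeries ℤ A →+ HahnSeries ℤ A :=
  coeffMap fun n => DistribSMul.toAddMonoidHom A (a ^ (-n))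

/-- Scalar series `ℂ((u⁻¹))` regarded as series with coefficients in `A`. -/
def scal (A : Type*) [Ring A] [Algebra ℂ A] : HahnSeries ℤ ℂ →+ HahnSeries ℤ A :=
  coeffMap fun _ => (algebraMap ℂ A).toAddMonoidHom

/-- An algebra map applied to all coefficients of a series. -/
def mapCoeff {A B : Type*} [Ring A] [Ring B] [Algebra ℂ A] [Algebra ℂ B] (f : A →ₐ[ℂ] B) :
    HahnSeries ℤ A →+ HahnSeries ℤ B :=
  coeffMap fun _ => f.toRingHom.toAddMonoidHom

/-- The variable `u` of `A((u⁻¹))`. -/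
def uVar (A : Type*) [Ring A] : HahnSeries ℤ A := HahnSeries.single (-1) 1

/-- The element `u⁻¹` of `A((u⁻¹))`. -/
def uInv (A : Type*) [Ring A] : HahnSeries ℤ A := HahnSeries.single 1 1

end Series

section Scalars

/-- `c(t) = t - t⁻¹`. -/
def cFun {k : Type*} [Field k] (t : k) : k := t - t⁻¹

/-- The `q`-number `[n]_q = (q^n - q^{-n}) / (q - q⁻¹)` with `q = s ^ 2`. -/
def qNum (s : ℂ) (n : ℕ) : ℂ :=
  ((s ^ 2) ^ n - ((s ^ 2) ^ n)⁻¹) / (s ^ 2 - (s ^ 2)⁻¹)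

/-- `B_{j, j-p} = √([2j-p]_q [p+1]_q)` with `N = 2j` (principal square root). One has
`F |j, j-p⟩ = B_{j,j-p} |j, j-p-1⟩` and `E |j, j-p-1⟩ = B_{j,j-p} |j, j-p⟩` in the spin-`j`
representation. -/
def bCoef (s : ℂ) (N p : ℕ) : ℂ := (qNum s (N - p) * qNum s (p + 1)) ^ (1 / 2 : ℂ)

/-- The matrix of `F` in the spin-`N/2` representation. -/
def repF (s : ℂ) (N : ℕ) : Matrix (Fin (N + 1)) (Fin (N + 1)) ℂ :=
  fun a b => if (a : ℕ) = b + 1 then bCoef s N b else 0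

/-- The matrix of `E` in the spin-`N/2` representation. -/
def repE (s : ℂ) (N : ℕ) : Matrix (Fin (N + 1)) (Fin (N + 1)) ℂ :=
  fun a b => if (b : ℕ) = a + 1 then bCoef s N a else 0

/-- The entries `∏_{p < n} B_{j,j-p} / B_{j+1/2,j+1/2-p}` of the intertwiner, `N = 2j`. -/
def eDiag (s : ℂ) (N n : ℕ) : ℂ := ∏ p ∈ Finset.range n, bCoef s N p / bCoef s (N + 1) p

/-- The entries of the intertwiner at (row `|↓⟩ ⊗ |j, j-a⟩`, column `a + 1`), `N = 2j`. -/
def eLow (s : ℂ) (N a : ℕ) : ℂ := qNum s (a + 1) * eDiag s N a / bCoef s (N + 1) a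

/-- The intertwiner `ℰ^{(j+1/2)} : ℂ^{2j+2} → ℂ² ⊗ ℂ^{2j+1}`, `N = 2j`;
the index `0 : Fin 2` is `|↑⟩` and `1 : Fin 2` is `|↓⟩`. -/
def fusE (s : ℂ) (N : ℕ) : Matrix (Fin 2 × Fin (N + 1)) (Fin (N + 2)) ℂ :=
  fun r b =>
    if r.1 = 0 then (if (b : ℕ) = r.2 then eDiag s N r.2 else 0)
    else (if (b : ℕ) = r.2 + 1 then eLow s N r.2 else 0)

/-- The pseudo-inverse `ℱ^{(j+1/2)} : ℂ² ⊗ ℂ^{2j+1} → ℂ^{2j+2}` of `ℰ^{(j+1/2)}`, `N = 2j`. -/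
def fusF (s : ℂ) (N : ℕ) : Matrix (Fin (N + 2)) (Fin 2 × Fin (N + 1)) ℂ :=
  fun b r =>
    if r.1 = 0 then
      (if (b : ℕ) = r.2 then
        (if (b : ℕ) = 0 then 1
        else (1 - eLow s N (b - 1) / (eDiag s N b ^ 2 + eLow s N (b - 1) ^ 2) * eLow s N (b - 1))
          / eDiag s N b)
      else 0)
    else
      (if (b : ℕ) = r.2 + 1 then
        (if (b : ℕ) = N + 1 then (eLow s N N)⁻¹
        else eLow s N r.2 / (eDiag s N b ^ 2 + eLow s N r.2 ^ 2))
      else 0)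

/-- The matrix `R^{(1/2,j)}(t)` for `N = 2j ≥ 1`, with `t` in a field extension `k` of `ℂ`:
`∏_{i=0}^{2j-2} c(t q^{j-1/2-i})` times
`(q-q⁻¹)(σ₊ ⊗ F + σ₋ ⊗ E) + t q^{(1 + σ_z ⊗ H)/2} - t⁻¹ q^{-(1 + σ_z ⊗ H)/2}`. -/
def rMat {k : Type*} [Field k] [Algebra ℂ k] (s : ℂ) (N : ℕ) (t : k) :
    Matrix (Fin 2 × Fin (N + 1)) (Fin 2 × Fin (N + 1)) k :=
  (∏ i ∈ Finset.range (N - 1), cFun (algebraMap ℂ k (s ^ ((N : ℤ) - 1 - 2 * i)) * t)) •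
    Matrix.of fun x y =>
      (if x = y then
        (if x.1 = 0 then cFun (algebraMap ℂ k (s ^ (1 + (N : ℤ) - 2 * (x.2 : ℕ))) * t)
        else cFun (algebraMap ℂ k (s ^ (1 - (N : ℤ) + 2 * (x.2 : ℕ))) * t))
      else 0)
      + algebraMap ℂ k ((s ^ 2 - (s ^ 2)⁻¹) *
          ((if x.1 = 0 ∧ y.1 = 1 then repF s N x.2 y.2 else 0)
          + (if x.1 = 1 ∧ y.1 = 0 then repE s N x.2 y.2 else 0)))

/-- `U(u) = (q u² + q⁻¹ u⁻²) / (q + q⁻¹)` as an element of the field `ℂ((u⁻¹))`. -/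
def uCap (s : ℂ) : HahnSeries ℤ ℂ :=
  (s ^ 2 + (s ^ 2)⁻¹)⁻¹ • ((s ^ 2) • uVar ℂ ^ 2 + (s ^ 2)⁻¹ • uInv ℂ ^ 2)

end Scalars

section Uq

/-- Generators of `U_q(sl₂)`: `E`, `F`, `K^{1/2}`, `K^{-1/2}`. -/
inductive UqGen
  | E
  | F
  | Kh
  | Kih

/-- The defining relations of `U_q(sl₂)`. -/
inductive UqRel (s : ℂ) : FreeAlgebra ℂ UqGen → FreeAlgebra ℂ UqGen → Prop
  | KE : UqRel s (FreeAlgebra.ι ℂ UqGen.Kh * FreeAlgebra.ι ℂ UqGen.E)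
      (s ^ 2 • (FreeAlgebra.ι ℂ UqGen.E * FreeAlgebra.ι ℂ UqGen.Kh))
  | KF : UqRel s (FreeAlgebra.ι ℂ UqGen.Kh * FreeAlgebra.ι ℂ UqGen.F)
      ((s ^ 2)⁻¹ • (FreeAlgebra.ι ℂ UqGen.F * FreeAlgebra.ι ℂ UqGen.Kh))
  | EF : UqRel s
      (FreeAlgebra.ι ℂ UqGen.E * FreeAlgebra.ι ℂ UqGen.F
        - FreeAlgebra.ι ℂ UqGen.F * FreeAlgebra.ι ℂ UqGen.E)
      ((s ^ 2 - (s ^ 2)⁻¹)⁻¹ •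
        (FreeAlgebra.ι ℂ UqGen.Kh ^ 2 - FreeAlgebra.ι ℂ UqGen.Kih ^ 2))
  | KKi : UqRel s (FreeAlgebra.ι ℂ UqGen.Kh * FreeAlgebra.ι ℂ UqGen.Kih) 1
  | KiK : UqRel s (FreeAlgebra.ι ℂ UqGen.Kih * FreeAlgebra.ι ℂ UqGen.Kh) 1

/-- The algebra `U_q(sl₂)`. -/
def Uq (s : ℂ) : Type := RingQuot (UqRel s)

instance (s : ℂ) : Ring (Uq s) := inferInstanceAs (Ring (RingQuot (UqRel s)))

instance (s : ℂ) : Algebra ℂ (Uq s) := inferInstanceAs (Algebra ℂ (RingQuot (UqRel s)))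

/-- The class of a generator in `U_q(sl₂)`. -/
def Uq.gen (s : ℂ) (x : UqGen) : Uq s :=
  RingQuot.mkAlgHom ℂ (UqRel s) (FreeAlgebra.ι ℂ x)

/-- The fundamental L-operator `ℒ^{(1/2)}(u)`. -/
def lHalf (s : ℂ) : Matrix (Fin 2) (Fin 2) (HahnSeries ℤ (Uq s)) :=
  !![HahnSeries.single (-1) (s • Uq.gen s UqGen.Kh)
        - HahnSeries.single 1 (s⁻¹ • Uq.gen s UqGen.Kih),
      HahnSeries.single 0 ((s ^ 2 - (s ^ 2)⁻¹) • Uq.gen s UqGen.F);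
    HahnSeries.single 0 ((s ^ 2 - (s ^ 2)⁻¹) • Uq.gen s UqGen.E),
      HahnSeries.single (-1) (s • Uq.gen s UqGen.Kih)
        - HahnSeries.single 1 (s⁻¹ • Uq.gen s UqGen.Kh)]

end Uq

section Fusion

variable {A : Type*} [Ring A] [Algebra ℂ A]

/-- A complex matrix regarded as a constant matrix over `A((u⁻¹))`. -/
def constMat (A : Type*) [Ring A] [Algebra ℂ A] {m n : Type*} (M : Matrix m n ℂ) :
    Matrix m n (HahnSeries ℤ A) :=
  M.map fun z => HahnSeries.single 0 (algebraMap ℂ A z)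

/-- `M₁ = M ⊗ 1` on `ℂ² ⊗ ℂ^{N+1}`. -/
def leg1 {X : Type*} [Ring X] (N : ℕ) (M : Matrix (Fin 2) (Fin 2) X) :
    Matrix (Fin 2 × Fin (N + 1)) (Fin 2 × Fin (N + 1)) X :=
  M ⊗ₖ (1 : Matrix (Fin (N + 1)) (Fin (N + 1)) X)

/-- `M₂ = 1 ⊗ M` on `ℂ² ⊗ ℂ^{N+1}`. -/
def leg2 {X : Type*} [Ring X] {N : ℕ} (M : Matrix (Fin (N + 1)) (Fin (N + 1)) X) :
    Matrix (Fin 2 × Fin (N + 1)) (Fin 2 × Fin (N + 1)) X :=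
  (1 : Matrix (Fin 2) (Fin 2) X) ⊗ₖ M

/-- The fused L-operators `ℒ^{(j)}(u)`, `N = 2j`, with
`ℒ^{(j+1/2)}(u) = ℱ^{(j+1/2)} ℒ₂^{(j)}(u q^{-1/2}) ℒ₁^{(1/2)}(u q^j) ℰ^{(j+1/2)}`. -/
def fusedL (s : ℂ) : (N : ℕ) → Matrix (Fin (N + 1)) (Fin (N + 1)) (HahnSeries ℤ (Uq s))
  | 0 => 1
  | 1 => lHalf s
  | N + 2 =>
      constMat (Uq s) (fusF s (N + 1))
        * leg2 ((fusedL s (N + 1)).map (shift s⁻¹))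
        * leg1 (N + 1) ((lHalf s).map (shift (s ^ (N + 1))))
        * constMat (Uq s) (fusE s (N + 1))

/-- The fused K-operators `𝒦^{(j)}(u)`, `N = 2j`, built from `𝒦^{(1/2)}(u) = K` by
`𝒦^{(j+1/2)}(u) =
  ℱ^{(j+1/2)} 𝒦₁^{(1/2)}(u q^{-j}) R^{(1/2,j)}(u² q^{-j+1/2}) 𝒦₂^{(j)}(u q^{1/2}) ℰ^{(j+1/2)}`. -/
def fusedK (s : ℂ) (K : Matrix (Fin 2) (Fin 2) (HahnSeries ℤ A)) :
    (N : ℕ) → Matrix (Fin (N + 1)) (Fin (N + 1)) (HahnSeries ℤ A)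
  | 0 => 1
  | 1 => K
  | N + 2 =>
      constMat A (fusF s (N + 1))
        * leg1 (N + 1) (K.map (shift (s ^ (-((N : ℤ) + 1)))))
        * (rMat s (N + 1) (s ^ (1 - ((N : ℤ) + 1)) • uVar ℂ ^ 2)).map (scal A)
        * leg2 ((fusedK s K (N + 1)).map (shift s))
        * constMat A (fusE s (N + 1))

end Fusion

section Aq

/-- The alternating generators of `𝒜_q`: `Wm k = W_{-k}`, `Wp k = W_{k+1}`, `G k = G_{k+1}`,
`Gt k = G̃_{k+1}` for `k ∈ ℕ`. -/
inductive AqGen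
  | Wm (k : ℕ)
  | Wp (k : ℕ)
  | G (k : ℕ)
  | Gt (k : ℕ)

/-- The generating function `∑_k a_k U^{-k-1}` in `A((u⁻¹))`. The series `U^{-k-1}` starts with
`u^{-2k-2}`, so only the terms with `k < n` contribute to the coefficient of `u^{-n}`. -/
def genFun {A : Type*} [Ring A] [Algebra ℂ A] (s : ℂ) (a : ℕ → A) : HahnSeries ℤ A :=
  HahnSeries.ofPowerSeries ℤ A (PowerSeries.mk fun n =>
    ∑ k ∈ Finset.range n, (((uCap s)⁻¹) ^ (k + 1)).coeff (n : ℤ) • a k)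

/-- The fundamental K-operator `𝒦^{(1/2)}(u)` formed from a family of elements of an algebra
indexed by the alternating generators. -/
def kHalf {A : Type*} [Ring A] [Algebra ℂ A] (s kp km : ℂ) (g : AqGen → A) :
    Matrix (Fin 2) (Fin 2) (HahnSeries ℤ A) :=
  let q : ℂ := s ^ 2
  let WP := genFun s fun k => g (AqGen.Wm k)
  let WM := genFun s fun k => g (AqGen.Wp k)
  let GP := genFun s fun k => g (AqGen.G k)
  let GM := genFun s fun k => g (AqGen.Gt k)
  !![q • (uVar A * WP) - q⁻¹ • (uInv A * WM),
      (km * (q + q⁻¹))⁻¹ • GP + (kp * (q + q⁻¹) / (q - q⁻¹)) • (1 : HahnSeries ℤ A);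
    (kp * (q + q⁻¹))⁻¹ • GM + (km * (q + q⁻¹) / (q - q⁻¹)) • (1 : HahnSeries ℤ A),
      q • (uVar A * WM) - q⁻¹ • (uInv A * WP)]

/-- Series in two variables: `A((v⁻¹))((u⁻¹))`. -/
abbrev TwoVar (A : Type*) [Ring A] : Type _ := HahnSeries ℤ (HahnSeries ℤ A)

/-- `u ∈ ℂ((v⁻¹))((u⁻¹))`. -/
def uu : TwoVar ℂ := HahnSeries.single (-1) 1

/-- `v ∈ ℂ((v⁻¹))((u⁻¹))`. -/
def vv : TwoVar ℂ := HahnSeries.single 0 (HahnSeries.single (-1) 1)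

/-- `x(u) ∈ A((u⁻¹))` regarded as a two-variable series. -/
def inU {A : Type*} [Ring A] [Algebra ℂ A] : HahnSeries ℤ A →+ TwoVar A :=
  coeffMap fun _ => (HahnSeries.C : A →+* HahnSeries ℤ A).toAddMonoidHom

/-- `x(v) ∈ A((v⁻¹))` regarded as a two-variable series. -/
def inV {A : Type*} [Ring A] [Algebra ℂ A] : HahnSeries ℤ A →+ TwoVar A :=
  (HahnSeries.C : HahnSeries ℤ A →+* TwoVar A).toAddMonoidHom

/-- Scalar two-variable series regarded as series with coefficients in `A`. -/
def scal2 (A : Type*) [Ring A] [Algebra ℂ A] : TwoVar ℂ →+ TwoVar A :=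
  coeffMap fun _ => scal A

/-- Left-hand side `R(u/v) K₁(u) R(uv) K₂(v)` of the reflection equation. -/
def reLHS {A : Type*} [Ring A] [Algebra ℂ A] (s : ℂ)
    (K : Matrix (Fin 2) (Fin 2) (HahnSeries ℤ A)) :
    Matrix (Fin 2 × Fin 2) (Fin 2 × Fin 2) (TwoVar A) :=
  (rMat s 1 (uu / vv)).map (scal2 A) * leg1 1 (K.map inU)
    * (rMat s 1 (uu * vv)).map (scal2 A) * leg2 (N := 1) (K.map inV)

/-- Right-hand side `K₂(v) R(uv) K₁(u) R(u/v)` of the reflection equation. -/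
def reRHS {A : Type*} [Ring A] [Algebra ℂ A] (s : ℂ)
    (K : Matrix (Fin 2) (Fin 2) (HahnSeries ℤ A)) :
    Matrix (Fin 2 × Fin 2) (Fin 2 × Fin 2) (TwoVar A) :=
  leg2 (N := 1) (K.map inV) * (rMat s 1 (uu * vv)).map (scal2 A)
    * leg1 1 (K.map inU) * (rMat s 1 (uu / vv)).map (scal2 A)

/-- The defining relations of `𝒜_q`: every coefficient (of `u^{-m} v^{-n}`, in every matrix entry)
of the reflection equation for `𝒦^{(1/2)}(u)`. -/
inductive AqRel (s kp km : ℂ) : FreeAlgebra ℂ AqGen → FreeAlgebra ℂ AqGen → Prop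
  | refl (i j : Fin 2 × Fin 2) (m n : ℤ) : AqRel s kp km
      (((reLHS s (kHalf s kp km (FreeAlgebra.ι ℂ)) i j).coeff m).coeff n)
      (((reRHS s (kHalf s kp km (FreeAlgebra.ι ℂ)) i j).coeff m).coeff n)

/-- The algebra `𝒜_q` (reflection algebra presentation) with parameters `q = s²`, `k₊`, `k₋`. -/
def Aq (s kp km : ℂ) : Type := RingQuot (AqRel s kp km)

instance (s kp km : ℂ) : Ring (Aq s kp km) := inferInstanceAs (Ring (RingQuot (AqRel s kp km)))

instance (s kp km : ℂ) : Algebra ℂ (Aq s kp km) :=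
  inferInstanceAs (Algebra ℂ (RingQuot (AqRel s kp km)))

/-- The class of a generator in `𝒜_q`. -/
def Aq.gen (s kp km : ℂ) (x : AqGen) : Aq s kp km :=
  RingQuot.mkAlgHom ℂ (AqRel s kp km) (FreeAlgebra.ι ℂ x)

/-- The fused K-operator `𝒦^{(N/2)}(u)` of `𝒜_q`. -/
def aqK (s kp km : ℂ) (N : ℕ) :
    Matrix (Fin (N + 1)) (Fin (N + 1)) (HahnSeries ℤ (Aq s kp km)) :=
  fusedK s (kHalf s kp km (Aq.gen s kp km)) N

end Aq

section Coaction

/-- The algebra `𝒜_q ⊗ U_q(sl₂)[w, w⁻¹]`. -/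
abbrev CoactTarget (s kp km : ℂ) : Type := Aq s kp km ⊗[ℂ] (Uq s)[T;T⁻¹]

/-- The `q`-commutator `[x, y]_q = q x y - q⁻¹ y x`. -/
def qComm {A : Type*} [Ring A] [Algebra ℂ A] (q : ℂ) (x y : A) : A := q • (x * y) - q⁻¹ • (y * x)

/-- The elements `G_k ∈ 𝒜_q`, `k ∈ ℕ`, with `G_0 = k₊ k₋ (q + q⁻¹)² / (q - q⁻¹)`. -/
def gElt (s kp km : ℂ) : ℕ → Aq s kp km
  | 0 => algebraMap ℂ _ (kp * km * (s ^ 2 + (s ^ 2)⁻¹) ^ 2 / (s ^ 2 - (s ^ 2)⁻¹))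
  | k + 1 => Aq.gen s kp km (AqGen.G k)

/-- The element `a wⁿ` of `U_q(sl₂)[w, w⁻¹]`. -/
def wMono {s : ℂ} (n : ℤ) (a : Uq s) : (Uq s)[T;T⁻¹] := LaurentPolynomial.C a * LaurentPolynomial.T n

/-- `δ` is the evaluated coaction `δ_w : 𝒜_q → 𝒜_q ⊗ U_q(sl₂)[w, w⁻¹]`: its values on the
generators `W_0`, `W_1`, `G_{k+1}` (`k ∈ ℕ`) are the prescribed ones, where
`ρ = k₊ k₋ (q + q⁻¹)²`. -/
structure IsEvaluatedCoaction (s kp km : ℂ) (δ : Aq s kp km →ₐ[ℂ] CoactTarget s kp km) : Prop where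
  /-- `δ_w(W_0) = 1 ⊗ (k₊ q^{1/2} w⁻¹ E K^{1/2} + k₋ q^{-1/2} w F K^{1/2}) + W_0 ⊗ K`. -/
  map_W0 : δ (Aq.gen s kp km (AqGen.Wm 0)) =
    1 ⊗ₜ (wMono (-1) ((kp * s) • (Uq.gen s UqGen.E * Uq.gen s UqGen.Kh))
        + wMono 1 ((km * s⁻¹) • (Uq.gen s UqGen.F * Uq.gen s UqGen.Kh)))
      + Aq.gen s kp km (AqGen.Wm 0) ⊗ₜ wMono 0 (Uq.gen s UqGen.Kh ^ 2)
  /-- `δ_w(W_1) = 1 ⊗ (k₊ q^{-1/2} w E K^{-1/2} + k₋ q^{1/2} w⁻¹ F K^{-1/2}) + W_1 ⊗ K⁻¹`. -/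
  map_W1 : δ (Aq.gen s kp km (AqGen.Wp 0)) =
    1 ⊗ₜ (wMono 1 ((kp * s⁻¹) • (Uq.gen s UqGen.E * Uq.gen s UqGen.Kih))
        + wMono (-1) ((km * s) • (Uq.gen s UqGen.F * Uq.gen s UqGen.Kih)))
      + Aq.gen s kp km (AqGen.Wp 0) ⊗ₜ wMono 0 (Uq.gen s UqGen.Kih ^ 2)
  /-- The value on `G_{k+1}`:
  `(k₋/k₊) ((q-q⁻¹)²/(q+q⁻¹)) (G_k - ((q+q⁻¹)/ρ) [W_0, [W_0, G_k]_q]) ⊗ F²`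
  `+ ((q-q⁻¹)/(k₊(q+q⁻¹))) (q^{-1/2} w⁻¹ [W_0, G_k]_q ⊗ F K^{1/2}`
  `    + q^{1/2} w [G_k, W_1]_q ⊗ F K^{-1/2})`
  `+ G_{k+1} ⊗ 1 - (G_k/(q+q⁻¹)) ⊗ (w² K⁻¹ + w⁻² K)`. -/
  map_G (k : ℕ) : δ (Aq.gen s kp km (AqGen.G k)) =
    (km / kp * (s ^ 2 - (s ^ 2)⁻¹) ^ 2 / (s ^ 2 + (s ^ 2)⁻¹)) •
      ((gElt s kp km k
          - ((s ^ 2 + (s ^ 2)⁻¹) / (kp * km * (s ^ 2 + (s ^ 2)⁻¹) ^ 2)) •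
            ⁅Aq.gen s kp km (AqGen.Wm 0),
              qComm (s ^ 2) (Aq.gen s kp km (AqGen.Wm 0)) (gElt s kp km k)⁆)
        ⊗ₜ wMono 0 (Uq.gen s UqGen.F ^ 2))
    + ((s ^ 2 - (s ^ 2)⁻¹) / (kp * (s ^ 2 + (s ^ 2)⁻¹))) •
      (s⁻¹ • (qComm (s ^ 2) (Aq.gen s kp km (AqGen.Wm 0)) (gElt s kp km k)
          ⊗ₜ wMono (-1) (Uq.gen s UqGen.F * Uq.gen s UqGen.Kh))
        + s • (qComm (s ^ 2) (gElt s kp km k) (Aq.gen s kp km (AqGen.Wp 0))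
          ⊗ₜ wMono 1 (Uq.gen s UqGen.F * Uq.gen s UqGen.Kih)))
    + gElt s kp km (k + 1) ⊗ₜ 1
    - (s ^ 2 + (s ^ 2)⁻¹)⁻¹ •
      (gElt s kp km k ⊗ₜ
        (wMono 2 (Uq.gen s UqGen.Kih ^ 2) + wMono (-2) (Uq.gen s UqGen.Kh ^ 2)))

/-- The substitution `x(u) ↦ x(u w^e)` for `x(u) ∈ U_q(sl₂)((u⁻¹))`, placed in the second tensor
factor: `∑ aₙ u^{-n} ↦ ∑ (1 ⊗ aₙ w^{-e n}) u^{-n}`. -/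
def second (s kp km : ℂ) (e : ℤ) :
    HahnSeries ℤ (Uq s) →+ HahnSeries ℤ (CoactTarget s kp km) :=
  coeffMap fun n =>
    (Algebra.TensorProduct.includeRight :
        (Uq s)[T;T⁻¹] →ₐ[ℂ] CoactTarget s kp km).toRingHom.toAddMonoidHom.comp
      ((AddMonoidHom.mulRight (LaurentPolynomial.T (-(e * n)))).comp
        (LaurentPolynomial.C : Uq s →+* (Uq s)[T;T⁻¹]).toAddMonoidHom)

/-- `x(u) ∈ 𝒜_q((u⁻¹))` placed in the first tensor factor. -/
def first (s kp km : ℂ) :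
    HahnSeries ℤ (Aq s kp km) →+ HahnSeries ℤ (CoactTarget s kp km) :=
  mapCoeff (Algebra.TensorProduct.includeLeft : Aq s kp km →ₐ[ℂ] CoactTarget s kp km)

/-- The factor `∏_{p=1}^{2j} (U⁻¹/(q+q⁻¹))|_{u ↦ u q^{j+1/2-p}}` in `ℂ((u⁻¹))`, `N = 2j`. -/
def prefactor (s : ℂ) (N : ℕ) : HahnSeries ℤ ℂ :=
  ∏ p ∈ Finset.Icc 1 N,
    shift (s ^ ((N : ℤ) + 1 - 2 * p)) ((s ^ 2 + (s ^ 2)⁻¹)⁻¹ • (uCap s)⁻¹)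

end Coaction

end QOnsager

end

open scoped TensorProduct Kronecker LaurentPolynomial

noncomputable section

namespace QOnsager

set_option linter.unusedSectionVars false
set_option linter.unnecessarySeqFocus false

/-! ### Coefficientwise maps and substitutions on Laurent series in u⁻¹. -/

section CoeffMap

/-! Part (a) is dressing. The matrix U⁻¹/(q+q⁻¹) · ℒ(u/w) 𝒦(u) ℒ(uw) again solves the reflection
equation: the factors ℒ satisfy the exchange relations `rll` (with R(u/v)) and `lrl` (with R(uv),
from which w cancels), they commute with the entries of 𝒦, and a purely formal rearrangement
(`dressed_reflection`) then moves R through the product. A 2×2 matrix of series has the shape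
`kHalf` for some family of elements exactly when its entries have the right order and parity in u
and the off-diagonal entries have the prescribed scalar leading terms (`exists_kHalf`); the dressed
matrix passes this test. Since 𝒜_q is presented by the reflection equation, the resulting family
defines an algebra map δ with δ(𝒦) equal to the dressed matrix.

It remains to read off values. Leading diagonal coefficients give δ(W₀) and δ(W₁). For G_{k+1} one
expands the upper right entry of ℒ𝒦ℒ. The reflection equation of 𝒜_q, at the power of u where W₀ and
W₁ first enter, expresses the combinations U𝒲₊ − 𝒲₋ and U𝒲₋ − 𝒲₊ and the entry 𝒦₂₁ through
q-commutators of W₀, W₁ with the G_k (`current_relations`), and these are the elements in the stated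
formula. The same relations express every alternating generator through W₀, W₁ and the G_{k+1}
(`alternating_relations`), which gives uniqueness. Hence any evaluated coaction dresses 𝒦^{(1/2)}.

Part (b) is an induction on N = 2j. Inserting the dressed operators in the fusion recursion gives a
product ℒ₁𝒦₁ℒ₁ R ℒ₂𝒦₂ℒ₂. The fused exchange relation ℒ₁Rℒ₂ = ℒ₂Rℒ₁ (`lHalf_rMat_fusedL`) regroups it
as (ℒ₁ℒ₂)(𝒦₁R𝒦₂)(ℒ₁ℒ₂). If each bracket X satisfies X ℰ = ℰ X' with X' the fused operator of the
next spin, ℰ can be pulled to the left and ℱℰ = 1 finishes.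

So the heart is that each bracket preserves the image of ℰ (`algE_mul_fusedK`, `vLeg_fusedL_mul`,
`aLeg_lHalf_mul`). After ℰ of the previous spin is applied in the second leg, this image is cut out
by ordinary symmetry in two spin-1/2 legs (`swapInv_vLeg_algE_iff`). Thus it is enough to treat a
pair of such legs: ℒ₂(x)ℒ₁(qx) and R₁₃(t)R₂₃(qt) preserve symmetric tensors by direct computation.
So does 𝒦₁(u)R(qu²)𝒦₂(qu), because at u/v = q⁻¹ the matrix R(u/v) in the reflection equation becomes
a multiple of the antisymmetrizer. The reduction to pairs needs the fusion of R in its second leg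
(`vLeg_algE_mul_rMat`). -/

@[simp] theorem coeffMap_coeff {R S : Type*} [AddCommMonoid R] [AddCommMonoid S]
    (g : ℤ → R →+ S) (x : HahnSeries ℤ R) (n : ℤ) : (coeffMap g x).coeff n = g n (x.coeff n) := rfl

theorem coeffMap_single {R S : Type*} [AddCommMonoid R] [AddCommMonoid S]
    (g : ℤ → R →+ S) (n : ℤ) (r : R) :
    coeffMap g (HahnSeries.single n r) = HahnSeries.single n (g n r) := by
  ext m
  by_cases h : m = n
  · subst h; simp
  · simp [HahnSeries.coeff_single_of_ne h]

/-- The coefficient of a product sums over pairs of degrees with fixed sum, so compatibility of the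
maps `g n` degree by degree is enough. -/
theorem coeffMap_mul {R S : Type*} [Ring R] [Ring S] (g : ℤ → R →+ S)
    (hg : ∀ m n a b, g (m + n) (a * b) = g m a * g n b) (x y : HahnSeries ℤ R) :
    coeffMap g (x * y) = coeffMap g x * coeffMap g y := by
  ext n
  have hx : (coeffMap g x).support ⊆ x.support := fun k hk h0 => hk (by
    rw [coeffMap_coeff, h0, map_zero])
  have hy : (coeffMap g y).support ⊆ y.support := fun k hk h0 => hk (by
    rw [coeffMap_coeff, h0, map_zero])
  rw [coeffMap_coeff, HahnSeries.coeff_mul, HahnSeries.coeff_mul_left' x.isPWO_support hx,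
    map_sum]
  have : ∑ ij ∈ Finset.antidiagonal x.isPWO_support y.isPWO_support n,
        g n (x.coeff ij.1 * y.coeff ij.2)
      = ∑ ij ∈ Finset.antidiagonal x.isPWO_support y.isPWO_support n,
        (coeffMap g x).coeff ij.1 * (coeffMap g y).coeff ij.2 := by
    refine Finset.sum_congr rfl fun ij hij => ?_
    rw [← (Finset.mem_antidiagonal.1 hij).2.2, hg]
    rfl
  rw [this]
  symm
  -- Applying `g` can shrink the support of `y`; the surplus terms of the larger antidiagonal
  -- vanish.
  refine Finset.sum_subset_zero_on_sdiff (fun ij hij => ?_) (fun ij hij => ?_) (fun _ _ => rfl)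
  · rw [Finset.mem_antidiagonal] at hij ⊢
    exact ⟨hij.1, hy hij.2.1, hij.2.2⟩
  · rw [Finset.mem_sdiff, Finset.mem_antidiagonal, Finset.mem_antidiagonal] at hij
    have h : (coeffMap g y).coeff ij.2 = 0 := by
      by_contra h
      exact hij.2 ⟨hij.1.1, h, hij.1.2.2⟩
    rw [h, mul_zero]

/-- A multiplicative degreewise coefficient map as a ring homomorphism. -/
def coeffHom {R S : Type*} [Ring R] [Ring S] (g : ℤ → R →+ S)
    (h1 : g 0 1 = 1) (hg : ∀ m n a b, g (m + n) (a * b) = g m a * g n b) :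
    HahnSeries ℤ R →+* HahnSeries ℤ S where
  toFun := coeffMap g
  map_one' := by
    rw [← HahnSeries.single_zero_one, coeffMap_single, h1, HahnSeries.single_zero_one]
  map_mul' := coeffMap_mul g hg
  map_zero' := map_zero _
  map_add' := map_add _

variable {A B : Type*} [Ring A] [Algebra ℂ A] [Ring B] [Algebra ℂ B]

def shiftHom {a : ℂ} (ha : a ≠ 0) : HahnSeries ℤ A →+* HahnSeries ℤ A :=
  coeffHom (fun n => DistribSMul.toAddMonoidHom A (a ^ (-n))) (by simp) (by
    intro m n x y
    simp only [DistribSMul.toAddMonoidHom_apply]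
    rw [neg_add, zpow_add₀ ha, smul_mul_smul_comm])

theorem shiftHom_apply {a : ℂ} (ha : a ≠ 0) (x : HahnSeries ℤ A) : shiftHom ha x = shift a x := rfl

def scalHom (A : Type*) [Ring A] [Algebra ℂ A] : HahnSeries ℤ ℂ →+* HahnSeries ℤ A :=
  coeffHom (fun _ => (algebraMap ℂ A).toAddMonoidHom) (by simp) (by intros; simp)

theorem scalHom_apply (x : HahnSeries ℤ ℂ) : scalHom A x = scal A x := rfl

def mapHom (f : A →ₐ[ℂ] B) : HahnSeries ℤ A →+* HahnSeries ℤ B :=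
  coeffHom (fun _ => f.toRingHom.toAddMonoidHom) (by simp) (by intros; simp)

theorem mapHom_apply (f : A →ₐ[ℂ] B) (x : HahnSeries ℤ A) : mapHom f x = mapCoeff f x := rfl

def inUHom : HahnSeries ℤ A →+* TwoVar A :=
  coeffHom (fun _ => (HahnSeries.C : A →+* HahnSeries ℤ A).toAddMonoidHom) (by simp)
    (by intros; simp)

def scal2Hom (A : Type*) [Ring A] [Algebra ℂ A] : TwoVar ℂ →+* TwoVar A :=
  coeffHom (fun _ => scal A) (map_one (scalHom A)) (fun _ _ => map_mul (scalHom A))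

theorem scal2Hom_apply (x : TwoVar ℂ) : scal2Hom A x = scal2 A x := rfl

/-- A ring homomorphism applied to all coefficients of a two-variable series. -/
def map2Hom (f : A →ₐ[ℂ] B) : TwoVar A →+* TwoVar B :=
  coeffHom (fun _ => (mapCoeff f)) (map_one (mapHom f)) (fun _ _ => map_mul (mapHom f))

theorem map2Hom_inU (f : A →ₐ[ℂ] B) (x : HahnSeries ℤ A) :
    map2Hom f (inU x) = inU (mapCoeff f x) := by
  ext m n
  change f ((HahnSeries.C (x.coeff m)).coeff n) = (HahnSeries.C (f (x.coeff m))).coeff n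
  rw [HahnSeries.C_apply, HahnSeries.C_apply, HahnSeries.coeff_single, HahnSeries.coeff_single]
  split_ifs <;> simp

theorem map2Hom_inV (f : A →ₐ[ℂ] B) (x : HahnSeries ℤ A) :
    map2Hom f (inV x) = inV (mapCoeff f x) := by
  change coeffMap _ (HahnSeries.single 0 x) = HahnSeries.single 0 _
  rw [coeffMap_single]

theorem mapCoeff_scal (f : A →ₐ[ℂ] B) (x : HahnSeries ℤ ℂ) : mapCoeff f (scal A x) = scal B x := by
  ext n
  exact f.commutes _

theorem map2Hom_scal2 (f : A →ₐ[ℂ] B) (x : TwoVar ℂ) : map2Hom f (scal2 A x) = scal2 B x := by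
  ext m n
  exact f.commutes _

theorem shift_shift (a b : ℂ) (x : HahnSeries ℤ A) : shift a (shift b x) = shift (b * a) x := by
  ext n
  change a ^ (-n) • b ^ (-n) • x.coeff n = (b * a) ^ (-n) • x.coeff n
  rw [smul_smul, mul_zpow, mul_comm]

theorem shift_one (x : HahnSeries ℤ A) : shift 1 x = x := by
  ext n
  change (1 : ℂ) ^ (-n) • x.coeff n = _
  simp

theorem shift_scal (a : ℂ) (x : HahnSeries ℤ ℂ) : shift a (scal A x) = scal A (shift a x) := by
  ext n
  change a ^ (-n) • algebraMap ℂ A (x.coeff n) = algebraMap ℂ A (a ^ (-n) • x.coeff n)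
  rw [Algebra.smul_def, smul_eq_mul, map_mul]

theorem mapCoeff_shift (f : A →ₐ[ℂ] B) (a : ℂ) (x : HahnSeries ℤ A) :
    mapCoeff f (shift a x) = shift a (mapCoeff f x) := by
  ext n
  exact map_smul f _ _

theorem shift_single (a : ℂ) (n : ℤ) (x : A) :
    shift a (HahnSeries.single n x) = HahnSeries.single n (a ^ (-n) • x) :=
  coeffMap_single _ _ _

theorem smul_single' (a : ℂ) (n : ℤ) (x : A) :
    a • HahnSeries.single n x = HahnSeries.single n (a • x) := by
  ext m
  by_cases h : m = n
  · subst h; simp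
  · simp [HahnSeries.coeff_single_of_ne h]

theorem single_mem_center (n : ℤ) {x : A} (hx : x ∈ Subring.center A) :
    HahnSeries.single n x ∈ Subring.center (HahnSeries ℤ A) := by
  rw [Subring.mem_center_iff] at hx ⊢
  intro y
  ext m
  rw [HahnSeries.coeff_single_mul, HahnSeries.coeff_mul_single, hx]

theorem hahn_commute {R : Type*} [Ring R] {x y : HahnSeries ℤ R}
    (h : ∀ m n, x.coeff m * y.coeff n = y.coeff n * x.coeff m) : x * y = y * x := by
  ext m
  rw [HahnSeries.coeff_mul, HahnSeries.coeff_mul]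
  refine Finset.sum_bij' (fun ij _ => (ij.2, ij.1)) (fun ij _ => (ij.2, ij.1)) ?_ ?_ ?_ ?_ ?_
  · intro ij h
    rw [Finset.mem_antidiagonal] at h ⊢
    exact ⟨h.2.1, h.1, by rw [add_comm]; exact h.2.2⟩
  · intro ij h
    rw [Finset.mem_antidiagonal] at h ⊢
    exact ⟨h.2.1, h.1, by rw [add_comm]; exact h.2.2⟩
  · intros; rfl
  · intros; rfl
  · intro ij _
    exact h _ _

theorem scal_mem_center (x : HahnSeries ℤ ℂ) : scal A x ∈ Subring.center (HahnSeries ℤ A) := by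
  rw [Subring.mem_center_iff]
  exact fun y => hahn_commute fun m n => (Algebra.commutes _ _).symm

theorem smul_mul_hahn (c : ℂ) (x y : HahnSeries ℤ A) : (c • x) * y = c • (x * y) :=
  smul_mul_assoc c x y

theorem mul_smul_hahn (c : ℂ) (x y : HahnSeries ℤ A) : x * (c • y) = c • (x * y) :=
  mul_smul_comm c x y

theorem algebraMap_eq_single (c : ℂ) :
    algebraMap ℂ (HahnSeries ℤ A) c = HahnSeries.single 0 (algebraMap ℂ A c) := by
  rw [HahnSeries.algebraMap_apply]; rfl

/-- The ℂ-algebra structure on the field ℂ((u⁻¹)) passes through power series; it has to be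
identified with the inclusion of constants. -/
theorem algebraMap_laurent (c : ℂ) :
    algebraMap ℂ (HahnSeries ℤ ℂ) c = HahnSeries.single 0 c := by
  rw [HahnSeries.algebraMap_apply', PowerSeries.algebraMap_apply]
  exact HahnSeries.ofPowerSeries_C c

theorem algebraMap_twoVar (c : ℂ) :
    algebraMap ℂ (TwoVar ℂ) c = HahnSeries.single 0 (HahnSeries.single 0 c) := by
  rw [HahnSeries.algebraMap_apply', PowerSeries.algebraMap_apply]
  refine (HahnSeries.ofPowerSeries_C _).trans ?_
  rw [algebraMap_laurent]; rfl

theorem scal_algebraMap (c : ℂ) :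
    scal A (algebraMap ℂ (HahnSeries ℤ ℂ) c) = algebraMap ℂ (HahnSeries ℤ A) c := by
  rw [algebraMap_eq_single]
  rw [algebraMap_laurent]
  exact coeffMap_single _ _ _

theorem scal_smul (c : ℂ) (x : HahnSeries ℤ ℂ) : scal A (c • x) = c • scal A x := by
  ext n
  change algebraMap ℂ A (c • x.coeff n) = c • algebraMap ℂ A (x.coeff n)
  rw [smul_eq_mul, map_mul, Algebra.smul_def]

theorem shift_algebraMap (a c : ℂ) :
    shift a (algebraMap ℂ (HahnSeries ℤ A) c) = algebraMap ℂ (HahnSeries ℤ A) c := by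
  rw [algebraMap_eq_single, shift_single]; simp

theorem mapCoeff_smul (f : A →ₐ[ℂ] B) (c : ℂ) (x : HahnSeries ℤ A) :
    mapCoeff f (c • x) = c • mapCoeff f x := by
  ext n
  exact map_smul f _ _

theorem shift_algebraMap_laurent (a c : ℂ) :
    shift a (algebraMap ℂ (HahnSeries ℤ ℂ) c) = algebraMap ℂ (HahnSeries ℤ ℂ) c := by
  rw [algebraMap_laurent, shift_single]; simp

theorem scal2_algebraMap (c : ℂ) :
    scal2 A (algebraMap ℂ (TwoVar ℂ) c) = HahnSeries.C (HahnSeries.C (algebraMap ℂ A c)) := by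
  rw [algebraMap_twoVar]
  change coeffMap _ _ = _
  rw [coeffMap_single]
  change HahnSeries.single 0 (coeffMap _ _) = _
  rw [coeffMap_single]
  rfl

theorem constMat_eq (A : Type*) [Ring A] [Algebra ℂ A] {m n : Type*} (M : Matrix m n ℂ) :
    constMat A M = M.map (algebraMap ℂ (HahnSeries ℤ A)) := by
  ext i j : 1
  exact (algebraMap_eq_single _).symm

end CoeffMap

/-! ### Order and parity of series: the spaces u^{-d} A[[u⁻²]]. -/

section Graded

variable {A : Type*} [Ring A] [Algebra ℂ A] {B : Type*} [Ring B] [Algebra ℂ B]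

/-- `x ∈ u^{-d} A[[u^{-2}]]`. -/
def Graded (d : ℤ) (x : HahnSeries ℤ A) : Prop := ∀ n, x.coeff n ≠ 0 → ∃ k : ℕ, n = d + 2 * k

theorem Graded.coeff_eq_zero_of_lt {d : ℤ} {x : HahnSeries ℤ A} (h : Graded d x) {n : ℤ}
    (hn : n < d) : x.coeff n = 0 := by
  by_contra h0
  obtain ⟨k, hk⟩ := h n h0
  omega

theorem Graded.add {d : ℤ} {x y : HahnSeries ℤ A} (hx : Graded d x) (hy : Graded d y) :
    Graded d (x + y) := by
  intro n hn
  by_cases h : x.coeff n = 0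
  · refine hy n fun h0 => hn ?_
    rw [HahnSeries.coeff_add, h, h0, add_zero]
  · exact hx n h

theorem Graded.smul {d : ℤ} {x : HahnSeries ℤ A} (c : ℂ) (hx : Graded d x) :
    Graded d (c • x) := by
  intro n hn
  refine hx n fun h0 => hn ?_
  rw [HahnSeries.coeff_smul, h0, smul_zero]

theorem Graded.neg {d : ℤ} {x : HahnSeries ℤ A} (hx : Graded d x) : Graded d (-x) := by
  intro n hn
  refine hx n fun h0 => hn ?_
  rw [HahnSeries.coeff_neg, h0, neg_zero]

theorem Graded.sub {d : ℤ} {x y : HahnSeries ℤ A} (hx : Graded d x) (hy : Graded d y) :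
    Graded d (x - y) := by
  rw [sub_eq_add_neg]
  exact hx.add hy.neg

theorem Graded.mono {d e : ℤ} {x : HahnSeries ℤ A} (hx : Graded d x) (k : ℕ)
    (h : d = e + 2 * k) : Graded e x := by
  intro n hn
  obtain ⟨l, hl⟩ := hx n hn
  exact ⟨k + l, by push_cast; omega⟩

theorem Graded.mul {d e : ℤ} {x y : HahnSeries ℤ A} (hx : Graded d x) (hy : Graded e y) :
    Graded (d + e) (x * y) := by
  intro n hn
  rw [HahnSeries.coeff_mul] at hn
  obtain ⟨ij, hij, -⟩ := Finset.exists_ne_zero_of_sum_ne_zero hn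
  rw [Finset.mem_antidiagonal] at hij
  obtain ⟨k, hk⟩ := hx _ hij.1
  obtain ⟨l, hl⟩ := hy _ hij.2.1
  exact ⟨k + l, by have := hij.2.2; push_cast; omega⟩

theorem Graded.coeff_mul {d e : ℤ} {x y : HahnSeries ℤ A} (hx : Graded d x) (hy : Graded e y) :
    (x * y).coeff (d + e) = x.coeff d * y.coeff e := by
  rw [HahnSeries.coeff_mul]
  refine Finset.sum_eq_single (d, e) (fun ij hij hne => ?_) (fun h => ?_)
  · rw [Finset.mem_antidiagonal] at hij
    obtain ⟨k, hk⟩ := hx _ hij.1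
    obtain ⟨l, hl⟩ := hy _ hij.2.1
    refine absurd (Prod.ext ?_ ?_) hne
    · have := hij.2.2; change ij.1 = d; omega
    · have := hij.2.2; change ij.2 = e; omega
  · rw [Finset.mem_antidiagonal] at h
    by_contra h0
    exact h ⟨fun h1 => h0 (by rw [h1, zero_mul]), fun h1 => h0 (by rw [h1, mul_zero]), rfl⟩

theorem Graded.single (d : ℤ) (a : A) : Graded d (HahnSeries.single d a) := by
  intro n hn
  refine ⟨0, ?_⟩
  by_contra h
  exact hn (HahnSeries.coeff_single_of_ne (by simpa using h))

theorem Graded.coeffMap {d : ℤ} {x : HahnSeries ℤ A} (hx : Graded d x) (g : ℤ → A →+ B) :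
    Graded d (coeffMap g x) := by
  intro n hn
  refine hx n fun h0 => hn ?_
  rw [coeffMap_coeff, h0, map_zero]

theorem Graded.one : Graded 0 (1 : HahnSeries ℤ A) := Graded.single 0 1

theorem Graded.pow {d : ℤ} {x : HahnSeries ℤ A} (hx : Graded d x) (k : ℕ) :
    Graded (k * d) (x ^ k) := by
  induction k with
  | zero => simpa using Graded.one
  | succ k ih =>
    rw [pow_succ]
    convert ih.mul hx using 1
    push_cast; ring

theorem Graded.coeff_pow {d : ℤ} {x : HahnSeries ℤ A} (hx : Graded d x) (k : ℕ) :
    (x ^ k).coeff (k * d) = x.coeff d ^ k := by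
  induction k with
  | zero => simp
  | succ k ih =>
    rw [pow_succ, pow_succ, ← ih, ← (hx.pow k).coeff_mul hx]
    congr 1
    push_cast; ring

/-- The explicit inverse of `a u² + b u⁻²` in `ℂ((u⁻¹))`. -/
def quadInv (a b : ℂ) : HahnSeries ℤ ℂ :=
  HahnSeries.ofSuppBddBelow
    (fun n => if 2 ≤ n ∧ (4 : ℤ) ∣ n - 2 then a⁻¹ * (-b / a) ^ ((n - 2) / 4) else 0)
    ⟨2, fun n hn => by
      by_contra h
      exact hn (if_neg fun h' => h h'.1)⟩

theorem quadInv_coeff (a b : ℂ) (n : ℤ) : (quadInv a b).coeff n =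
    if 2 ≤ n ∧ (4 : ℤ) ∣ n - 2 then a⁻¹ * (-b / a) ^ ((n - 2) / 4) else 0 := rfl

theorem quadInv_graded (a b : ℂ) : Graded 2 (quadInv a b) := by
  intro n hn
  rw [quadInv_coeff] at hn
  have h : 2 ≤ n ∧ (4 : ℤ) ∣ n - 2 := by
    by_contra h
    exact hn (if_neg h)
  obtain ⟨h1, k, hk⟩ := h
  exact ⟨(2 * k).toNat, by omega⟩

/-- Geometric series: (a u² + b u⁻²)⁻¹ = a⁻¹ ∑ (−b/a)^k u^{−2−4k}. Only exponents divisible by 4 can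
occur in the product. -/
theorem quad_mul_quadInv {a b : ℂ} (ha : a ≠ 0) (hb : b ≠ 0) :
    (HahnSeries.single (-2) a + HahnSeries.single 2 b) * quadInv a b = 1 := by
  ext n
  rw [add_mul, HahnSeries.coeff_add, HahnSeries.coeff_single_mul, HahnSeries.coeff_single_mul,
    quadInv_coeff, quadInv_coeff, HahnSeries.coeff_one]
  by_cases h4 : (4 : ℤ) ∣ n
  · obtain ⟨k, rfl⟩ := h4
    have e1 : (4 : ℤ) * k - -2 - 2 = 4 * k := by ring
    have e2 : (4 : ℤ) * k - 2 - 2 = 4 * (k - 1) := by ring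
    rw [e1, e2, Int.mul_ediv_cancel_left _ (by norm_num), Int.mul_ediv_cancel_left _ (by norm_num)]
    rcases lt_trichotomy k 0 with h | h | h
    · rw [if_neg (by omega), if_neg (by omega), if_neg (by omega)]; simp
    · subst h
      rw [if_pos (by norm_num), if_neg (by omega), if_pos (by norm_num)]
      simp [ha]
    · rw [if_pos ⟨by omega, dvd_mul_right _ _⟩, if_pos ⟨by omega, dvd_mul_right _ _⟩,
        if_neg (by omega)]
      have : (-b / a) ≠ 0 := div_ne_zero (neg_ne_zero.2 hb) ha
      rw [zpow_sub_one₀ this]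
      field_simp
      ring
  · rw [if_neg (by omega), if_neg (by omega), if_neg (by rintro rfl; exact h4 (dvd_zero _))]
    simp

end Graded

/-! ### The series U and its inverse. -/

section UCap

theorem qSq_sub_ne {s : ℂ} (hs : s ≠ 0) (hq : ∀ n : ℕ, 0 < n → (s ^ 2) ^ n ≠ 1) :
    s ^ 2 - (s ^ 2)⁻¹ ≠ 0 := by
  intro h
  refine hq 2 (by norm_num) ?_
  field_simp at h
  linear_combination h

theorem qSq_add_ne {s : ℂ} (hs : s ≠ 0) (hq : ∀ n : ℕ, 0 < n → (s ^ 2) ^ n ≠ 1) :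
    s ^ 2 + (s ^ 2)⁻¹ ≠ 0 := by
  intro h
  -- q + q⁻¹ = 0 means q² = −1, hence q⁴ = 1.
  refine hq 4 (by norm_num) ?_
  field_simp at h
  linear_combination (s ^ 4 - 1) * h

theorem uVar_mul_uInv (A : Type*) [Ring A] : uVar A * uInv A = 1 := by
  rw [uVar, uInv, HahnSeries.single_mul_single]
  simp

theorem uInv_mul_uVar (A : Type*) [Ring A] : uInv A * uVar A = 1 := by
  rw [uVar, uInv, HahnSeries.single_mul_single]
  simp

theorem uCap_eq (s : ℂ) : uCap s =
    HahnSeries.single (-2) (s ^ 2 * (s ^ 2 + (s ^ 2)⁻¹)⁻¹)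
      + HahnSeries.single 2 ((s ^ 2)⁻¹ * (s ^ 2 + (s ^ 2)⁻¹)⁻¹) := by
  rw [uCap, uVar, uInv, HahnSeries.single_pow, HahnSeries.single_pow, smul_single', smul_single',
    smul_add, smul_single', smul_single']
  simp [mul_comm]

variable {s : ℂ} (hs : s ≠ 0) (hq : s ^ 2 + (s ^ 2)⁻¹ ≠ 0)
include hs hq

theorem uCap_inv : (uCap s)⁻¹ =
    quadInv (s ^ 2 * (s ^ 2 + (s ^ 2)⁻¹)⁻¹) ((s ^ 2)⁻¹ * (s ^ 2 + (s ^ 2)⁻¹)⁻¹) := by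
  rw [uCap_eq]
  refine (eq_inv_of_mul_eq_one_right (quad_mul_quadInv ?_ ?_)).symm
  · exact mul_ne_zero (pow_ne_zero _ hs) (inv_ne_zero hq)
  · exact mul_ne_zero (inv_ne_zero (pow_ne_zero _ hs)) (inv_ne_zero hq)

theorem uCap_mul_inv : uCap s * (uCap s)⁻¹ = 1 := by
  rw [uCap_inv hs hq, uCap_eq]
  refine quad_mul_quadInv ?_ ?_
  · exact mul_ne_zero (pow_ne_zero _ hs) (inv_ne_zero hq)
  · exact mul_ne_zero (inv_ne_zero (pow_ne_zero _ hs)) (inv_ne_zero hq)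

theorem uCap_inv_graded : Graded 2 (uCap s)⁻¹ := by
  rw [uCap_inv hs hq]
  exact quadInv_graded _ _

theorem uCap_inv_coeff_two :
    ((uCap s)⁻¹).coeff 2 = (s ^ 2 + (s ^ 2)⁻¹) * (s ^ 2)⁻¹ := by
  rw [uCap_inv hs hq, quadInv_coeff, if_pos (by norm_num)]
  simp [mul_comm]

end UCap

/-! ### Generating functions ∑ a_k U^{-k-1}. -/

section GenFun

variable {A : Type*} [Ring A] [Algebra ℂ A] {B : Type*} [Ring B] [Algebra ℂ B]

theorem genFun_coeff_nat (s : ℂ) (a : ℕ → A) (n : ℕ) : (genFun s a).coeff n =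
    ∑ k ∈ Finset.range n, (((uCap s)⁻¹) ^ (k + 1)).coeff (n : ℤ) • a k := by
  rw [genFun, HahnSeries.ofPowerSeries_apply_coeff, PowerSeries.coeff_mk]

theorem genFun_coeff_neg (s : ℂ) (a : ℕ → A) {n : ℤ} (hn : n < 0) :
    (genFun s a).coeff n = 0 := by
  rw [genFun, HahnSeries.ofPowerSeries_apply]
  refine HahnSeries.embDomain_of_notMem_range ?_
  rintro ⟨k, rfl⟩
  exact absurd hn (by simp)

variable {s : ℂ} (hs : s ≠ 0) (hq : s ^ 2 + (s ^ 2)⁻¹ ≠ 0)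
include hs hq

theorem uCap_inv_pow_graded (k : ℕ) : Graded (2 * k) ((uCap s)⁻¹ ^ k) := by
  rw [mul_comm]
  exact (uCap_inv_graded hs hq).pow k

/-- U^{-k-1} starts at u^{-2k-2}, so any cut-off `M` beyond which no term reaches degree n may
replace the one in the definition. -/
theorem genFun_coeff (a : ℕ → A) (n : ℤ) (M : ℕ) (hM : n ≤ 2 * M + 1) : (genFun s a).coeff n =
    ∑ k ∈ Finset.range M, (((uCap s)⁻¹) ^ (k + 1)).coeff n • a k := by
  have hz : ∀ k : ℕ, n < 2 * (k + 1) → (((uCap s)⁻¹) ^ (k + 1)).coeff n • a k = 0 := by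
    intro k hk
    rw [(uCap_inv_pow_graded hs hq (k + 1)).coeff_eq_zero_of_lt (by push_cast; exact hk), zero_smul]
  rcases lt_or_ge n 0 with h | h
  · rw [genFun_coeff_neg _ _ h]
    exact (Finset.sum_eq_zero fun k _ => hz k (by omega)).symm
  · lift n to ℕ using h
    rw [genFun_coeff_nat]
    rcases le_total n M with h | h
    · refine Finset.sum_subset (Finset.range_subset_range.2 h) fun k _ hk => hz k ?_
      rw [Finset.mem_range] at hk; omega
    · refine (Finset.sum_subset (Finset.range_subset_range.2 h) fun k _ hk => hz k ?_).symm
      rw [Finset.mem_range] at hk; omega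

theorem genFun_graded (a : ℕ → A) : Graded 2 (genFun s a) := by
  intro n hn
  rw [genFun_coeff hs hq a n n.toNat (by omega)] at hn
  obtain ⟨k, -, hk⟩ := Finset.exists_ne_zero_of_sum_ne_zero hn
  obtain ⟨l, hl⟩ := uCap_inv_pow_graded hs hq (k + 1) n fun h => hk (by rw [h, zero_smul])
  exact ⟨k + l, by push_cast at hl ⊢; omega⟩

theorem uCap_inv_pow_coeff (k : ℕ) : ((uCap s)⁻¹ ^ k).coeff (2 * k) =
    ((s ^ 2 + (s ^ 2)⁻¹) * (s ^ 2)⁻¹) ^ k := by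
  rw [mul_comm, (uCap_inv_graded hs hq).coeff_pow, uCap_inv_coeff_two hs hq]

theorem genFun_coeff_even (a : ℕ → A) (m : ℕ) : (genFun s a).coeff (2 * (m + 1)) =
    ((s ^ 2 + (s ^ 2)⁻¹) * (s ^ 2)⁻¹) ^ (m + 1) • a m +
    ∑ k ∈ Finset.range m, (((uCap s)⁻¹) ^ (k + 1)).coeff (2 * (m + 1)) • a k := by
  rw [genFun_coeff hs hq a _ (m + 1) (by push_cast; omega), Finset.sum_range_succ, add_comm]
  congr 2
  exact_mod_cast uCap_inv_pow_coeff hs hq (m + 1)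

theorem leading_ne_zero : (s ^ 2 + (s ^ 2)⁻¹) * (s ^ 2)⁻¹ ≠ 0 :=
  mul_ne_zero hq (inv_ne_zero (pow_ne_zero _ hs))

/-- The coefficient of u^{-2m-2} involves a_0, …, a_m only, and a_m with the nonzero factor
((q+q⁻¹)q⁻¹)^{m+1}: a triangular system. -/
theorem genFun_injective : Function.Injective (genFun (A := A) s) := by
  intro a b h
  funext m
  induction m using Nat.strong_induction_on with
  | _ m ih =>
    have h1 := congrArg (fun x => x.coeff (2 * ((m : ℤ) + 1))) h
    simp only [genFun_coeff_even hs hq] at h1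
    rw [Finset.sum_congr rfl fun k hk => by rw [ih k (Finset.mem_range.1 hk)]] at h1
    exact smul_right_injective A (pow_ne_zero (m + 1) (leading_ne_zero hs hq)) (add_right_cancel h1)

/-- The same triangular system solved recursively; parity is what makes the odd coefficients agree.
-/
theorem exists_genFun {x : HahnSeries ℤ A} (hx : Graded 2 x) : ∃ a : ℕ → A, genFun s a = x := by
  let c := (s ^ 2 + (s ^ 2)⁻¹) * (s ^ 2)⁻¹
  let a : ℕ → A := fun n => Nat.strongRec (motive := fun _ => A) (fun m f =>
    (c ^ (m + 1))⁻¹ • (x.coeff (2 * (m + 1)) -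
      ∑ k : Fin m, (((uCap s)⁻¹) ^ ((k : ℕ) + 1)).coeff (2 * ((m : ℤ) + 1)) • f k k.2)) n
  have ha : ∀ m, a m = (c ^ (m + 1))⁻¹ • (x.coeff (2 * (m + 1)) -
      ∑ k : Fin m, (((uCap s)⁻¹) ^ ((k : ℕ) + 1)).coeff (2 * ((m : ℤ) + 1)) • a k) := fun m => by
    conv_lhs => rw [show a m = Nat.strongRec (motive := fun _ => A) _ m from rfl, Nat.strongRec_eq]
  refine ⟨a, ?_⟩
  have key : ∀ m : ℕ, (genFun s a).coeff (2 * (m + 1)) = x.coeff (2 * (m + 1)) := by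
    intro m
    rw [genFun_coeff_even hs hq, ha m, smul_smul,
      mul_inv_cancel₀ (pow_ne_zero _ (leading_ne_zero hs hq)), one_smul, Finset.sum_range,
      sub_add_cancel]
  ext n
  by_cases h : ∃ m : ℕ, n = 2 * (m + 1)
  · obtain ⟨m, rfl⟩ := h
    exact key m
  · have h1 : (genFun s a).coeff n = 0 := by
      by_contra h0
      obtain ⟨k, hk⟩ := genFun_graded hs hq a n h0
      exact h ⟨k, by omega⟩
    have h2 : x.coeff n = 0 := by
      by_contra h0
      obtain ⟨k, hk⟩ := hx n h0
      exact h ⟨k, by omega⟩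
    rw [h1, h2]

theorem genFun_coeff_two (a : ℕ → A) :
    (genFun s a).coeff 2 = ((s ^ 2 + (s ^ 2)⁻¹) * (s ^ 2)⁻¹) • a 0 := by
  simpa using genFun_coeff_even hs hq a 0

omit hs hq in
theorem coeffMap_genFun (φ : A →ₗ[ℂ] B) (a : ℕ → A) :
    coeffMap (fun _ => φ.toAddMonoidHom) (genFun s a) = genFun s (fun k => φ (a k)) := by
  ext n
  rw [coeffMap_coeff]
  rcases lt_or_ge n 0 with h | h
  · rw [genFun_coeff_neg _ _ h, genFun_coeff_neg _ _ h, map_zero]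
  · lift n to ℕ using h
    rw [genFun_coeff_nat, genFun_coeff_nat]
    simp

omit hs hq in
theorem genFun_add (a b : ℕ → A) : genFun s (fun k => a k + b k) = genFun s a + genFun s b := by
  ext n
  rw [HahnSeries.coeff_add]
  rcases lt_or_ge n 0 with h | h
  · simp [genFun_coeff_neg _ _ h]
  · lift n to ℕ using h
    simp [genFun_coeff_nat, Finset.sum_add_distrib]

omit hs hq in
theorem genFun_smul (c : ℂ) (a : ℕ → A) : genFun s (fun k => c • a k) = c • genFun s a := by
  ext n
  rw [HahnSeries.coeff_smul]
  rcases lt_or_ge n 0 with h | h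
  · simp [genFun_coeff_neg _ _ h]
  · lift n to ℕ using h
    simp [genFun_coeff_nat, Finset.smul_sum, smul_smul, mul_comm]

theorem scal_uCap_mul_coeff (x : HahnSeries ℤ A) (n : ℤ) : (scal A (uCap s) * x).coeff n =
    (s ^ 2 * (s ^ 2 + (s ^ 2)⁻¹)⁻¹) • x.coeff (n + 2) +
    ((s ^ 2)⁻¹ * (s ^ 2 + (s ^ 2)⁻¹)⁻¹) • x.coeff (n - 2) := by
  rw [uCap_eq, map_add]
  have h : ∀ k c, scal A (HahnSeries.single k c) = HahnSeries.single k (algebraMap ℂ A c) :=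
    fun k c => coeffMap_single _ _ _
  rw [h, h, add_mul, HahnSeries.coeff_add, HahnSeries.coeff_single_mul,
    HahnSeries.coeff_single_mul, Algebra.smul_def, Algebra.smul_def]
  congr 3

/-- Multiplication by U shifts the index and splits off the constant a_0. This is how the element
G_0 enters later. -/
theorem scal_uCap_mul_genFun (a : ℕ → A) : scal A (uCap s) * genFun s a =
    HahnSeries.single 0 (a 0) + genFun s (fun k => a (k + 1)) := by
  ext n
  have hsc : scal ℂ (uCap s) = uCap s := by ext n; rfl
  have hU : ∀ k : ℕ, (s ^ 2 * (s ^ 2 + (s ^ 2)⁻¹)⁻¹) * (((uCap s)⁻¹) ^ (k + 1)).coeff (n + 2) +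
      ((s ^ 2)⁻¹ * (s ^ 2 + (s ^ 2)⁻¹)⁻¹) * (((uCap s)⁻¹) ^ (k + 1)).coeff (n - 2)
      = (((uCap s)⁻¹) ^ k).coeff n := by
    intro k
    have h := scal_uCap_mul_coeff hs hq (((uCap s)⁻¹) ^ (k + 1)) n
    rw [hsc, pow_succ', ← mul_assoc, uCap_mul_inv hs hq, one_mul] at h
    rw [h, pow_succ' (uCap s)⁻¹ k]
    rfl
  rw [scal_uCap_mul_coeff hs hq, HahnSeries.coeff_add,
    genFun_coeff hs hq a (n + 2) (n.toNat + 3) (by push_cast; omega),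
    genFun_coeff hs hq a (n - 2) (n.toNat + 3) (by push_cast; omega),
    genFun_coeff hs hq _ n (n.toNat + 2) (by push_cast; omega), Finset.smul_sum, Finset.smul_sum,
    ← Finset.sum_add_distrib]
  simp only [smul_smul, ← add_smul, hU]
  rw [Finset.sum_range_succ', add_comm, pow_zero, HahnSeries.coeff_one, HahnSeries.coeff_single]
  congr 1
  split_ifs <;> simp

end GenFun

/-! ### The shape of the fundamental K-operator and its characterization. -/

section KHalf

variable {A : Type*} [Ring A] [Algebra ℂ A] {B : Type*} [Ring B] [Algebra ℂ B]

theorem mapCoeff_uVar (f : A →ₐ[ℂ] B) : mapCoeff f (uVar A) = uVar B := by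
  change coeffMap _ _ = _
  rw [uVar, coeffMap_single]
  exact congrArg _ (map_one f)

theorem mapCoeff_uInv (f : A →ₐ[ℂ] B) : mapCoeff f (uInv A) = uInv B := by
  change coeffMap _ _ = _
  rw [uInv, coeffMap_single]
  exact congrArg _ (map_one f)

theorem mapCoeff_mul (f : A →ₐ[ℂ] B) (x y : HahnSeries ℤ A) :
    mapCoeff f (x * y) = mapCoeff f x * mapCoeff f y := map_mul (mapHom f) x y

theorem mapCoeff_one (f : A →ₐ[ℂ] B) : mapCoeff f (1 : HahnSeries ℤ A) = 1 :=
  map_one (mapHom f)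

theorem mapCoeff_genFun (f : A →ₐ[ℂ] B) (s : ℂ) (a : ℕ → A) :
    mapCoeff f (genFun s a) = genFun s (fun k => f (a k)) :=
  coeffMap_genFun f.toLinearMap a

theorem kHalf_map (f : A →ₐ[ℂ] B) (s kp km : ℂ) (g : AqGen → A) :
    (kHalf s kp km g).map (mapCoeff f) = kHalf s kp km (fun x => f (g x)) := by
  ext i j : 1
  fin_cases i <;> fin_cases j <;>
    simp [kHalf, mapCoeff_smul, mapCoeff_mul, mapCoeff_uVar, mapCoeff_uInv, mapCoeff_genFun,
      mapCoeff_one]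

theorem uVar_mul_uInv_mul (x : HahnSeries ℤ A) : uVar A * (uInv A * x) = x := by
  rw [← mul_assoc, uVar_mul_uInv, one_mul]

theorem uInv_mul_uVar_mul (x : HahnSeries ℤ A) : uInv A * (uVar A * x) = x := by
  rw [← mul_assoc, uInv_mul_uVar, one_mul]

theorem uVar_mem_center (A : Type*) [Ring A] [Algebra ℂ A] :
    uVar A ∈ Subring.center (HahnSeries ℤ A) := single_mem_center _ (Subring.one_mem _)

theorem uInv_mem_center (A : Type*) [Ring A] [Algebra ℂ A] :
    uInv A ∈ Subring.center (HahnSeries ℤ A) := single_mem_center _ (Subring.one_mem _)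

/-- The inverse of `q² u² - q⁻² u⁻²`. -/
def wInv (A : Type*) [Ring A] [Algebra ℂ A] (s : ℂ) : HahnSeries ℤ A :=
  scal A (quadInv ((s ^ 2) ^ 2) (-((s ^ 2)⁻¹ ^ 2)))

theorem wInv_mul {s : ℂ} (hs : s ≠ 0) (x : HahnSeries ℤ A) :
    wInv A s * ((s ^ 2) ^ 2 • (uVar A * (uVar A * x))
      - (s ^ 2)⁻¹ ^ 2 • (uInv A * (uInv A * x))) = x := by
  have h := congrArg (scalHom A) (quad_mul_quadInv (a := (s ^ 2) ^ 2) (b := -((s ^ 2)⁻¹ ^ 2))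
    (by positivity) (by simp [hs]))
  rw [map_mul, map_one, map_add] at h
  have h2 : ∀ k c, scalHom A (HahnSeries.single k c) = HahnSeries.single k (algebraMap ℂ A c) :=
    fun k c => coeffMap_single _ _ _
  rw [h2, h2, scalHom_apply] at h
  have h3 : HahnSeries.single (-2) (algebraMap ℂ A ((s ^ 2) ^ 2))
      = (s ^ 2) ^ 2 • (uVar A * uVar A) := by
    rw [uVar, HahnSeries.single_mul_single, smul_single', Algebra.algebraMap_eq_smul_one]
    norm_num
  have h4 : HahnSeries.single 2 (algebraMap ℂ A (-((s ^ 2)⁻¹ ^ 2)))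
      = -((s ^ 2)⁻¹ ^ 2 • (uInv A * uInv A)) := by
    rw [uInv, HahnSeries.single_mul_single, smul_single', Algebra.algebraMap_eq_smul_one]
    norm_num
  rw [h3, h4, ← sub_eq_add_neg, (Subring.mem_center_iff.1 (scal_mem_center _) _)] at h
  conv_rhs => rw [← one_mul x, ← h]
  rw [wInv, mul_assoc, sub_mul, smul_mul_hahn, smul_mul_hahn, mul_assoc, mul_assoc]

theorem wInv_graded (A : Type*) [Ring A] [Algebra ℂ A] (s : ℂ) : Graded 2 (wInv A s) :=
  (quadInv_graded _ _).coeffMap _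

theorem uVar_graded : Graded (-1) (uVar A) := Graded.single _ _

theorem uInv_graded : Graded 1 (uInv A) := Graded.single _ _

variable {s kp km : ℂ} (hs : s ≠ 0) (hq : s ^ 2 + (s ^ 2)⁻¹ ≠ 0) (hkp : kp ≠ 0) (hkm : km ≠ 0)
include hs hq

theorem kHalf_graded (g : AqGen → A) :
    Graded 1 (kHalf s kp km g 0 0) ∧ Graded 0 (kHalf s kp km g 0 1) ∧
    Graded 0 (kHalf s kp km g 1 0) ∧ Graded 1 (kHalf s kp km g 1 1) := by
  have h1 : ∀ a : ℕ → A, Graded 1 (uVar A * genFun s a) := fun a => by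
    simpa using uVar_graded.mul (genFun_graded hs hq a)
  have h2 : ∀ a : ℕ → A, Graded 1 (uInv A * genFun s a) := fun a =>
    (uInv_graded.mul (genFun_graded hs hq a)).mono 1 (by norm_num)
  have h3 : ∀ a : ℕ → A, Graded 0 (genFun s a) := fun a =>
    (genFun_graded hs hq a).mono 1 (by norm_num)
  refine ⟨?_, ?_, ?_, ?_⟩
  · exact ((h1 _).smul _).sub ((h2 _).smul _)
  · exact ((h3 _).smul _).add (Graded.one.smul _)
  · exact ((h3 _).smul _).add (Graded.one.smul _)
  · exact ((h1 _).smul _).sub ((h2 _).smul _)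

theorem kHalf_coeff_00 (g : AqGen → A) :
    (kHalf s kp km g 0 0).coeff 1 = (s ^ 2 + (s ^ 2)⁻¹) • g (AqGen.Wm 0) := by
  have e1 := uVar_graded.coeff_mul (genFun_graded hs hq fun k => g (AqGen.Wm k))
  have e2 := (uInv_graded.mul (genFun_graded hs hq fun k => g (AqGen.Wp k))).coeff_eq_zero_of_lt
    (n := 1) (by norm_num)
  norm_num at e1
  change ((s ^ 2) • _ - (s ^ 2)⁻¹ • _ : HahnSeries ℤ A).coeff 1 = _
  rw [HahnSeries.coeff_sub, HahnSeries.coeff_smul, HahnSeries.coeff_smul, e1, e2,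
    genFun_coeff_two hs hq, uVar, HahnSeries.coeff_single_same, one_mul, smul_smul, smul_zero,
    sub_zero]
  congr 1
  field_simp

theorem kHalf_coeff_11 (g : AqGen → A) :
    (kHalf s kp km g 1 1).coeff 1 = (s ^ 2 + (s ^ 2)⁻¹) • g (AqGen.Wp 0) := by
  have e1 := uVar_graded.coeff_mul (genFun_graded hs hq fun k => g (AqGen.Wp k))
  have e2 := (uInv_graded.mul (genFun_graded hs hq fun k => g (AqGen.Wm k))).coeff_eq_zero_of_lt
    (n := 1) (by norm_num)
  norm_num at e1
  change ((s ^ 2) • _ - (s ^ 2)⁻¹ • _ : HahnSeries ℤ A).coeff 1 = _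
  rw [HahnSeries.coeff_sub, HahnSeries.coeff_smul, HahnSeries.coeff_smul, e1, e2,
    genFun_coeff_two hs hq, uVar, HahnSeries.coeff_single_same, one_mul, smul_smul, smul_zero,
    sub_zero]
  congr 1
  field_simp

theorem kHalf_coeff_01 (g : AqGen → A) : (kHalf s kp km g 0 1).coeff 0 =
    algebraMap ℂ A (kp * (s ^ 2 + (s ^ 2)⁻¹) / (s ^ 2 - (s ^ 2)⁻¹)) := by
  change (_ • _ + (kp * (s ^ 2 + (s ^ 2)⁻¹) / (s ^ 2 - (s ^ 2)⁻¹)) • 1 : HahnSeries ℤ A).coeff 0 = _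
  rw [HahnSeries.coeff_add, HahnSeries.coeff_smul, HahnSeries.coeff_smul,
    (genFun_graded hs hq _).coeff_eq_zero_of_lt (by norm_num), smul_zero, zero_add,
    HahnSeries.coeff_one, if_pos rfl, Algebra.algebraMap_eq_smul_one]

theorem kHalf_coeff_10 (g : AqGen → A) : (kHalf s kp km g 1 0).coeff 0 =
    algebraMap ℂ A (km * (s ^ 2 + (s ^ 2)⁻¹) / (s ^ 2 - (s ^ 2)⁻¹)) := by
  change (_ • _ + (km * (s ^ 2 + (s ^ 2)⁻¹) / (s ^ 2 - (s ^ 2)⁻¹)) • 1 : HahnSeries ℤ A).coeff 0 = _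
  rw [HahnSeries.coeff_add, HahnSeries.coeff_smul, HahnSeries.coeff_smul,
    (genFun_graded hs hq _).coeff_eq_zero_of_lt (by norm_num), smul_zero, zero_add,
    HahnSeries.coeff_one, if_pos rfl, Algebra.algebraMap_eq_smul_one]

include hkp hkm in
-- The diagonal determines 𝒲₊ and 𝒲₋ by Cramer's rule: q u M₀₀ + q⁻¹u⁻¹ M₁₁ = (q²u² − q⁻²u⁻²)𝒲₊, and
-- with M₀₀, M₁₁ exchanged for 𝒲₋. The determinant is invertible with inverse in u⁻²ℂ[[u⁻²]], so the
-- solutions lie in u⁻²A[[u⁻²]], and every such series is a generating function. Off the diagonal it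
-- suffices to remove the scalar leading term.
theorem exists_kHalf (M : Matrix (Fin 2) (Fin 2) (HahnSeries ℤ A))
    (h00 : Graded 1 (M 0 0)) (h01 : Graded 0 (M 0 1)) (h10 : Graded 0 (M 1 0))
    (h11 : Graded 1 (M 1 1))
    (c01 : (M 0 1).coeff 0 = algebraMap ℂ A (kp * (s ^ 2 + (s ^ 2)⁻¹) / (s ^ 2 - (s ^ 2)⁻¹)))
    (c10 : (M 1 0).coeff 0 = algebraMap ℂ A (km * (s ^ 2 + (s ^ 2)⁻¹) / (s ^ 2 - (s ^ 2)⁻¹))) :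
    ∃ g : AqGen → A, kHalf s kp km g = M := by
  have hw : ∀ x y : HahnSeries ℤ A, Graded 1 x → Graded 1 y →
      Graded 2 (wInv A s * (s ^ 2 • (uVar A * x) + (s ^ 2)⁻¹ • (uInv A * y))) := by
    intro x y hx hy
    simpa using (wInv_graded A s).mul (((uVar_graded.mul hx).smul (s ^ 2)).add
      (((uInv_graded.mul hy).mono 1 (by norm_num) : Graded (-1 + 1) _).smul (s ^ 2)⁻¹))
  have ho : ∀ (x : HahnSeries ℤ A) (c : ℂ), Graded 0 x → x.coeff 0 = algebraMap ℂ A c →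
      Graded 2 (x - c • (1 : HahnSeries ℤ A)) := by
    intro x c hx hc n hn
    obtain ⟨k, hk⟩ := (hx.sub (Graded.one.smul c)) n hn
    rcases k with _ | k
    · exfalso
      apply hn
      rw [hk, HahnSeries.coeff_sub, HahnSeries.coeff_smul, HahnSeries.coeff_one]
      simp [hc, Algebra.algebraMap_eq_smul_one]
    · exact ⟨k, by push_cast at hk; omega⟩
  obtain ⟨wm, hwm⟩ := exists_genFun hs hq (hw _ _ h00 h11)
  obtain ⟨wp, hwp⟩ := exists_genFun hs hq (hw _ _ h11 h00)
  obtain ⟨gp, hgp⟩ := exists_genFun hs hq ((ho _ _ h01 c01).smul (km * (s ^ 2 + (s ^ 2)⁻¹)))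
  obtain ⟨gm, hgm⟩ := exists_genFun hs hq ((ho _ _ h10 c10).smul (kp * (s ^ 2 + (s ^ 2)⁻¹)))
  have hc : ∀ z ∈ Subring.center (HahnSeries ℤ A), ∀ y, z * (wInv A s * y) = wInv A s * (z * y) := by
    intro z hz y
    rw [← mul_assoc, ← mul_assoc, Subring.mem_center_iff.1 hz]
  have hq0 : s ^ 2 ≠ 0 := pow_ne_zero _ hs
  -- Substituting the solution of the 2×2 system back: the mixed terms, in which u and u⁻¹ meet,
  -- cancel.
  have hd : ∀ x y : HahnSeries ℤ A,
      s ^ 2 • (uVar A * (wInv A s * (s ^ 2 • (uVar A * x) + (s ^ 2)⁻¹ • (uInv A * y)))) -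
      (s ^ 2)⁻¹ • (uInv A * (wInv A s * (s ^ 2 • (uVar A * y) + (s ^ 2)⁻¹ • (uInv A * x)))) = x := by
    intro x y
    rw [hc _ (uVar_mem_center A), hc _ (uInv_mem_center A), ← mul_smul_hahn _ (wInv A s),
      ← mul_smul_hahn _ (wInv A s), ← mul_sub]
    conv_rhs => rw [← wInv_mul hs x]
    congr 1
    simp only [mul_add, mul_smul_hahn, uVar_mul_uInv_mul, uInv_mul_uVar_mul, smul_add, smul_smul]
    rw [mul_inv_cancel₀ hq0, inv_mul_cancel₀ hq0, sq (s ^ 2), sq (s ^ 2)⁻¹]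
    abel
  refine ⟨fun x => match x with
    | AqGen.Wm k => wm k
    | AqGen.Wp k => wp k
    | AqGen.G k => gp k
    | AqGen.Gt k => gm k, ?_⟩
  ext i j : 1
  fin_cases i <;> fin_cases j
  · change s ^ 2 • (uVar A * genFun s wm) - (s ^ 2)⁻¹ • (uInv A * genFun s wp) = M 0 0
    rw [hwm, hwp, hd]
  · change (km * (s ^ 2 + (s ^ 2)⁻¹))⁻¹ • genFun s gp + _ • (1 : HahnSeries ℤ A) = M 0 1
    rw [hgp, smul_smul, inv_mul_cancel₀ (mul_ne_zero hkm hq), one_smul, sub_add_cancel]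
  · change (kp * (s ^ 2 + (s ^ 2)⁻¹))⁻¹ • genFun s gm + _ • (1 : HahnSeries ℤ A) = M 1 0
    rw [hgm, smul_smul, inv_mul_cancel₀ (mul_ne_zero hkp hq), one_smul, sub_add_cancel]
  · change s ^ 2 • (uVar A * genFun s wp) - (s ^ 2)⁻¹ • (uInv A * genFun s wm) = M 1 1
    rw [hwm, hwp, hd]

end KHalf

/-! ### Exchange relations of ℒ^{(1/2)} over a commutative ring of scalars. -/

section GenericL

variable {S : Type*} [CommRing S] {B : Type*} [Ring B] [Algebra S B]

/-- Elements `E, F, K^{1/2}, K^{-1/2}` satisfying the relations of `U_q(sl₂)`, over a commutative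
base ring with `σ = q^{1/2}`, `σ' = q^{-1/2}`. -/
structure UqTuple (σ σ' : S) (E F k k' : B) : Prop where
  inv : σ * σ' = 1
  kE : k * E = σ ^ 2 • (E * k)
  kF : k * F = σ' ^ 2 • (F * k)
  kiE : k' * E = σ' ^ 2 • (E * k')
  kiF : k' * F = σ ^ 2 • (F * k')
  kk : k * k = (σ ^ 2 - σ' ^ 2) • (E * F) - (σ ^ 2 - σ' ^ 2) • (F * E) + k' * k'
  kki : k * k' = 1
  kik : k' * k = 1

/-- The fundamental L-operator at `u = x`, where `x' = x⁻¹`. -/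
def lGen (σ σ' : S) (E F k k' : B) (x x' : S) : Matrix (Fin 2) (Fin 2) B :=
  !![(x * σ) • k - (x' * σ') • k', (σ ^ 2 - σ' ^ 2) • F;
    (σ ^ 2 - σ' ^ 2) • E, (x * σ) • k' - (x' * σ') • k]

/-- Diagonal entries of `R^{(1/2,1/2)}(t)`, `t' = t⁻¹`. -/
def rDiag (σ σ' t t' : S) (i j : Fin 2) : S :=
  if i = j then t * σ ^ 2 - t' * σ' ^ 2 else t - t'

/-- `R^{(1/2,1/2)}(t)`, `t' = t⁻¹`. -/
def rGen (σ σ' t t' : S) : Matrix (Fin 2 × Fin 2) (Fin 2 × Fin 2) S := fun a b =>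
  if a = b then rDiag σ σ' t t' a.1 a.2
  else if a.1 = b.2 ∧ a.2 = b.1 then σ ^ 2 - σ' ^ 2 else 0

/-- Both sides are brought to a normal form with powers of K^{1/2} to the right of E and F. The
relation `kk` eliminates K in favour of EF, FE and K⁻¹, so EF and FE stay independent monomials and
no division by q − q⁻¹ is needed. Comparing coefficients leaves Laurent polynomial identities in x,
y and q^{1/2}. -/
theorem rll_apply {σ σ' : S} {E F k k' : B} (h : UqTuple σ σ' E F k k') {x x' y y' : S}
    (hx : x * x' = 1) (hy : y * y' = 1) (i j m l : Fin 2) :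
    rDiag σ σ' (x * y') (x' * y) i j •
        (lGen σ σ' E F k k' x x' i m * lGen σ σ' E F k k' y y' j l) +
      (if i = j then 0 else (σ ^ 2 - σ' ^ 2) •
        (lGen σ σ' E F k k' x x' j m * lGen σ σ' E F k k' y y' i l)) =
    rDiag σ σ' (x * y') (x' * y) m l •
        (lGen σ σ' E F k k' y y' j l * lGen σ σ' E F k k' x x' i m) +
      (if m = l then 0 else (σ ^ 2 - σ' ^ 2) •
        (lGen σ σ' E F k k' y y' j m * lGen σ σ' E F k k' x x' i l)) := by
  have hσ := h.inv
  fin_cases i <;> fin_cases j <;> fin_cases m <;> fin_cases l <;>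
    simp only [lGen, rDiag, Matrix.of_apply, Matrix.cons_val', Matrix.cons_val_zero,
      Matrix.cons_val_one, Matrix.cons_val_fin_one, Fin.zero_eta, Fin.mk_one, Fin.isValue,
      if_true, zero_ne_one, one_ne_zero, if_false, add_zero,
      mul_sub, sub_mul, smul_mul_assoc, mul_smul_comm, h.kE, h.kF, h.kiE, h.kiF, h.kk, h.kki,
      h.kik] <;>
    match_scalars <;> grind

/-- In `Fin 2` the index j + 1 is the one different from j, so the second summand is the exchange
part of R. The normal form is that of `rll_apply`. -/
theorem lrl_apply {σ σ' : S} {E F k k' : B} (h : UqTuple σ σ' E F k k') {x x' y y' : S}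
    (hx : x * x' = 1) (hy : y * y' = 1) (i j m l : Fin 2) :
    rDiag σ σ' (x * y) (x' * y') m j •
        (lGen σ σ' E F k k' x x' i m * lGen σ σ' E F k k' y y' j l) +
      (if m = j then (σ ^ 2 - σ' ^ 2) •
        (lGen σ σ' E F k k' x x' i (j + 1) * lGen σ σ' E F k k' y y' (j + 1) l) else 0) =
    rDiag σ σ' (x * y) (x' * y') i l •
        (lGen σ σ' E F k k' y y' j l * lGen σ σ' E F k k' x x' i m) +
      (if i = l then (σ ^ 2 - σ' ^ 2) •
        (lGen σ σ' E F k k' y y' j (i + 1) * lGen σ σ' E F k k' x x' (i + 1) m) else 0) := by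
  have hσ := h.inv
  have h11 : (1 : Fin 2) + 1 = 0 := rfl
  fin_cases i <;> fin_cases j <;> fin_cases m <;> fin_cases l <;>
    simp only [lGen, rDiag, Matrix.of_apply, Matrix.cons_val', Matrix.cons_val_zero,
      Matrix.cons_val_one, Matrix.cons_val_fin_one, Fin.zero_eta, Fin.mk_one, Fin.isValue,
      if_true, zero_ne_one, one_ne_zero, if_false, add_zero, zero_add, h11,
      mul_sub, sub_mul, smul_mul_assoc, mul_smul_comm, h.kE, h.kF, h.kiE, h.kiF, h.kk, h.kki,
      h.kik] <;>
    match_scalars <;> grind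

/-- `ℒ_2(x) ℒ_1(q x)` maps symmetric tensors to symmetric tensors. -/
theorem lGen_sym {σ σ' : S} {E F k k' : B} (h : UqTuple σ σ' E F k k') {x x' : S}
    (hx : x * x' = 1) (m l : Fin 2) :
    lGen σ σ' E F k k' x x' 1 l * lGen σ σ' E F k k' (x * σ ^ 2) (x' * σ' ^ 2) 0 m +
      lGen σ σ' E F k k' x x' 1 m * lGen σ σ' E F k k' (x * σ ^ 2) (x' * σ' ^ 2) 0 l =
    lGen σ σ' E F k k' x x' 0 l * lGen σ σ' E F k k' (x * σ ^ 2) (x' * σ' ^ 2) 1 m +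
      lGen σ σ' E F k k' x x' 0 m * lGen σ σ' E F k k' (x * σ ^ 2) (x' * σ' ^ 2) 1 l := by
  have hσ := h.inv
  fin_cases m <;> fin_cases l <;>
    simp only [lGen, Matrix.of_apply, Matrix.cons_val', Matrix.cons_val_zero,
      Matrix.cons_val_one, Matrix.cons_val_fin_one, Fin.zero_eta, Fin.mk_one, Fin.isValue,
      mul_sub, sub_mul, smul_mul_assoc, mul_smul_comm, h.kE, h.kF, h.kiE, h.kiF, h.kk, h.kki,
      h.kik] <;>
    match_scalars <;> grind

end GenericL

/-! ### Operators acting on one factor of ℂ² ⊗ V. -/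

section Legs

variable {X Y : Type*} [Ring X] [Ring Y] {V W Z : Type*} [Fintype V] [DecidableEq V] [Fintype W]
  [DecidableEq W] [Fintype Z] [DecidableEq Z]

/-- `M ⊗ 1` on `ℂ² ⊗ V`. -/
def aLeg (V : Type*) [DecidableEq V] (M : Matrix (Fin 2) (Fin 2) X) :
    Matrix (Fin 2 × V) (Fin 2 × V) X := M ⊗ₖ (1 : Matrix V V X)

/-- `1 ⊗ M` on `ℂ² ⊗ V`. -/
def vLeg (M : Matrix V W X) : Matrix (Fin 2 × V) (Fin 2 × W) X :=
  (1 : Matrix (Fin 2) (Fin 2) X) ⊗ₖ M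

theorem leg1_eq (N : ℕ) (M : Matrix (Fin 2) (Fin 2) X) : leg1 N M = aLeg (Fin (N + 1)) M := rfl

theorem leg2_eq {N : ℕ} (M : Matrix (Fin (N + 1)) (Fin (N + 1)) X) : leg2 M = vLeg M := rfl

theorem aLeg_apply (M : Matrix (Fin 2) (Fin 2) X) (a b : Fin 2 × V) :
    aLeg V M a b = if a.2 = b.2 then M a.1 b.1 else 0 := by
  simp [aLeg, Matrix.kroneckerMap_apply, Matrix.one_apply]

theorem vLeg_apply (M : Matrix V W X) (a : Fin 2 × V) (b : Fin 2 × W) :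
    vLeg M a b = if a.1 = b.1 then M a.2 b.2 else 0 := by
  simp [vLeg, Matrix.kroneckerMap_apply, Matrix.one_apply]

theorem aLeg_mul (M N : Matrix (Fin 2) (Fin 2) X) : aLeg V (M * N) = aLeg V M * aLeg V N := by
  ext a b
  simp [aLeg_apply, Matrix.mul_apply, Fintype.sum_prod_type]

theorem vLeg_mul (M : Matrix V W X) (N : Matrix W Z X) : vLeg (M * N) = vLeg M * vLeg N := by
  ext a b
  simp only [vLeg_apply, Matrix.mul_apply, Fintype.sum_prod_type]
  rw [Finset.sum_eq_single a.1]
  · simp only [if_true]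
    split_ifs <;> simp
  · intro i _ hi
    simp [hi.symm]
  · simp

theorem aLeg_map (f : X →+* Y) (M : Matrix (Fin 2) (Fin 2) X) :
    (aLeg V M).map f = aLeg V (M.map f) := by
  ext a b
  simp only [Matrix.map_apply, aLeg_apply]
  split_ifs <;> simp

theorem vLeg_map (f : X →+* Y) (M : Matrix V W X) : (vLeg M).map f = vLeg (M.map f) := by
  ext a b
  simp only [Matrix.map_apply, vLeg_apply]
  split_ifs <;> simp

theorem aLeg_mul_vLeg_apply (M : Matrix (Fin 2) (Fin 2) X) (N : Matrix V W X) (a : Fin 2 × V)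
    (b : Fin 2 × W) : (aLeg V M * vLeg N) a b = M a.1 b.1 * N a.2 b.2 := by
  simp [aLeg_apply, vLeg_apply, Matrix.mul_apply, Fintype.sum_prod_type]

theorem vLeg_mul_aLeg_apply (M : Matrix (Fin 2) (Fin 2) X) (N : Matrix V W X) (a : Fin 2 × V)
    (b : Fin 2 × W) : (vLeg N * aLeg W M) a b = N a.2 b.2 * M a.1 b.1 := by
  simp [aLeg_apply, vLeg_apply, Matrix.mul_apply, Fintype.sum_prod_type]

theorem aLeg_vLeg_comm {M : Matrix (Fin 2) (Fin 2) X} {N : Matrix V W X}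
    (h : ∀ i j v w, M i j * N v w = N v w * M i j) :
    aLeg V M * vLeg N = vLeg N * aLeg W M := by
  ext a b
  rw [aLeg_mul_vLeg_apply, vLeg_mul_aLeg_apply, h]

theorem aLeg_smul (c : X) (M : Matrix (Fin 2) (Fin 2) X) : aLeg V (c • M) = c • aLeg V M := by
  ext a b
  simp [aLeg_apply]

theorem vLeg_smul (c : X) (M : Matrix V W X) : vLeg (c • M) = c • vLeg M := by
  ext a b
  simp [vLeg_apply]

theorem smul_mul_matrix (c : X) (M : Matrix V W X) (N : Matrix W Z X) :
    (c • M) * N = c • (M * N) := Matrix.smul_mul c M N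

theorem mul_smul_matrix {c : X} (hc : c ∈ Subring.center X) (M : Matrix V W X)
    (N : Matrix W Z X) : M * (c • N) = c • (M * N) := by
  ext i j
  simp only [Matrix.mul_apply, Matrix.smul_apply, smul_eq_mul, Finset.mul_sum]
  refine Finset.sum_congr rfl fun k _ => ?_
  rw [← mul_assoc, ← mul_assoc, Subring.mem_center_iff.1 hc]

theorem map_smul_matrix (f : X →+* Y) (c : X) (M : Matrix V W X) :
    (c • M).map f = f c • M.map f := by
  ext i j
  simp

end Legs

/-! ### Evaluation of ℒ at central spectral parameters. -/

section LEval

variable {B : Type*} [Ring B] [Algebra ℂ B]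

theorem algebraMap_mem_center (c : ℂ) : algebraMap ℂ B c ∈ Subring.center B :=
  Subring.mem_center_iff.2 fun y => (Algebra.commutes c y).symm

/-- A scalar as an element of the centre. -/
def cst (B : Type*) [Ring B] [Algebra ℂ B] (c : ℂ) : Subring.center B :=
  ⟨algebraMap ℂ B c, algebraMap_mem_center c⟩

@[simp] theorem cst_coe (c : ℂ) : (cst B c : B) = algebraMap ℂ B c := rfl

theorem cst_mul (a b : ℂ) : cst B a * cst B b = cst B (a * b) :=
  Subtype.ext (map_mul _ _ _).symm

theorem cst_one : cst B 1 = 1 := Subtype.ext (map_one _)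

/-- Central elements serve as scalars: u, v, uw, v/w and so on are all central, so the generic
identities over a commutative ring apply to them. -/
instance centerAlgebra (B : Type*) [Ring B] : Algebra (Subring.center B) B :=
  RingHom.toAlgebra' (Subring.center B).subtype fun c x => (Subring.mem_center_iff.1 c.2 x).symm

theorem center_smul_def (c : Subring.center B) (x : B) : c • x = (c : B) * x := rfl

theorem cst_smul (c : ℂ) (x : B) : cst B c • x = c • x := by
  rw [center_smul_def, cst_coe, Algebra.smul_def]

theorem uq_rel {s : ℂ} {x y : FreeAlgebra ℂ UqGen} (h : UqRel s x y) :
    RingQuot.mkAlgHom ℂ (UqRel s) x = RingQuot.mkAlgHom ℂ (UqRel s) y := RingQuot.mkAlgHom_rel ℂ h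

/-- `R^{(1/2,1/2)}(t)` through a homomorphism of scalars into the centre of `B`. -/
theorem rMat_one_map {k : Type*} [Field k] [Algebra ℂ k] {s : ℂ}
    (hq : s ^ 2 - (s ^ 2)⁻¹ ≠ 0) (ρ : k →+* B)
    (hρ : ∀ c, ρ (algebraMap ℂ k c) = algebraMap ℂ B c) {t : k} {z z' : Subring.center B}
    (hz : ρ t = z) (hz' : ρ t⁻¹ = z') :
    (rMat s 1 t).map ρ =
      (rGen (cst B s) (cst B s⁻¹) z z').map (Subring.center B).subtype := by
  have hb : bCoef s 1 0 = 1 := by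
    have : qNum s 1 = 1 := by simp [qNum, div_self hq]
    simp [bCoef, this]
  have hc : ∀ c : ℂ, ρ (cFun (algebraMap ℂ k c * t)) =
      z * algebraMap ℂ B c - z' * algebraMap ℂ B c⁻¹ := by
    intro c
    rw [cFun, mul_inv, ← map_inv₀, map_sub, map_mul, map_mul, hρ, hρ, hz, hz',
      Subring.mem_center_iff.1 z.2, Subring.mem_center_iff.1 z'.2]
  have hc1 : ρ (cFun t) = z - z' := by simpa using hc 1
  ext a b
  obtain ⟨a1, a2⟩ := a
  obtain ⟨b1, b2⟩ := b
  fin_cases a1 <;> fin_cases a2 <;> fin_cases b1 <;> fin_cases b2 <;>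
    simp [rMat, rGen, rDiag, repE, repF, hρ, hb, -map_pow, -map_inv₀] <;>
    first
    | done
    | (norm_num [← map_pow, -map_inv₀]; done)
    | exact hc1
    | (norm_num [← map_pow, -map_inv₀]; exact hc _)

/-- The relations for K^{-1/2} follow from those of K^{1/2} by conjugation, and `kk` is the relation
for [E,F] multiplied by q − q⁻¹. -/
theorem uqTuple {s : ℂ} (hs : s ≠ 0) (hq : s ^ 2 - (s ^ 2)⁻¹ ≠ 0) (ι : Uq s →ₐ[ℂ] B) :
    UqTuple (cst B s) (cst B s⁻¹) (ι (Uq.gen s UqGen.E)) (ι (Uq.gen s UqGen.F))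
      (ι (Uq.gen s UqGen.Kh)) (ι (Uq.gen s UqGen.Kih)) := by
  have hKE : Uq.gen s UqGen.Kh * Uq.gen s UqGen.E =
      s ^ 2 • (Uq.gen s UqGen.E * Uq.gen s UqGen.Kh) := by
    have h := uq_rel (UqRel.KE (s := s))
    rw [map_mul, map_smul, map_mul] at h
    exact h
  have hKF : Uq.gen s UqGen.Kh * Uq.gen s UqGen.F =
      (s ^ 2)⁻¹ • (Uq.gen s UqGen.F * Uq.gen s UqGen.Kh) := by
    have h := uq_rel (UqRel.KF (s := s))
    rw [map_mul, map_smul, map_mul] at h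
    exact h
  have hEF : Uq.gen s UqGen.E * Uq.gen s UqGen.F - Uq.gen s UqGen.F * Uq.gen s UqGen.E =
      (s ^ 2 - (s ^ 2)⁻¹)⁻¹ • (Uq.gen s UqGen.Kh ^ 2 - Uq.gen s UqGen.Kih ^ 2) := by
    have h := uq_rel (UqRel.EF (s := s))
    rw [map_sub, map_mul, map_mul, map_smul, map_sub, map_pow, map_pow] at h
    exact h
  have hKKi : Uq.gen s UqGen.Kh * Uq.gen s UqGen.Kih = 1 := by
    have h := uq_rel (UqRel.KKi (s := s))
    rw [map_mul, map_one] at h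
    exact h
  have hKiK : Uq.gen s UqGen.Kih * Uq.gen s UqGen.Kh = 1 := by
    have h := uq_rel (UqRel.KiK (s := s))
    rw [map_mul, map_one] at h
    exact h
  have conj : ∀ (c : ℂ) (x : Uq s), c ≠ 0 →
      Uq.gen s UqGen.Kh * x = c • (x * Uq.gen s UqGen.Kh) →
      Uq.gen s UqGen.Kih * x = c⁻¹ • (x * Uq.gen s UqGen.Kih) := by
    intro c x hc h
    have h1 : Uq.gen s UqGen.Kih * (Uq.gen s UqGen.Kh * x) * Uq.gen s UqGen.Kih =
        c • (Uq.gen s UqGen.Kih * x) := by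
      rw [h, mul_smul_comm, smul_mul_assoc, mul_assoc, mul_assoc, hKKi, mul_one]
    rw [← mul_assoc, hKiK, one_mul] at h1
    rw [h1, smul_smul, inv_mul_cancel₀ hc, one_smul]
  have hs2 : s ^ 2 ≠ 0 := pow_ne_zero _ hs
  have hsq : s⁻¹ ^ 2 = (s ^ 2)⁻¹ := inv_pow s 2
  have c2 : ∀ (c : ℂ) (x : Uq s), cst B c ^ 2 • ι x = ι (c ^ 2 • x) := by
    intro c x
    rw [sq, cst_mul, cst_smul, map_smul, sq]
  refine ⟨?_, ?_, ?_, ?_, ?_, ?_, ?_, ?_⟩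
  · rw [cst_mul, mul_inv_cancel₀ hs, cst_one]
  · rw [← map_mul, ← map_mul, c2, hKE]
  · rw [← map_mul, ← map_mul, c2, hKF, hsq]
  · rw [← map_mul, ← map_mul, c2, conj _ _ hs2 hKE, hsq]
  · rw [← map_mul, ← map_mul, c2, conj _ _ (inv_ne_zero hs2) hKF, inv_inv]
  · rw [← smul_sub, sub_smul, ← map_mul, ← map_mul, ← map_mul, ← map_mul, ← map_sub, c2, c2, hEF,
      ← map_sub, ← map_add, ← sub_smul, hsq, smul_smul, mul_inv_cancel₀ hq, one_smul, sq, sq,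
      sub_add_cancel]
  · rw [← map_mul, hKKi, map_one]
  · rw [← map_mul, hKiK, map_one]

/-- `φ` is the evaluation of series over `U_q(sl₂)` at a central point `u = x`, `x' = x⁻¹`. -/
structure LEval {s : ℂ} (φ : HahnSeries ℤ (Uq s) →+* B) (ι : Uq s →ₐ[ℂ] B)
    (x x' : Subring.center B) : Prop where
  inv : x * x' = 1
  map_zero : ∀ a, φ (HahnSeries.single 0 a) = ι a
  map_neg : ∀ a, φ (HahnSeries.single (-1) a) = x * ι a
  map_pos : ∀ a, φ (HahnSeries.single 1 a) = x' * ι a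

theorem LEval.lHalf {s : ℂ} {φ : HahnSeries ℤ (Uq s) →+* B} {ι : Uq s →ₐ[ℂ] B}
    {x x' : Subring.center B} (h : LEval φ ι x x') :
    (lHalf s).map φ = lGen (cst B s) (cst B s⁻¹) (ι (Uq.gen s UqGen.E)) (ι (Uq.gen s UqGen.F))
      (ι (Uq.gen s UqGen.Kh)) (ι (Uq.gen s UqGen.Kih)) x x' := by
  have hω : ∀ y : B, (cst B s ^ 2 - cst B s⁻¹ ^ 2) • y = (s ^ 2 - (s ^ 2)⁻¹) • y := by
    intro y
    rw [sub_smul, sq, sq, cst_mul, cst_mul, cst_smul, cst_smul, ← sub_smul, ← mul_inv, sq]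
  ext i j
  fin_cases i <;> fin_cases j <;>
    simp [QOnsager.lHalf, lGen, h.map_zero, h.map_neg, h.map_pos, hω, mul_smul,
      center_smul_def, ← Algebra.smul_def, -map_inv₀]

theorem LEval.comp_shift {s : ℂ} {φ : HahnSeries ℤ (Uq s) →+* B} {ι : Uq s →ₐ[ℂ] B}
    {x x' : Subring.center B} (h : LEval φ ι x x') {c : ℂ} (hc : c ≠ 0) :
    LEval (φ.comp (shiftHom hc)) ι (cst B c * x) (cst B c⁻¹ * x') where
  inv := by
    rw [mul_mul_mul_comm, h.inv, cst_mul, mul_inv_cancel₀ hc, cst_one, one_mul]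
  map_zero a := by
    rw [RingHom.comp_apply, shiftHom_apply, shift_single, h.map_zero]; simp
  map_neg a := by
    rw [RingHom.comp_apply, shiftHom_apply, shift_single, h.map_neg, map_smul, mul_smul_comm,
      Subring.coe_mul, mul_assoc, cst_coe, ← Algebra.smul_def]
    simp
  map_pos a := by
    rw [RingHom.comp_apply, shiftHom_apply, shift_single, h.map_pos, map_smul, mul_smul_comm,
      Subring.coe_mul, mul_assoc, cst_coe, ← Algebra.smul_def]
    simp

theorem sum_rGen_mul (σ σ' z z' : Subring.center B) (i j : Fin 2) (f : Fin 2 → Fin 2 → B) :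
    ∑ m, ∑ n, ((rGen σ σ' z z' (i, j) (m, n) : Subring.center B) : B) * f m n =
      rDiag σ σ' z z' i j • f i j + if i = j then 0 else (σ ^ 2 - σ' ^ 2) • f j i := by
  fin_cases i <;> fin_cases j <;> simp [Fin.sum_univ_two, rGen, rDiag, center_smul_def]
  exact add_comm _ _

theorem sum_mul_rGen (σ σ' z z' : Subring.center B) (i j : Fin 2) (f : Fin 2 → Fin 2 → B) :
    ∑ m, ∑ n, f m n * ((rGen σ σ' z z' (m, n) (i, j) : Subring.center B) : B) =
      rDiag σ σ' z z' i j • f i j + if i = j then 0 else (σ ^ 2 - σ' ^ 2) • f j i := by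
  have hc : ∀ (y : B) (c : Subring.center B), y * (c : B) = c * y := fun y c =>
    Subring.mem_center_iff.1 c.2 y
  fin_cases i <;> fin_cases j <;> simp [Fin.sum_univ_two, rGen, rDiag, center_smul_def, hc]
  exact add_comm _ _

theorem aLeg_rGen_vLeg_apply (σ σ' z z' : Subring.center B) (M N : Matrix (Fin 2) (Fin 2) B)
    (i j m l : Fin 2) :
    (aLeg (Fin 2) M * (rGen σ σ' z z').map (Subring.center B).subtype * vLeg N) (i, j) (m, l) =
      rDiag σ σ' z z' m j • (M i m * N j l) +
        if m = j then (σ ^ 2 - σ' ^ 2) • (M i (j + 1) * N (j + 1) l) else 0 := by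
  have hc : ∀ (y : B) (c : Subring.center B), y * (c : B) = c * y := fun y c =>
    Subring.mem_center_iff.1 c.2 y
  have h11 : (1 : Fin 2) + 1 = 0 := rfl
  simp only [Matrix.mul_apply, Fintype.sum_prod_type, aLeg_apply, vLeg_apply, Matrix.map_apply,
    Subring.subtype_apply, center_smul_def]
  fin_cases i <;> fin_cases j <;> fin_cases m <;> fin_cases l <;>
    simp [Fin.sum_univ_two, rGen, hc, mul_assoc, h11] <;> first | done | exact add_comm _ _

theorem vLeg_rGen_aLeg_apply (σ σ' z z' : Subring.center B) (M N : Matrix (Fin 2) (Fin 2) B)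
    (i j m l : Fin 2) :
    (vLeg N * (rGen σ σ' z z').map (Subring.center B).subtype * aLeg (Fin 2) M) (i, j) (m, l) =
      rDiag σ σ' z z' i l • (N j l * M i m) +
        if i = l then (σ ^ 2 - σ' ^ 2) • (N j (i + 1) * M (i + 1) m) else 0 := by
  have hc : ∀ (y : B) (c : Subring.center B), y * (c : B) = c * y := fun y c =>
    Subring.mem_center_iff.1 c.2 y
  have h11 : (1 : Fin 2) + 1 = 0 := rfl
  simp only [Matrix.mul_apply, Fintype.sum_prod_type, aLeg_apply, vLeg_apply, Matrix.map_apply,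
    Subring.subtype_apply, center_smul_def]
  fin_cases i <;> fin_cases j <;> fin_cases m <;> fin_cases l <;>
    simp [Fin.sum_univ_two, rGen, hc, mul_assoc, h11] <;> first | done | exact add_comm _ _

variable {s : ℂ} (hs : s ≠ 0) (hq : s ^ 2 - (s ^ 2)⁻¹ ≠ 0)
  {φ ψ : HahnSeries ℤ (Uq s) →+* B} {ι : Uq s →ₐ[ℂ] B} {x x' y y' : Subring.center B}
  (hφ : LEval φ ι x x') (hψ : LEval ψ ι y y')
include hs hq hφ hψ

/-- `R(x/y) ℒ₁(x) ℒ₂(y) = ℒ₂(y) ℒ₁(x) R(x/y)`. -/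
theorem rll : (rGen (cst B s) (cst B s⁻¹) (x * y') (x' * y)).map (Subring.center B).subtype *
      (aLeg (Fin 2) ((lHalf s).map φ) * vLeg ((lHalf s).map ψ)) =
    (vLeg ((lHalf s).map ψ) * aLeg (Fin 2) ((lHalf s).map φ)) *
      (rGen (cst B s) (cst B s⁻¹) (x * y') (x' * y)).map (Subring.center B).subtype := by
  ext ⟨i, j⟩ ⟨m, l⟩
  rw [hφ.lHalf, hψ.lHalf, Matrix.mul_apply, Matrix.mul_apply, Fintype.sum_prod_type,
    Fintype.sum_prod_type]
  simp only [aLeg_mul_vLeg_apply, vLeg_mul_aLeg_apply, Matrix.map_apply, Subring.subtype_apply]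
  rw [sum_rGen_mul, sum_mul_rGen]
  exact rll_apply (uqTuple hs hq ι) hφ.inv hψ.inv i j m l

/-- `ℒ₁(x) R(xy) ℒ₂(y) = ℒ₂(y) R(xy) ℒ₁(x)`. -/
theorem lrl : aLeg (Fin 2) ((lHalf s).map φ) *
      (rGen (cst B s) (cst B s⁻¹) (x * y) (x' * y')).map (Subring.center B).subtype *
      vLeg ((lHalf s).map ψ) =
    vLeg ((lHalf s).map ψ) *
      (rGen (cst B s) (cst B s⁻¹) (x * y) (x' * y')).map (Subring.center B).subtype *
      aLeg (Fin 2) ((lHalf s).map φ) := by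
  ext ⟨i, j⟩ ⟨m, l⟩
  rw [aLeg_rGen_vLeg_apply, vLeg_rGen_aLeg_apply, hφ.lHalf, hψ.lHalf]
  exact lrl_apply (uqTuple hs hq ι) hφ.inv hψ.inv i j m l

end LEval

/-! ### Dressing a solution of the reflection equation. -/

section Dressing

/-- R(u/v) has to travel from left to right. The relations `h3`, `h4` bring ℒ-factors of different
legs past R(uv), the relations `c1`–`c4` bring them past 𝒦, and then `h1`, `hK`, `h2` carry R(u/v)
through the left ℒ's, the bare 𝒦's and the right ℒ's. -/
theorem dressed_reflection {M : Type*} [Ring M] {Rm Rp L₁ L₂ L₁' L₂' K₁ K₂ : M}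
    (h1 : Rm * (L₁ * L₂) = (L₂ * L₁) * Rm) (h2 : Rm * (L₁' * L₂') = (L₂' * L₁') * Rm)
    (h3 : L₁' * Rp * L₂ = L₂ * Rp * L₁') (h4 : L₁ * Rp * L₂' = L₂' * Rp * L₁)
    (hK : Rm * K₁ * Rp * K₂ = K₂ * Rp * K₁ * Rm)
    (c1 : K₁ * L₂ = L₂ * K₁) (c2 : K₁ * L₂' = L₂' * K₁) (c3 : L₁ * K₂ = K₂ * L₁)
    (c4 : L₁' * K₂ = K₂ * L₁') :
    Rm * (L₁ * K₁ * L₁') * Rp * (L₂ * K₂ * L₂') = (L₂ * K₂ * L₂') * Rp * (L₁ * K₁ * L₁') * Rm := by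
  calc Rm * (L₁ * K₁ * L₁') * Rp * (L₂ * K₂ * L₂')
      = Rm * L₁ * K₁ * (L₁' * Rp * L₂) * K₂ * L₂' := by simp only [mul_assoc]
    _ = Rm * L₁ * (K₁ * L₂) * Rp * (L₁' * K₂) * L₂' := by rw [h3]; simp only [mul_assoc]
    _ = (Rm * (L₁ * L₂)) * K₁ * Rp * K₂ * L₁' * L₂' := by rw [c1, c4]; simp only [mul_assoc]
    _ = L₂ * L₁ * (Rm * K₁ * Rp * K₂) * L₁' * L₂' := by rw [h1]; simp only [mul_assoc]
    _ = L₂ * L₁ * K₂ * Rp * K₁ * (Rm * (L₁' * L₂')) := by rw [hK]; simp only [mul_assoc]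
    _ = L₂ * (L₁ * K₂) * Rp * (K₁ * L₂') * L₁' * Rm := by rw [h2]; simp only [mul_assoc]
    _ = L₂ * K₂ * (L₁ * Rp * L₂') * K₁ * L₁' * Rm := by rw [c3, c2]; simp only [mul_assoc]
    _ = (L₂ * K₂ * L₂') * Rp * (L₁ * K₁ * L₁') * Rm := by rw [h4]; simp only [mul_assoc]

variable {s kp km : ℂ}

def uqInclude (s kp km : ℂ) : Uq s →ₐ[ℂ] CoactTarget s kp km :=
  (Algebra.TensorProduct.includeRight : (Uq s)[T;T⁻¹] →ₐ[ℂ] CoactTarget s kp km).comp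
    { (LaurentPolynomial.C : Uq s →+* (Uq s)[T;T⁻¹]) with
      commutes' := fun r => (LaurentPolynomial.algebraMap_apply r).symm }

theorem uqInclude_apply (a : Uq s) :
    uqInclude s kp km a = 1 ⊗ₜ (LaurentPolynomial.C a : (Uq s)[T;T⁻¹]) := rfl

/-- The element `1 ⊗ wⁿ`. -/
def wT (s kp km : ℂ) (n : ℤ) : CoactTarget s kp km := 1 ⊗ₜ (LaurentPolynomial.T n : (Uq s)[T;T⁻¹])

theorem wT_mem_center (n : ℤ) : wT s kp km n ∈ Subring.center (CoactTarget s kp km) := by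
  rw [Subring.mem_center_iff]
  intro y
  induction y using TensorProduct.induction_on with
  | zero => simp
  | tmul a b =>
    rw [wT, Algebra.TensorProduct.tmul_mul_tmul, Algebra.TensorProduct.tmul_mul_tmul, one_mul,
      mul_one, LaurentPolynomial.T_mul]
  | add a b ha hb => rw [add_mul, mul_add, ha, hb]

theorem wT_mul (m n : ℤ) : wT s kp km m * wT s kp km n = wT s kp km (m + n) := by
  rw [wT, wT, Algebra.TensorProduct.tmul_mul_tmul, one_mul, ← LaurentPolynomial.T_add]
  rfl

theorem wT_zero : wT s kp km 0 = 1 := by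
  rw [wT, LaurentPolynomial.T_zero]; rfl

theorem second_single (e n : ℤ) (a : Uq s) : second s kp km e (HahnSeries.single n a) =
    HahnSeries.single n (wT s kp km (-(e * n)) * uqInclude s kp km a) := by
  refine (coeffMap_single _ _ _).trans (congrArg _ ?_)
  rw [Subring.mem_center_iff.1 (wT_mem_center _) _ |>.symm]
  change (1 : Aq s kp km) ⊗ₜ[ℂ] (LaurentPolynomial.C a * LaurentPolynomial.T (-(e * n))) = _
  rw [uqInclude_apply, wT, Algebra.TensorProduct.tmul_mul_tmul, one_mul]

def secondHom (s kp km : ℂ) (e : ℤ) :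
    HahnSeries ℤ (Uq s) →+* HahnSeries ℤ (CoactTarget s kp km) :=
  coeffHom (fun n =>
    (Algebra.TensorProduct.includeRight :
        (Uq s)[T;T⁻¹] →ₐ[ℂ] CoactTarget s kp km).toRingHom.toAddMonoidHom.comp
      ((AddMonoidHom.mulRight (LaurentPolynomial.T (-(e * n)))).comp
        (LaurentPolynomial.C : Uq s →+* (Uq s)[T;T⁻¹]).toAddMonoidHom)) (by
    change (1 : Aq s kp km) ⊗ₜ[ℂ] (LaurentPolynomial.C (1 : Uq s) * LaurentPolynomial.T (-(e * 0))) = 1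
    rw [mul_zero, neg_zero, LaurentPolynomial.T_zero, map_one, mul_one]
    rfl) (by
    intro m n a b
    change (1 : Aq s kp km) ⊗ₜ[ℂ] (LaurentPolynomial.C (a * b) * LaurentPolynomial.T (-(e * (m + n)))) =
      ((1 : Aq s kp km) ⊗ₜ[ℂ] (LaurentPolynomial.C a * LaurentPolynomial.T (-(e * m)))) *
      ((1 : Aq s kp km) ⊗ₜ[ℂ] (LaurentPolynomial.C b * LaurentPolynomial.T (-(e * n))))
    rw [Algebra.TensorProduct.tmul_mul_tmul, one_mul, mul_add, neg_add, LaurentPolynomial.T_add,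
      map_mul, mul_assoc, mul_assoc, ← mul_assoc (LaurentPolynomial.C b),
      ← LaurentPolynomial.T_mul _ (LaurentPolynomial.C b), mul_assoc])

theorem secondHom_apply (e : ℤ) (x : HahnSeries ℤ (Uq s)) :
    secondHom s kp km e x = second s kp km e x := rfl

def firstHom (s kp km : ℂ) :
    HahnSeries ℤ (Aq s kp km) →+* HahnSeries ℤ (CoactTarget s kp km) :=
  mapHom Algebra.TensorProduct.includeLeft

theorem first_second_coeff_commute (x : HahnSeries ℤ (Aq s kp km)) (y : HahnSeries ℤ (Uq s))
    (e m n : ℤ) : (first s kp km x).coeff m * (second s kp km e y).coeff n =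
      (second s kp km e y).coeff n * (first s kp km x).coeff m := by
  change ((x.coeff m) ⊗ₜ[ℂ] (1 : (Uq s)[T;T⁻¹])) *
      ((1 : Aq s kp km) ⊗ₜ[ℂ] (LaurentPolynomial.C (y.coeff n) * LaurentPolynomial.T (-(e * n)))) =
      ((1 : Aq s kp km) ⊗ₜ[ℂ] (LaurentPolynomial.C (y.coeff n) * LaurentPolynomial.T (-(e * n)))) *
      ((x.coeff m) ⊗ₜ[ℂ] (1 : (Uq s)[T;T⁻¹]))
  simp only [Algebra.TensorProduct.tmul_mul_tmul, one_mul, mul_one]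

theorem inU_coeff {A : Type*} [Ring A] [Algebra ℂ A] (x : HahnSeries ℤ A) (n : ℤ) :
    (inU x).coeff n = HahnSeries.C (x.coeff n) := rfl

theorem inV_coeff {A : Type*} [Ring A] [Algebra ℂ A] (x : HahnSeries ℤ A) (n : ℤ) :
    (inV x).coeff n = if n = 0 then x else 0 := by
  change (HahnSeries.single 0 x).coeff n = _
  rw [HahnSeries.coeff_single]
  split_ifs <;> rfl

theorem commute_inU_inV {A : Type*} [Ring A] [Algebra ℂ A] {x y : HahnSeries ℤ A}
    (h : ∀ m n, x.coeff m * y.coeff n = y.coeff n * x.coeff m) :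
    inU x * inV y = inV y * inU x := by
  refine hahn_commute fun m n => ?_
  rw [inU_coeff, inV_coeff]
  split_ifs
  · refine hahn_commute fun m' n' => ?_
    rw [HahnSeries.C_apply, HahnSeries.coeff_single]
    split_ifs <;> simp [h]
  · simp

def inVHom {A : Type*} [Ring A] [Algebra ℂ A] : HahnSeries ℤ A →+* TwoVar A := HahnSeries.C

def constAlg (A : Type*) [Ring A] [Algebra ℂ A] : A →ₐ[ℂ] HahnSeries ℤ A :=
  { (HahnSeries.C : A →+* HahnSeries ℤ A) with
    commutes' := fun r => (HahnSeries.algebraMap_apply (r := r)).symm }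

/-- `u wᵉ` as a central element of `(𝒜_q ⊗ U_q(sl₂)[w, w⁻¹])((u⁻¹))`. -/
def uw (s kp km : ℂ) (n e : ℤ) : Subring.center (HahnSeries ℤ (CoactTarget s kp km)) :=
  ⟨HahnSeries.single n (wT s kp km e), single_mem_center _ (wT_mem_center _)⟩

theorem uw_mul (m n e f : ℤ) : uw s kp km m e * uw s kp km n f = uw s kp km (m + n) (e + f) := by
  apply Subtype.ext
  change HahnSeries.single m _ * HahnSeries.single n _ = HahnSeries.single _ _
  rw [HahnSeries.single_mul_single, wT_mul]

theorem uw_zero : uw s kp km 0 0 = 1 := by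
  apply Subtype.ext
  change HahnSeries.single 0 _ = 1
  rw [wT_zero]; rfl

/-- Placing a series in the second factor with u ↦ u wᵉ is evaluation at the central point u wᵉ, so
the exchange relations of ℒ hold there. -/
theorem second_eval (e : ℤ) : LEval (secondHom s kp km e)
    ((constAlg _).comp (uqInclude s kp km)) (uw s kp km (-1) e) (uw s kp km 1 (-e)) where
  inv := by rw [uw_mul, ← uw_zero]; congr 1; ring
  map_zero a := by
    rw [secondHom_apply, second_single, mul_zero, neg_zero, wT_zero, one_mul]; rfl
  map_neg a := by
    rw [secondHom_apply, second_single]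
    change _ = HahnSeries.single (-1) _ * HahnSeries.single 0 _
    rw [HahnSeries.single_mul_single, mul_neg_one, neg_neg, add_zero]
    rfl
  map_pos a := by
    rw [secondHom_apply, second_single]
    change _ = HahnSeries.single 1 _ * HahnSeries.single 0 _
    rw [HahnSeries.single_mul_single, mul_one, add_zero]
    rfl

theorem inU_mem_center {A : Type*} [Ring A] [Algebra ℂ A] {x : HahnSeries ℤ A}
    (hx : ∀ n, x.coeff n ∈ Subring.center A) : inU x ∈ Subring.center (TwoVar A) := by
  refine Subring.mem_center_iff.2 fun y => hahn_commute fun m n => ?_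
  exact Subring.mem_center_iff.1 (single_mem_center _ (hx _)) _

theorem inV_mem_center {A : Type*} [Ring A] [Algebra ℂ A] {x : HahnSeries ℤ A}
    (hx : x ∈ Subring.center (HahnSeries ℤ A)) : inV x ∈ Subring.center (TwoVar A) :=
  single_mem_center (A := HahnSeries ℤ A) _ hx

theorem LEval.comp_ringHom {B C : Type*} [Ring B] [Algebra ℂ B] [Ring C] [Algebra ℂ C]
    {φ : HahnSeries ℤ (Uq s) →+* B} {ι : Uq s →ₐ[ℂ] B} {x x' : Subring.center B}
    (h : LEval φ ι x x') (f : B →+* C) (ι' : Uq s →ₐ[ℂ] C) (hι : ∀ a, f (ι a) = ι' a)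
    (hx : f x ∈ Subring.center C) (hx' : f x' ∈ Subring.center C) :
    LEval (f.comp φ) ι' ⟨f x, hx⟩ ⟨f x', hx'⟩ where
  inv := Subtype.ext (by
    change f x * f x' = 1
    rw [← map_mul, ← Subring.coe_mul, h.inv]; exact map_one f)
  map_zero a := by rw [RingHom.comp_apply, h.map_zero, hι]
  map_neg a := by rw [RingHom.comp_apply, h.map_neg, map_mul, hι]
  map_pos a := by rw [RingHom.comp_apply, h.map_pos, map_mul, hι]

theorem inU_single {A : Type*} [Ring A] [Algebra ℂ A] (n : ℤ) (a : A) :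
    inU (HahnSeries.single n a) = HahnSeries.single n (HahnSeries.single 0 a) :=
  coeffMap_single _ _ _

theorem inV_single {A : Type*} [Ring A] [Algebra ℂ A] (n : ℤ) (a : A) :
    inV (HahnSeries.single n a) = HahnSeries.single 0 (HahnSeries.single n a) := rfl

theorem uw_coeff_mem_center (n e m : ℤ) :
    ((uw s kp km n e : HahnSeries ℤ (CoactTarget s kp km)).coeff m) ∈ Subring.center _ := by
  change (HahnSeries.single n (wT s kp km e)).coeff m ∈ _
  rw [HahnSeries.coeff_single]
  split_ifs
  · exact wT_mem_center _
  · exact Subring.zero_mem _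

def uwU (s kp km : ℂ) (n e : ℤ) : Subring.center (TwoVar (CoactTarget s kp km)) :=
  ⟨inUHom (uw s kp km n e : HahnSeries ℤ (CoactTarget s kp km)),
    inU_mem_center (uw_coeff_mem_center n e)⟩

def uwV (s kp km : ℂ) (n e : ℤ) : Subring.center (TwoVar (CoactTarget s kp km)) :=
  ⟨inVHom (uw s kp km n e : HahnSeries ℤ (CoactTarget s kp km)), inV_mem_center (uw s kp km n e).2⟩

theorem second_eval_u (e : ℤ) : LEval (inUHom.comp (secondHom s kp km e))
    ((constAlg _).comp ((constAlg _).comp (uqInclude s kp km))) (uwU s kp km (-1) e)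
    (uwU s kp km 1 (-e)) :=
  (second_eval e).comp_ringHom _ _ (fun _ => inU_single _ _) _ _

theorem second_eval_v (e : ℤ) : LEval (inVHom.comp (secondHom s kp km e))
    ((constAlg _).comp ((constAlg _).comp (uqInclude s kp km))) (uwV s kp km (-1) e)
    (uwV s kp km 1 (-e)) :=
  (second_eval e).comp_ringHom _ _ (fun _ => inV_single _ _) _ _

theorem uwU_mul_uwV (m n e f : ℤ) : ((uwU s kp km m e * uwV s kp km n f : Subring.center _) :
    TwoVar (CoactTarget s kp km)) = HahnSeries.single m (HahnSeries.single n (wT s kp km (e + f))) := by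
  change inU (HahnSeries.single _ _) * inV (HahnSeries.single _ _) = _
  rw [inU_single, inV_single, HahnSeries.single_mul_single, HahnSeries.single_mul_single, wT_mul,
    add_zero, zero_add]

theorem scal2_single {A : Type*} [Ring A] [Algebra ℂ A] (m n : ℤ) :
    scal2 A (HahnSeries.single m (HahnSeries.single n 1)) =
      HahnSeries.single m (HahnSeries.single n 1) := by
  refine (coeffMap_single _ _ _).trans (congrArg _ ((coeffMap_single _ _ _).trans (congrArg _ ?_)))
  exact map_one (algebraMap ℂ A)

theorem twoVar_inv (m n : ℤ) :
    (HahnSeries.single m (HahnSeries.single n 1) : TwoVar ℂ)⁻¹ =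
      HahnSeries.single (-m) (HahnSeries.single (-n) 1) := by
  symm
  refine eq_inv_of_mul_eq_one_left ?_
  rw [HahnSeries.single_mul_single, HahnSeries.single_mul_single]
  simp

theorem scal2Hom_algebraMap {A : Type*} [Ring A] [Algebra ℂ A] (c : ℂ) :
    scal2Hom A (algebraMap ℂ (TwoVar ℂ) c) = algebraMap ℂ (TwoVar A) c := by
  rw [scal2Hom_apply, scal2_algebraMap, HahnSeries.algebraMap_apply, HahnSeries.algebraMap_apply]

theorem uu_mul_vv : uu * vv = HahnSeries.single (-1) (HahnSeries.single (-1) 1) := by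
  rw [uu, vv, HahnSeries.single_mul_single]; simp

theorem uu_div_vv : uu / vv = HahnSeries.single (-1) (HahnSeries.single 1 1) := by
  rw [div_eq_mul_inv, vv, twoVar_inv, uu, HahnSeries.single_mul_single]; simp

variable (hq : s ^ 2 - (s ^ 2)⁻¹ ≠ 0)
include hq

/-- (u wᵉ)(v w⁻ᵉ) = uv: the powers of w cancel, so the scalar matrix R(uv) is the one occurring in
the exchange relation of ℒ(u wᵉ) with ℒ(v w⁻ᵉ). Likewise for the quotient of u wᵉ and v wᵉ in the
next statement. -/
theorem rMat_uv_coact (e : ℤ) : (rMat s 1 (uu * vv)).map (scal2 (CoactTarget s kp km)) =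
    (rGen (cst _ s) (cst _ s⁻¹) (uwU s kp km (-1) e * uwV s kp km (-1) (-e))
      (uwU s kp km 1 (-e) * uwV s kp km 1 (-(-e)))).map (Subring.center _).subtype := by
  refine rMat_one_map (k := TwoVar ℂ) (B := TwoVar (CoactTarget s kp km)) hq (scal2Hom _)
    scal2Hom_algebraMap ?_ ?_
  · rw [uwU_mul_uwV, scal2Hom_apply, uu_mul_vv, scal2_single, add_neg_cancel, wT_zero]
  · rw [uwU_mul_uwV, scal2Hom_apply, uu_mul_vv, twoVar_inv, scal2_single, add_neg_cancel, wT_zero]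
    rfl

theorem rMat_u_div_v_coact (e : ℤ) : (rMat s 1 (uu / vv)).map (scal2 (CoactTarget s kp km)) =
    (rGen (cst _ s) (cst _ s⁻¹) (uwU s kp km (-1) e * uwV s kp km 1 (-e))
      (uwU s kp km 1 (-e) * uwV s kp km (-1) e)).map (Subring.center _).subtype := by
  refine rMat_one_map (k := TwoVar ℂ) (B := TwoVar (CoactTarget s kp km)) hq (scal2Hom _)
    scal2Hom_algebraMap ?_ ?_
  · rw [uwU_mul_uwV, scal2Hom_apply, uu_div_vv, scal2_single, add_neg_cancel, wT_zero]
  · rw [uwU_mul_uwV, scal2Hom_apply, uu_div_vv, twoVar_inv, scal2_single, neg_add_cancel, wT_zero]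
    rfl

/-- The dressed operator `(U⁻¹/(q+q⁻¹)) ℒ(u/w) K(u) ℒ(uw)`. -/
def dressK (s kp km : ℂ) (K : Matrix (Fin 2) (Fin 2) (HahnSeries ℤ (Aq s kp km))) :
    Matrix (Fin 2) (Fin 2) (HahnSeries ℤ (CoactTarget s kp km)) :=
  scal (CoactTarget s kp km) (prefactor s 1) •
    ((lHalf s).map (second s kp km (-1)) * K.map (first s kp km) * (lHalf s).map (second s kp km 1))

omit hq in
-- The reflection equation is insensitive to central scalar factors, hence to the prefactor
-- containing U⁻¹.
theorem reLHS_smul {A : Type*} [Ring A] [Algebra ℂ A] {c : HahnSeries ℤ A}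
    (hc : ∀ n, c.coeff n ∈ Subring.center A) (hc' : c ∈ Subring.center (HahnSeries ℤ A))
    (K : Matrix (Fin 2) (Fin 2) (HahnSeries ℤ A)) :
    reLHS s (c • K) = (inU c * inV c) • reLHS s K ∧ reRHS s (c • K) = (inU c * inV c) • reRHS s K := by
  have e1 : (c • K).map inU = inU c • K.map inU := map_smul_matrix inUHom c K
  have e2 : (c • K).map inV = inV c • K.map inV := map_smul_matrix inVHom c K
  have z1 := inU_mem_center hc
  have z2 := inV_mem_center hc'
  constructor
  · rw [reLHS, reLHS, e1, e2, leg1_eq, leg2_eq, aLeg_smul, vLeg_smul, mul_smul_matrix z1,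
      mul_smul_matrix z2, smul_mul_matrix, smul_mul_matrix, smul_smul,
      Subring.mem_center_iff.1 z2]
    rfl
  · rw [reRHS, reRHS, e1, e2, leg1_eq, leg2_eq, aLeg_smul, vLeg_smul, mul_smul_matrix z1,
      smul_mul_matrix, smul_mul_matrix, smul_mul_matrix, smul_mul_matrix, smul_smul]
    rfl

theorem dressK_reflection (hs : s ≠ 0) {K : Matrix (Fin 2) (Fin 2) (HahnSeries ℤ (Aq s kp km))}
    (hK : reLHS s K = reRHS s K) : reLHS s (dressK s kp km K) = reRHS s (dressK s kp km K) := by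
  obtain ⟨e1, e2⟩ := reLHS_smul (s := s) (c := scal (CoactTarget s kp km) (prefactor s 1))
    (fun n => algebraMap_mem_center _) (scal_mem_center _)
    ((lHalf s).map (second s kp km (-1)) * K.map (first s kp km) * (lHalf s).map (second s kp km 1))
  rw [dressK, e1, e2]
  refine congrArg (_ • ·) ?_
  have m1 : ((lHalf s).map (second s kp km (-1)) * K.map (first s kp km) *
      (lHalf s).map (second s kp km 1)).map inU =
      (lHalf s).map (inUHom.comp (secondHom s kp km (-1))) * K.map (inUHom.comp (firstHom s kp km)) *
      (lHalf s).map (inUHom.comp (secondHom s kp km 1)) :=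
    (Matrix.map_mul (f := inUHom)).trans (congrArg (· * _) (Matrix.map_mul (f := inUHom)))
  have m2 : ((lHalf s).map (second s kp km (-1)) * K.map (first s kp km) *
      (lHalf s).map (second s kp km 1)).map inV =
      (lHalf s).map (inVHom.comp (secondHom s kp km (-1))) * K.map (inVHom.comp (firstHom s kp km)) *
      (lHalf s).map (inVHom.comp (secondHom s kp km 1)) :=
    (Matrix.map_mul (f := inVHom)).trans (congrArg (· * _) (Matrix.map_mul (f := inVHom)))
  rw [reLHS, reRHS, m1, m2, leg1_eq, leg2_eq, aLeg_mul, aLeg_mul, vLeg_mul, vLeg_mul]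
  refine dressed_reflection ?_ ?_ ?_ ?_ ?_ ?_ ?_ ?_ ?_
  · have h := rll hs hq (second_eval_u (s := s) (kp := kp) (km := km) (-1)) (second_eval_v (-1))
    rw [rMat_u_div_v_coact hq (-1)]
    exact h
  · have h := rll hs hq (second_eval_u (s := s) (kp := kp) (km := km) 1) (second_eval_v 1)
    rw [rMat_u_div_v_coact hq 1]
    exact h
  -- ℒ(uw) meets ℒ(v/w) here, and ℒ(u/w) meets ℒ(vw) in the next case; in both the product of
  -- arguments is uv.
  · have h := lrl hs hq (second_eval_u (s := s) (kp := kp) (km := km) 1) (second_eval_v (-1))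
    rw [rMat_uv_coact hq 1]
    exact h
  · have h := lrl hs hq (second_eval_u (s := s) (kp := kp) (km := km) (-1)) (second_eval_v 1)
    rw [rMat_uv_coact hq (-1)]
    exact h
  -- The reflection equation of the undressed 𝒦, transported along 𝒜_q → 𝒜_q ⊗ 1.
  · have h := congrArg (fun M => M.map (map2Hom
      (Algebra.TensorProduct.includeLeft : Aq s kp km →ₐ[ℂ] CoactTarget s kp km))) hK
    have r : ∀ t, ((rMat s 1 t).map (scal2 (Aq s kp km))).map (map2Hom
      (Algebra.TensorProduct.includeLeft : Aq s kp km →ₐ[ℂ] CoactTarget s kp km)) =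
        (rMat s 1 t).map (scal2 (CoactTarget s kp km)) := fun t => by
      ext i j : 1
      exact map2Hom_scal2 _ _
    have k1 : (aLeg (Fin 2) (K.map inU)).map (map2Hom
      (Algebra.TensorProduct.includeLeft : Aq s kp km →ₐ[ℂ] CoactTarget s kp km)) =
        aLeg (Fin 2) (K.map (inUHom.comp (firstHom s kp km))) := by
      rw [aLeg_map]
      congr 1
      ext i j : 1
      exact map2Hom_inU _ _
    have k2 : (vLeg (K.map inV)).map (map2Hom
      (Algebra.TensorProduct.includeLeft : Aq s kp km →ₐ[ℂ] CoactTarget s kp km)) =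
        vLeg (K.map (inVHom.comp (firstHom s kp km))) := by
      rw [vLeg_map]
      congr 1
      ext i j : 1
      exact map2Hom_inV _ _
    simp only [reLHS, reRHS, Matrix.map_mul, r, leg1_eq, leg2_eq] at h
    exact (by simpa only [Nat.reduceAdd, k1, k2] using h)
  · exact aLeg_vLeg_comm fun i j v w =>
      commute_inU_inV fun m n => first_second_coeff_commute _ _ _ _ _
  · exact aLeg_vLeg_comm fun i j v w =>
      commute_inU_inV fun m n => first_second_coeff_commute _ _ _ _ _
  · exact aLeg_vLeg_comm fun i j v w =>
      commute_inU_inV fun m n => (first_second_coeff_commute _ _ _ _ _).symm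
  · exact aLeg_vLeg_comm fun i j v w =>
      commute_inU_inV fun m n => (first_second_coeff_commute _ _ _ _ _).symm

end Dressing

/-! ### Entries of the reflection equation and its coefficients in u. -/

section ReflectionCoeff

variable {A : Type*} [Ring A] [Algebra ℂ A]

/-- `u^{-m} v^{-n}` as a central element. -/
def uvC (A : Type*) [Ring A] [Algebra ℂ A] (m n : ℤ) : Subring.center (TwoVar A) :=
  ⟨HahnSeries.single m (HahnSeries.single n 1),
    single_mem_center (A := HahnSeries ℤ A) _ (single_mem_center _ (Subring.one_mem _))⟩

theorem rMat_uv {s : ℂ} (hq : s ^ 2 - (s ^ 2)⁻¹ ≠ 0) : (rMat s 1 (uu * vv)).map (scal2 A) =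
    (rGen (cst _ s) (cst _ s⁻¹) (uvC A (-1) (-1)) (uvC A 1 1)).map (Subring.center _).subtype := by
  refine rMat_one_map (k := TwoVar ℂ) (B := TwoVar A) hq (scal2Hom _) scal2Hom_algebraMap ?_ ?_
  · rw [scal2Hom_apply, uu_mul_vv, scal2_single]; rfl
  · rw [scal2Hom_apply, uu_mul_vv, twoVar_inv, scal2_single]; rfl

theorem rMat_u_div_v {s : ℂ} (hq : s ^ 2 - (s ^ 2)⁻¹ ≠ 0) : (rMat s 1 (uu / vv)).map (scal2 A) =
    (rGen (cst _ s) (cst _ s⁻¹) (uvC A (-1) 1) (uvC A 1 (-1))).map (Subring.center _).subtype := by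
  refine rMat_one_map (k := TwoVar ℂ) (B := TwoVar A) hq (scal2Hom _) scal2Hom_algebraMap ?_ ?_
  · rw [scal2Hom_apply, uu_div_vv, scal2_single]; rfl
  · rw [scal2Hom_apply, uu_div_vv, twoVar_inv, scal2_single]; rfl

theorem omega_smul (s : ℂ) {B : Type*} [Ring B] [Algebra ℂ B] (Z : B) :
    (cst _ s ^ 2 - cst _ s⁻¹ ^ 2 : Subring.center B) • Z = (s ^ 2 - (s ^ 2)⁻¹) • Z := by
  rw [sub_smul, sq, sq, cst_mul, cst_mul, cst_smul, cst_smul, ← sub_smul, ← mul_inv, sq]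

/-- Entries of `K₁(u) R(uv) K₂(v)`. -/
def krk (s : ℂ) (K : Matrix (Fin 2) (Fin 2) (HahnSeries ℤ A)) (i j m l : Fin 2) : TwoVar A :=
  rDiag (cst _ s) (cst _ s⁻¹) (uvC A (-1) (-1)) (uvC A 1 1) m j * (inU (K i m) * inV (K j l)) +
    if m = j then (s ^ 2 - (s ^ 2)⁻¹) •
      (inU (K i (j + 1)) * inV (K (j + 1) l)) else 0

/-- Entries of `K₂(v) R(uv) K₁(u)`. -/
def krk' (s : ℂ) (K : Matrix (Fin 2) (Fin 2) (HahnSeries ℤ A)) (i j m l : Fin 2) : TwoVar A :=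
  rDiag (cst _ s) (cst _ s⁻¹) (uvC A (-1) (-1)) (uvC A 1 1) i l * (inV (K j l) * inU (K i m)) +
    if i = l then (s ^ 2 - (s ^ 2)⁻¹) •
      (inV (K j (i + 1)) * inU (K (i + 1) m)) else 0

theorem reLHS_apply {s : ℂ} (hq : s ^ 2 - (s ^ 2)⁻¹ ≠ 0)
    (K : Matrix (Fin 2) (Fin 2) (HahnSeries ℤ A)) (i j m l : Fin 2) :
    reLHS s K (i, j) (m, l) =
      rDiag (cst _ s) (cst _ s⁻¹) (uvC A (-1) 1) (uvC A 1 (-1)) i j * krk s K i j m l +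
        if i = j then 0 else (s ^ 2 - (s ^ 2)⁻¹) •
          krk s K j i m l := by
  have h : reLHS s K = (rGen (cst _ s) (cst _ s⁻¹) (uvC A (-1) 1) (uvC A 1 (-1))).map
      (Subring.center _).subtype * (aLeg (Fin 2) (K.map inU) *
      (rGen (cst _ s) (cst _ s⁻¹) (uvC A (-1) (-1)) (uvC A 1 1)).map (Subring.center _).subtype *
        vLeg (K.map inV)) := by
    rw [reLHS, rMat_uv hq, rMat_u_div_v hq]
    simp only [mul_assoc]
    rfl
  rw [h, Matrix.mul_apply, Fintype.sum_prod_type]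
  simp only [aLeg_rGen_vLeg_apply, Matrix.map_apply, Subring.subtype_apply]
  rw [sum_rGen_mul]
  simp only [omega_smul]
  rfl

theorem reRHS_apply {s : ℂ} (hq : s ^ 2 - (s ^ 2)⁻¹ ≠ 0)
    (K : Matrix (Fin 2) (Fin 2) (HahnSeries ℤ A)) (i j m l : Fin 2) :
    reRHS s K (i, j) (m, l) =
      rDiag (cst _ s) (cst _ s⁻¹) (uvC A (-1) 1) (uvC A 1 (-1)) m l * krk' s K i j m l +
        if m = l then 0 else (s ^ 2 - (s ^ 2)⁻¹) •
          krk' s K i j l m := by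
  have h : reRHS s K = (vLeg (K.map inV) *
      (rGen (cst _ s) (cst _ s⁻¹) (uvC A (-1) (-1)) (uvC A 1 1)).map (Subring.center _).subtype *
        aLeg (Fin 2) (K.map inU)) *
      (rGen (cst _ s) (cst _ s⁻¹) (uvC A (-1) 1) (uvC A 1 (-1))).map
      (Subring.center _).subtype := by
    rw [reRHS, rMat_uv hq, rMat_u_div_v hq]
    rfl
  rw [h, Matrix.mul_apply, Fintype.sum_prod_type]
  simp only [vLeg_rGen_aLeg_apply, Matrix.map_apply, Subring.subtype_apply]
  rw [sum_mul_rGen]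
  simp only [omega_smul]
  rfl

theorem uvC_mul_coeff (m n k : ℤ) (Z : TwoVar A) :
    ((uvC A m n : TwoVar A) * Z).coeff k = HahnSeries.single n 1 * Z.coeff (k - m) :=
  HahnSeries.coeff_single_mul

theorem rDiag_coeff (s : ℂ) (n n' k : ℤ) (i j : Fin 2) (Z : TwoVar A) :
    (((rDiag (cst _ s) (cst _ s⁻¹) (uvC A (-1) n) (uvC A 1 n') i j : Subring.center (TwoVar A)) :
      TwoVar A) * Z).coeff k =
      (if i = j then s ^ 2 else 1) • (HahnSeries.single n 1 * Z.coeff (k + 1)) -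
      (if i = j then (s ^ 2)⁻¹ else 1) • (HahnSeries.single n' 1 * Z.coeff (k - 1)) := by
  have hc : ∀ c : ℂ, ((cst (TwoVar A) c ^ 2 : Subring.center _) : TwoVar A) * Z = c ^ 2 • Z := by
    intro c
    rw [sq, cst_mul, cst_coe, ← Algebra.smul_def, sq]
  rw [rDiag]
  split_ifs
  · rw [AddSubgroupClass.coe_sub, sub_mul, Subring.coe_mul, Subring.coe_mul, mul_assoc, mul_assoc, hc, hc,
      HahnSeries.coeff_sub, uvC_mul_coeff, uvC_mul_coeff, sub_neg_eq_add, HahnSeries.coeff_smul,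
      HahnSeries.coeff_smul, mul_smul_hahn, mul_smul_hahn, inv_pow]
  · rw [AddSubgroupClass.coe_sub, sub_mul, HahnSeries.coeff_sub, uvC_mul_coeff, uvC_mul_coeff, one_smul,
      one_smul, sub_neg_eq_add]

theorem inU_mul_inV_coeff (x y : HahnSeries ℤ A) (n : ℤ) :
    (inU x * inV y).coeff n = HahnSeries.C (x.coeff n) * y := by
  change (inU x * HahnSeries.single 0 y).coeff n = _
  rw [HahnSeries.coeff_mul_single_zero, inU_coeff]

theorem inV_mul_inU_coeff (x y : HahnSeries ℤ A) (n : ℤ) :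
    (inV y * inU x).coeff n = y * HahnSeries.C (x.coeff n) := by
  change (HahnSeries.single 0 y * inU x).coeff n = _
  rw [HahnSeries.coeff_single_zero_mul, inU_coeff]

variable {s kp km : ℂ} (hs : s ≠ 0) (hq : s ^ 2 - (s ^ 2)⁻¹ ≠ 0) (hq' : s ^ 2 + (s ^ 2)⁻¹ ≠ 0)
  {g : AqGen → A} (hg : reLHS s (kHalf s kp km g) = reRHS s (kHalf s kp km g))
include hs hq hq' hg

/-- The relations obtained from the coefficients of `u` in the reflection equation. -/
theorem kHalf_relations {K : Matrix (Fin 2) (Fin 2) (HahnSeries ℤ A)} (hKg : kHalf s kp km g = K) :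
    (HahnSeries.single 0 (g (AqGen.Wm 0)) * K 0 0 - K 0 0 * HahnSeries.single 0 (g (AqGen.Wm 0)) =
      (s ^ 2)⁻¹ • (uInv A * (km • K 0 1 - kp • K 1 0))) ∧
    (HahnSeries.single 0 (g (AqGen.Wm 0)) * K 1 1 - K 1 1 * HahnSeries.single 0 (g (AqGen.Wm 0)) =
      s ^ 2 • (uVar A * (kp • K 1 0 - km • K 0 1))) ∧
    (s ^ 2 • (HahnSeries.single 0 (g (AqGen.Wm 0)) * K 0 1) -
      (s ^ 2)⁻¹ • (K 0 1 * HahnSeries.single 0 (g (AqGen.Wm 0))) =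
      kp • (uVar A * K 0 0 - uInv A * K 1 1)) ∧
    (s ^ 2 • (K 0 1 * HahnSeries.single 0 (g (AqGen.Wp 0))) -
      (s ^ 2)⁻¹ • (HahnSeries.single 0 (g (AqGen.Wp 0)) * K 0 1) =
      kp • (uVar A * K 1 1 - uInv A * K 0 0)) := by
  obtain ⟨g00, g01, g10, g11⟩ := kHalf_graded (kp := kp) (km := km) hs hq' g
  have c00 := kHalf_coeff_00 (kp := kp) (km := km) hs hq' g
  have c11 := kHalf_coeff_11 (kp := kp) (km := km) hs hq' g
  have c01 := kHalf_coeff_01 (kp := kp) (km := km) hs hq' g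
  have c10 := kHalf_coeff_10 (kp := kp) (km := km) hs hq' g
  have z00 : ∀ n : ℤ, n < 1 → _ := fun n => g00.coeff_eq_zero_of_lt
  have z11 : ∀ n : ℤ, n < 1 → _ := fun n => g11.coeff_eq_zero_of_lt
  have z01 : ∀ n : ℤ, n < 0 → _ := fun n => g01.coeff_eq_zero_of_lt
  have z10 : ∀ n : ℤ, n < 0 → _ := fun n => g10.coeff_eq_zero_of_lt
  -- The coefficient of u¹. The diagonal entries of 𝒦(u) have order u⁻¹ with leading coefficients
  -- (q+q⁻¹)W₀ and (q+q⁻¹)W₁, while R(u/v) and R(uv) contribute u²; so in the four entries below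
  -- only W₀, W₁ and the scalar leading terms survive from 𝒦(u), while 𝒦(v) remains a full series.
  have key := fun i j m l => congrArg (fun x => x.coeff (-1)) (congrFun (congrFun hg (i, j)) (m, l))
  simp only [reLHS_apply hq, reRHS_apply hq] at key
  rw [hKg] at g00 g01 g10 g11 c00 c11 c01 c10 z00 z11 z01 z10
  simp only [hKg] at key
  have h11 : (1 : Fin 2) + 1 = 0 := rfl
  have hq0 : s ^ 2 ≠ 0 := pow_ne_zero _ hs
  have ca : ∀ (c : ℂ) (y : HahnSeries ℤ A), y * HahnSeries.single 0 (algebraMap ℂ A c) = c • y := by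
    intro c y
    rw [← algebraMap_eq_single, ← Algebra.commutes, Algebra.smul_def]
  have ca' : ∀ (c : ℂ) (y : HahnSeries ℤ A), HahnSeries.single 0 (algebraMap ℂ A c) * y = c • y := by
    intro c y
    rw [← algebraMap_eq_single, Algebra.smul_def]
  have cm : ∀ (c : ℂ) (x : A), HahnSeries.single (0 : ℤ) (c • x) =
      c • HahnSeries.single (0 : ℤ) x :=
    fun c x => (smul_single' c 0 x).symm
  have e1 : (HahnSeries.single (-1) 1 : HahnSeries ℤ A) = uVar A := rfl
  have e2 : (HahnSeries.single 1 1 : HahnSeries ℤ A) = uInv A := rfl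
  have r1 := key 0 0 0 0
  have r2 := key 0 1 0 1
  have r3 := key 0 0 0 1
  have r4 := key 1 0 1 1
  have h01 : (0 : Fin 2) ≠ 1 := by decide
  have h10 : (1 : Fin 2) ≠ 0 := by decide
  simp only [krk, krk', rDiag_coeff, h11, HahnSeries.coeff_add, HahnSeries.coeff_smul,
    inU_mul_inV_coeff, inV_mul_inU_coeff, if_true, h01, h10, if_false, add_zero, zero_add] at r1 r2 r3 r4
  norm_num [z00, z11, z01, z10, c00, c11, c01, c10, HahnSeries.C_apply, ca, ca', cm, e1, e2,
    -HahnSeries.single_zero_mul_eq_smul, -map_mul, -map_div₀] at r1 r2 r3 r4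
  generalize HahnSeries.single (0 : ℤ) (g (AqGen.Wm 0)) = w at *
  generalize HahnSeries.single (0 : ℤ) (g (AqGen.Wp 0)) = w' at *
  simp only [mul_add, mul_smul_hahn, uInv_mul_uVar_mul, mul_sub] at r1 r2 r3 r4 ⊢
  generalize K 0 0 = a at *
  generalize K 0 1 = b at *
  generalize K 1 0 = c at *
  generalize K 1 1 = d at *
  have hd : (s ^ 2 - (s ^ 2)⁻¹) ≠ 0 := hq
  clear hg key g00 g01 g10 g11 c00 c11 c01 c10 z00 z11 z01 z10 e1 e2
  have hd4 : s ^ 4 - 1 ≠ 0 := by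
    intro h
    apply hq
    field_simp
    linear_combination h
  have hd4' : -1 + s ^ 4 ≠ 0 := by rwa [neg_add_eq_sub]
  have hd4'' : 1 - s ^ 4 ≠ 0 := by
    intro h
    exact hd4 (by linear_combination -h)
  have hne : (s ^ 2 + (s ^ 2)⁻¹) * s ^ 2 ≠ 0 := mul_ne_zero hq' hq0
  refine ⟨?_, ?_, ?_, ?_⟩
  · refine smul_right_injective _ (mul_ne_zero hne hq0) ?_
    linear_combination (norm := skip) r1
    match_scalars <;> field_simp <;> ring
  · refine smul_right_injective _ hq' ?_
    linear_combination (norm := skip) r2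
    match_scalars <;> field_simp <;> ring
  · refine smul_right_injective _ hne ?_
    linear_combination (norm := skip) r3
    match_scalars <;> field_simp <;> ring
  · refine smul_right_injective _ hne ?_
    linear_combination (norm := skip) -r4
    match_scalars <;> field_simp <;> ring
end ReflectionCoeff

/-! ### Relations of W₀ and W₁ with the generating functions. -/

section AlternatingRelations

variable {A : Type*} [Ring A] [Algebra ℂ A]

theorem single_mul_genFun (s : ℂ) (x : A) (a : ℕ → A) :
    HahnSeries.single 0 x * genFun s a = genFun s (fun k => x * a k) := by
  rw [← LinearMap.mulLeft_apply (R := ℂ), ← HahnSeries.C_apply]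
  refine Eq.trans ?_ (coeffMap_genFun (LinearMap.mulLeft ℂ x) a)
  ext n
  exact HahnSeries.coeff_single_zero_mul

theorem genFun_mul_single (s : ℂ) (x : A) (a : ℕ → A) :
    genFun s a * HahnSeries.single 0 x = genFun s (fun k => a k * x) := by
  refine Eq.trans ?_ (coeffMap_genFun (LinearMap.mulRight ℂ x) a)
  ext n
  exact HahnSeries.coeff_mul_single_zero

theorem genFun_sub (s : ℂ) (a b : ℕ → A) :
    genFun s (fun k => a k - b k) = genFun s a - genFun s b := by
  have h := genFun_add (s := s) (fun k => a k - b k) b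
  simp only [sub_add_cancel] at h
  exact eq_sub_of_add_eq h.symm

theorem quartic_add_ne {s : ℂ} (hs : s ≠ 0) (hq' : s ^ 2 + (s ^ 2)⁻¹ ≠ 0) : 1 + s ^ 4 ≠ 0 := by
  intro h
  apply hq'
  field_simp
  linear_combination h

theorem quartic_sub_ne {s : ℂ} (hs : s ≠ 0) (hq : s ^ 2 - (s ^ 2)⁻¹ ≠ 0) : 1 - s ^ 4 ≠ 0 := by
  intro h
  apply hq
  field_simp
  linear_combination -h

theorem scal_uCap_eq {s : ℂ} (hs : s ≠ 0) (hq' : s ^ 2 + (s ^ 2)⁻¹ ≠ 0) (x : HahnSeries ℤ A) :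
    scal A (uCap s) * x =
    (s ^ 2 + (s ^ 2)⁻¹)⁻¹ • (s ^ 2 • (uVar A * (uVar A * x)) +
      (s ^ 2)⁻¹ • (uInv A * (uInv A * x))) := by
  ext n
  rw [scal_uCap_mul_coeff hs hq', HahnSeries.coeff_smul, HahnSeries.coeff_add, HahnSeries.coeff_smul,
    HahnSeries.coeff_smul]
  simp only [uVar, uInv, HahnSeries.coeff_single_mul, one_mul]
  rw [smul_add, smul_smul, smul_smul, mul_comm, mul_comm _ (s ^ 2 + (s ^ 2)⁻¹)⁻¹,
    show n - -1 - -1 = n + 2 by ring, show n - 1 - 1 = n - 2 by ring]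

variable {s kp km : ℂ} (hs : s ≠ 0) (hq : s ^ 2 - (s ^ 2)⁻¹ ≠ 0) (hq' : s ^ 2 + (s ^ 2)⁻¹ ≠ 0)
  (hkp : kp ≠ 0) (hkm : km ≠ 0)
  {g : AqGen → A} (hg : reLHS s (kHalf s kp km g) = reRHS s (kHalf s kp km g))

include hs hq'

omit hq' in
-- Cancels the determinant that appears when 𝒲₊ and 𝒲₋ are separated in the diagonal entries of 𝒦.
theorem quad_injective {x y : HahnSeries ℤ A}
    (h : (s ^ 2) ^ 2 • (uVar A * (uVar A * x)) - (s ^ 2)⁻¹ ^ 2 • (uInv A * (uInv A * x)) =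
      (s ^ 2) ^ 2 • (uVar A * (uVar A * y)) - (s ^ 2)⁻¹ ^ 2 • (uInv A * (uInv A * y))) : x = y := by
  rw [← wInv_mul hs x, h, wInv_mul hs y]

include hq hg

/-- The first two relations concern commutators of W₀ with both diagonal entries, each a mixture of
𝒲₊ and 𝒲₋; they are unmixed as in `exists_kHalf`. In the other two the combination of diagonal
entries on the right already simplifies to U𝒲_± − 𝒲_∓. -/
theorem genFun_relations {w w' : HahnSeries ℤ A} (hw : w = HahnSeries.single 0 (g (AqGen.Wm 0)))
    (hw' : w' = HahnSeries.single 0 (g (AqGen.Wp 0))) {WP WM b c : HahnSeries ℤ A}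
    (hWP : WP = genFun s fun k => g (AqGen.Wm k)) (hWM : WM = genFun s fun k => g (AqGen.Wp k))
    (hb : b = kHalf s kp km g 0 1) (hc : c = kHalf s kp km g 1 0) :
    w * WP - WP * w = 0 ∧ w * WM - WM * w = kp • c - km • b ∧
    s ^ 2 • (w * b) - (s ^ 2)⁻¹ • (b * w) =
      (kp * (s ^ 2 + (s ^ 2)⁻¹)) • (scal A (uCap s) * WP - WM) ∧
    s ^ 2 • (b * w') - (s ^ 2)⁻¹ • (w' * b) =
      (kp * (s ^ 2 + (s ^ 2)⁻¹)) • (scal A (uCap s) * WM - WP) := by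
  obtain ⟨r1, r2, r3, r4⟩ := kHalf_relations hs hq hq' hg rfl
  have k00 : kHalf s kp km g 0 0 = s ^ 2 • (uVar A * WP) - (s ^ 2)⁻¹ • (uInv A * WM) := by
    rw [hWP, hWM]; rfl
  have k11 : kHalf s kp km g 1 1 = s ^ 2 • (uVar A * WM) - (s ^ 2)⁻¹ • (uInv A * WP) := by
    rw [hWP, hWM]; rfl
  rw [← hw, k00, ← hb, ← hc] at r1
  rw [← hw, k11, ← hb, ← hc] at r2
  rw [← hw, k00, k11, ← hb] at r3
  rw [← hw', k00, k11, ← hb] at r4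
  have cu : ∀ x, w * (uVar A * x) = uVar A * (w * x) := fun x => by
    rw [← mul_assoc, Subring.mem_center_iff.1 (uVar_mem_center A), mul_assoc]
  have ci : ∀ x, w * (uInv A * x) = uInv A * (w * x) := fun x => by
    rw [← mul_assoc, Subring.mem_center_iff.1 (uInv_mem_center A), mul_assoc]
  -- Multiples by q u and q⁻¹u⁻¹: `r1' + r2''` isolates 𝒲₊ and `r2' + r1''` isolates 𝒲₋.
  have r1' := congrArg (fun x => s ^ 2 • (uVar A * x)) r1
  have r1'' := congrArg (fun x => (s ^ 2)⁻¹ • (uInv A * x)) r1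
  have r2' := congrArg (fun x => s ^ 2 • (uVar A * x)) r2
  have r2'' := congrArg (fun x => (s ^ 2)⁻¹ • (uInv A * x)) r2
  simp only [mul_sub, sub_mul, mul_add, smul_sub, mul_smul_hahn, smul_mul_hahn, cu, ci,
    uVar_mul_uInv_mul, uInv_mul_uVar_mul, scal_uCap_eq hs hq', mul_assoc] at r1' r1'' r2' r2'' r3 r4 ⊢
  have h1 := quartic_add_ne hs hq'
  have h1' : s ^ 4 + 1 ≠ 0 := by rwa [add_comm]
  refine ⟨quad_injective hs ?_, quad_injective hs ?_, ?_, ?_⟩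
  · simp only [mul_sub, mul_zero]
    linear_combination (norm := skip) r1' + r2''
    match_scalars <;> field_simp <;> ring
  · simp only [mul_sub, mul_smul_hahn]
    linear_combination (norm := skip) r2' + r1''
    match_scalars <;> field_simp <;> ring
  · rw [r3]
    match_scalars <;> field_simp <;> ring
  · rw [r4]
    match_scalars <;> field_simp <;> ring

include hkp hkm

/-- The relations between `W_0`, `W_1` and the alternating generators. -/
theorem alternating_relations (k : ℕ) :
    g (AqGen.Wm 0) * g (AqGen.Wm k) = g (AqGen.Wm k) * g (AqGen.Wm 0) ∧
    (s ^ 2 + (s ^ 2)⁻¹) • (g (AqGen.Wm 0) * g (AqGen.Wp k) - g (AqGen.Wp k) * g (AqGen.Wm 0)) =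
      g (AqGen.Gt k) - g (AqGen.G k) ∧
    qComm (s ^ 2) (g (AqGen.Wm 0)) (g (AqGen.G k)) = (kp * km * (s ^ 2 + (s ^ 2)⁻¹) ^ 2) •
      (g (AqGen.Wm (k + 1)) - g (AqGen.Wp k)) ∧
    qComm (s ^ 2) (g (AqGen.G k)) (g (AqGen.Wp 0)) = (kp * km * (s ^ 2 + (s ^ 2)⁻¹) ^ 2) •
      (g (AqGen.Wp (k + 1)) - g (AqGen.Wm k)) := by
  obtain ⟨r1, r2, r3, r4⟩ := genFun_relations hs hq hq' hg rfl rfl rfl rfl rfl rfl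
  have hb : kHalf s kp km g 0 1 = (km * (s ^ 2 + (s ^ 2)⁻¹))⁻¹ • genFun s (fun k => g (AqGen.G k)) +
    (kp * (s ^ 2 + (s ^ 2)⁻¹) / (s ^ 2 - (s ^ 2)⁻¹)) • (1 : HahnSeries ℤ A) := rfl
  have hc : kHalf s kp km g 1 0 = (kp * (s ^ 2 + (s ^ 2)⁻¹))⁻¹ • genFun s (fun k => g (AqGen.Gt k)) +
    (km * (s ^ 2 + (s ^ 2)⁻¹) / (s ^ 2 - (s ^ 2)⁻¹)) • (1 : HahnSeries ℤ A) := rfl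
  simp only [hb, hc, mul_add, add_mul, mul_smul_hahn, smul_mul_hahn, mul_one, one_mul] at r2 r3 r4
  rw [scal_uCap_mul_genFun hs hq'] at r3 r4
  simp only [single_mul_genFun, genFun_mul_single] at r1 r2 r3 r4
  have h1 := quartic_add_ne hs hq'
  have h2 : s ^ 4 + 1 ≠ 0 := by rwa [add_comm]
  have h3 := quartic_sub_ne hs hq
  have h4 : s ^ 4 - 1 ≠ 0 := by rwa [← neg_ne_zero, neg_sub]
  have i := genFun_injective (A := A) hs hq'
  refine ⟨?_, ?_, ?_, ?_⟩
  · exact congrFun (i (sub_eq_zero.1 r1)) k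
  · refine congrFun (i (a₁ := fun k => (s ^ 2 + (s ^ 2)⁻¹) • (g (AqGen.Wm 0) * g (AqGen.Wp k) - g (AqGen.Wp k) * g (AqGen.Wm 0))) (a₂ := fun k => g (AqGen.Gt k) - g (AqGen.G k)) ?_) k
    rw [genFun_smul, genFun_sub, genFun_sub]
    linear_combination (norm := skip) (s ^ 2 + (s ^ 2)⁻¹) • r2
    match_scalars <;> field_simp <;> ring
  · refine congrFun (i (a₁ := fun k => qComm (s ^ 2) (g (AqGen.Wm 0)) (g (AqGen.G k))) (a₂ := fun k => (kp * km * (s ^ 2 + (s ^ 2)⁻¹) ^ 2) •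
      (g (AqGen.Wm (k + 1)) - g (AqGen.Wp k))) ?_) k
    simp only [qComm]
    rw [genFun_smul, genFun_sub, genFun_sub, genFun_smul, genFun_smul]
    linear_combination (norm := skip) (km * (s ^ 2 + (s ^ 2)⁻¹)) • r3
    match_scalars <;> field_simp <;> ring
  · refine congrFun (i (a₁ := fun k => qComm (s ^ 2) (g (AqGen.G k)) (g (AqGen.Wp 0))) (a₂ := fun k => (kp * km * (s ^ 2 + (s ^ 2)⁻¹) ^ 2) •
      (g (AqGen.Wp (k + 1)) - g (AqGen.Wm k))) ?_) k
    simp only [qComm]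
    rw [genFun_smul, genFun_sub, genFun_sub, genFun_smul, genFun_smul]
    linear_combination (norm := skip) (km * (s ^ 2 + (s ^ 2)⁻¹)) • r4
    match_scalars <;> field_simp <;> ring

end AlternatingRelations

/-! ### The reflection equation under algebra maps. -/

section Naturality

variable {A B : Type*} [Ring A] [Ring B] [Algebra ℂ A] [Algebra ℂ B]

theorem reLHS_map (f : A →ₐ[ℂ] B) (s : ℂ) (K : Matrix (Fin 2) (Fin 2) (HahnSeries ℤ A)) :
    reLHS s (K.map (mapCoeff f)) = (reLHS s K).map (map2Hom f) ∧
    reRHS s (K.map (mapCoeff f)) = (reRHS s K).map (map2Hom f) := by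
  have r : ∀ t, ((rMat s 1 t).map (scal2 A)).map (map2Hom f) = (rMat s 1 t).map (scal2 B) :=
    fun t => by
      ext i j : 1
      exact map2Hom_scal2 _ _
  have k1 : (aLeg (Fin 2) (K.map inU)).map (map2Hom f) =
      aLeg (Fin 2) ((K.map (mapCoeff f)).map inU) := by
    rw [aLeg_map]
    congr 1
    ext i j : 1
    exact map2Hom_inU _ _
  have k2 : (vLeg (K.map inV)).map (map2Hom f) =
      vLeg ((K.map (mapCoeff f)).map inV) := by
    rw [vLeg_map]
    congr 1
    ext i j : 1
    exact map2Hom_inV _ _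
  constructor
  · simp only [reLHS, Matrix.map_mul, r, leg1_eq, leg2_eq, Nat.reduceAdd, k1, k2]
  · simp only [reRHS, Matrix.map_mul, r, leg1_eq, leg2_eq, Nat.reduceAdd, k1, k2]

end Naturality

/-! ### The universal property of 𝒜_q. -/

section Presentation

variable {s kp km : ℂ}

def aqMk (s kp km : ℂ) : FreeAlgebra ℂ AqGen →ₐ[ℂ] Aq s kp km := RingQuot.mkAlgHom ℂ (AqRel s kp km)

theorem kHalf_gen : kHalf s kp km (Aq.gen s kp km) =
    (kHalf s kp km (FreeAlgebra.ι ℂ)).map (mapCoeff (aqMk s kp km)) :=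
  (kHalf_map (aqMk s kp km) s kp km _).symm

theorem aq_reflection : reLHS s (kHalf s kp km (Aq.gen s kp km)) =
    reRHS s (kHalf s kp km (Aq.gen s kp km)) := by
  rw [kHalf_gen, (reLHS_map _ _ _).1, (reLHS_map _ _ _).2]
  ext i j m n
  exact RingQuot.mkAlgHom_rel ℂ (AqRel.refl i j m n)

/-- A solution of the reflection equation of the form `kHalf` is a homomorphism out of 𝒜_q, since by
naturality the image of each defining relation is a coefficient of that equation. -/
theorem exists_aqLift {B : Type*} [Ring B] [Algebra ℂ B] (g : AqGen → B)
    (hg : reLHS s (kHalf s kp km g) = reRHS s (kHalf s kp km g)) :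
    ∃ δ : Aq s kp km →ₐ[ℂ] B, ∀ x, δ (Aq.gen s kp km x) = g x := by
  have hk : kHalf s kp km g =
      (kHalf s kp km (FreeAlgebra.ι ℂ)).map (mapCoeff (FreeAlgebra.lift ℂ g)) := by
    rw [kHalf_map]
    congr 1
    ext x
    exact (FreeAlgebra.lift_ι_apply g x).symm
  refine ⟨RingQuot.liftAlgHom ℂ ⟨FreeAlgebra.lift ℂ g, ?_⟩, fun x => ?_⟩
  · rintro _ _ ⟨i, j, m, n⟩
    rw [hk, (reLHS_map _ _ _).1, (reLHS_map _ _ _).2] at hg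
    exact congrArg (fun x => (x.coeff m).coeff n) (congrFun (congrFun hg i) j)
  · exact (RingQuot.liftAlgHom_mkAlgHom_apply ..).trans (FreeAlgebra.lift_ι_apply g x)

end Presentation

/-! ### Expansion of the product ℒ(u/w) 𝒦(u) ℒ(uw). -/

section Values

variable {s kp km : ℂ}

/-- Right tensoring `∑ xₙ u^{-n} ↦ ∑ (xₙ ⊗ c) u^{-n}`. -/
def tensorR (kp km : ℂ) (c : (Uq s)[T;T⁻¹]) :
    HahnSeries ℤ (Aq s kp km) →+ HahnSeries ℤ (CoactTarget s kp km) :=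
  coeffMap fun _ => ((TensorProduct.mk ℂ (Aq s kp km) (Uq s)[T;T⁻¹]).flip c).toAddMonoidHom

theorem tensorR_coeff (c : (Uq s)[T;T⁻¹]) (x : HahnSeries ℤ (Aq s kp km)) (n : ℤ) :
    (tensorR kp km c x).coeff n = x.coeff n ⊗ₜ c := rfl

theorem tensorR_genFun (c : (Uq s)[T;T⁻¹]) (a : ℕ → Aq s kp km) :
    tensorR kp km c (genFun s a) = genFun s (fun k => a k ⊗ₜ c) :=
  coeffMap_genFun ((TensorProduct.mk ℂ (Aq s kp km) (Uq s)[T;T⁻¹]).flip c) a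

theorem tensorR_smul_left (a : ℂ) (c : (Uq s)[T;T⁻¹]) (x : HahnSeries ℤ (Aq s kp km)) :
    tensorR kp km (a • c) x = a • tensorR kp km c x := by
  ext n
  rw [HahnSeries.coeff_smul]
  exact TensorProduct.tmul_smul _ _ _

theorem tensorR_smul (a : ℂ) (c : (Uq s)[T;T⁻¹]) (x : HahnSeries ℤ (Aq s kp km)) :
    tensorR kp km c (a • x) = a • tensorR kp km c x := by
  ext n
  rw [HahnSeries.coeff_smul, tensorR_coeff, HahnSeries.coeff_smul]
  exact (TensorProduct.smul_tmul' _ _ _).symm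

theorem tensorR_uCap (hs : s ≠ 0) (hq' : s ^ 2 + (s ^ 2)⁻¹ ≠ 0) (c : (Uq s)[T;T⁻¹])
    (x : HahnSeries ℤ (Aq s kp km)) :
    tensorR kp km c (scal _ (uCap s) * x) = scal _ (uCap s) * tensorR kp km c x := by
  ext n
  simp only [scal_uCap_mul_coeff hs hq', tensorR_coeff, TensorProduct.add_tmul,
    TensorProduct.smul_tmul']

theorem single_first_single (m n : ℤ) (a b : (Uq s)[T;T⁻¹]) (x : HahnSeries ℤ (Aq s kp km)) :
    (HahnSeries.single m ((1 : Aq s kp km) ⊗ₜ[ℂ] a) : HahnSeries ℤ (CoactTarget s kp km)) *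
      first s kp km x * HahnSeries.single n (1 ⊗ₜ b) =
      tensorR kp km (a * b) (HahnSeries.single (m + n) 1 * x) := by
  ext k
  rw [HahnSeries.coeff_mul_single, HahnSeries.coeff_single_mul, tensorR_coeff,
    HahnSeries.coeff_single_mul, one_mul]
  change (1 ⊗ₜ[ℂ] a) * (x.coeff _ ⊗ₜ 1) * (1 ⊗ₜ b) = _
  rw [Algebra.TensorProduct.tmul_mul_tmul, Algebra.TensorProduct.tmul_mul_tmul, one_mul, mul_one,
    mul_one]
  congr 2
  ring

theorem wMono_mul (m n : ℤ) (a b : Uq s) : wMono m a * wMono n b = wMono (m + n) (a * b) := by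
  rw [wMono, wMono, wMono, map_mul, LaurentPolynomial.T_add, mul_assoc, mul_assoc,
    ← mul_assoc (LaurentPolynomial.T m), LaurentPolynomial.T_mul, mul_assoc]

theorem wMono_smul (c : ℂ) (n : ℤ) (a : Uq s) : wMono n (c • a) = c • wMono n a := by
  rw [wMono, wMono, Algebra.smul_def, map_mul, ← smul_mul_assoc, Algebra.smul_def c (LaurentPolynomial.C a),
    LaurentPolynomial.algebraMap_apply]

theorem second_single_wMono (e n : ℤ) (a : Uq s) : second s kp km e (HahnSeries.single n a) =
    HahnSeries.single n (1 ⊗ₜ wMono (-(e * n)) a) :=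
  coeffMap_single _ _ _

theorem Uq.Kh_mul_E : Uq.gen s .Kh * Uq.gen s .E = s ^ 2 • (Uq.gen s .E * Uq.gen s .Kh) := by
  have h := RingQuot.mkAlgHom_rel ℂ (UqRel.KE (s := s))
  rw [map_smul, map_mul, map_mul] at h
  exact h

theorem Uq.Kh_mul_F : Uq.gen s .Kh * Uq.gen s .F = (s ^ 2)⁻¹ • (Uq.gen s .F * Uq.gen s .Kh) := by
  have h := RingQuot.mkAlgHom_rel ℂ (UqRel.KF (s := s))
  rw [map_smul, map_mul, map_mul] at h
  exact h

theorem Uq.Kh_mul_Kih : Uq.gen s .Kh * Uq.gen s .Kih = 1 := by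
  have h := RingQuot.mkAlgHom_rel ℂ (UqRel.KKi (s := s))
  rw [map_mul, map_one] at h
  exact h

theorem Uq.Kih_mul_Kh : Uq.gen s .Kih * Uq.gen s .Kh = 1 := by
  have h := RingQuot.mkAlgHom_rel ℂ (UqRel.KiK (s := s))
  rw [map_mul, map_one] at h
  exact h

theorem Uq.Kih_mul_E (hs : s ≠ 0) :
    Uq.gen s .Kih * Uq.gen s .E = (s ^ 2)⁻¹ • (Uq.gen s .E * Uq.gen s .Kih) := by
  have h : Uq.gen s .Kih * (Uq.gen s .Kh * Uq.gen s .E) * Uq.gen s .Kih =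
      s ^ 2 • (Uq.gen s .Kih * Uq.gen s .E) := by
    rw [Uq.Kh_mul_E, mul_smul_comm, smul_mul_assoc, mul_assoc, mul_assoc, Uq.Kh_mul_Kih, mul_one]
  rw [← mul_assoc, Uq.Kih_mul_Kh, one_mul] at h
  rw [h, smul_smul, inv_mul_cancel₀ (pow_ne_zero _ hs), one_smul]

theorem Uq.Kih_mul_F (hs : s ≠ 0) :
    Uq.gen s .Kih * Uq.gen s .F = s ^ 2 • (Uq.gen s .F * Uq.gen s .Kih) := by
  have h : Uq.gen s .Kih * (Uq.gen s .Kh * Uq.gen s .F) * Uq.gen s .Kih =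
      (s ^ 2)⁻¹ • (Uq.gen s .Kih * Uq.gen s .F) := by
    rw [Uq.Kh_mul_F, mul_smul_comm, smul_mul_assoc, mul_assoc, mul_assoc, Uq.Kh_mul_Kih, mul_one]
  rw [← mul_assoc, Uq.Kih_mul_Kh, one_mul] at h
  rw [h, smul_smul, mul_inv_cancel₀ (pow_ne_zero _ hs), one_smul]

/-- The product `ℒ(u/w) K(u) ℒ(uw)`. -/
def sandwich (s kp km : ℂ) (K : Matrix (Fin 2) (Fin 2) (HahnSeries ℤ (Aq s kp km))) :
    Matrix (Fin 2) (Fin 2) (HahnSeries ℤ (CoactTarget s kp km)) :=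
  (lHalf s).map (second s kp km (-1)) * K.map (first s kp km) * (lHalf s).map (second s kp km 1)

theorem sandwich_expand {R : Type*} [Ring R] (a b f x y z v c d e : R) :
    ((a - b) * x + f * y) * (c - d) + ((a - b) * z + f * v) * e =
      a * x * c - b * x * c - a * x * d + b * x * d + f * y * c - f * y * d + a * z * e - b * z * e +
        f * v * e := by
  noncomm_ring

theorem second_lHalf (e : ℤ) :
    second s kp km e (lHalf s 0 0) = HahnSeries.single (-1) (1 ⊗ₜ wMono e (s • Uq.gen s .Kh)) -
      HahnSeries.single 1 (1 ⊗ₜ wMono (-e) (s⁻¹ • Uq.gen s .Kih)) ∧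
    second s kp km e (lHalf s 1 1) = HahnSeries.single (-1) (1 ⊗ₜ wMono e (s • Uq.gen s .Kih)) -
      HahnSeries.single 1 (1 ⊗ₜ wMono (-e) (s⁻¹ • Uq.gen s .Kh)) ∧
    second s kp km e (lHalf s 0 1) =
      HahnSeries.single 0 (1 ⊗ₜ wMono 0 ((s ^ 2 - (s ^ 2)⁻¹) • Uq.gen s .F)) ∧
    second s kp km e (lHalf s 1 0) =
      HahnSeries.single 0 (1 ⊗ₜ wMono 0 ((s ^ 2 - (s ^ 2)⁻¹) • Uq.gen s .E)) := by
  have h0 : ∀ a : Uq s, second s kp km e (HahnSeries.single 0 a) =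
      HahnSeries.single 0 (1 ⊗ₜ wMono 0 a) := fun a => by
    rw [second_single_wMono, mul_zero, neg_zero]
  have h1 : ∀ a b : Uq s, second s kp km e (HahnSeries.single (-1) a - HahnSeries.single 1 b) =
      HahnSeries.single (-1) (1 ⊗ₜ wMono e a) - HahnSeries.single 1 (1 ⊗ₜ wMono (-e) b) :=
    fun a b => by
      rw [map_sub, second_single_wMono, second_single_wMono, mul_neg_one, neg_neg, mul_one]
  exact ⟨h1 _ _, h1 _ _, h0 _, h0 _⟩

variable (K : Matrix (Fin 2) (Fin 2) (HahnSeries ℤ (Aq s kp km)))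

theorem sandwich_sum (i l : Fin 2) : sandwich s kp km K i l =
    (second s kp km (-1) (lHalf s i 0) * first s kp km (K 0 0) +
      second s kp km (-1) (lHalf s i 1) * first s kp km (K 1 0)) * second s kp km 1 (lHalf s 0 l) +
    (second s kp km (-1) (lHalf s i 0) * first s kp km (K 0 1) +
      second s kp km (-1) (lHalf s i 1) * first s kp km (K 1 1)) * second s kp km 1 (lHalf s 1 l) := by
  rw [sandwich, Matrix.mul_apply, Fin.sum_univ_two, Matrix.mul_apply, Matrix.mul_apply,
    Fin.sum_univ_two, Fin.sum_univ_two]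
  rfl

theorem sandwich_expand' {R : Type*} [Ring R] (a b f x y z v c d e : R) :
    ((a - b) * x + f * y) * e + ((a - b) * z + f * v) * (c - d) =
      a * x * e - b * x * e + f * y * e + a * z * c - b * z * c - a * z * d + b * z * d +
        f * v * c - f * v * d := by
  noncomm_ring

theorem sandwich_expand₁ {R : Type*} [Ring R] (a b f x y z v c d e : R) :
    (f * x + (a - b) * y) * (c - d) + (f * z + (a - b) * v) * e =
      f * x * c - f * x * d + a * y * c - b * y * c - a * y * d + b * y * d + f * z * e +
        a * v * e - b * v * e := by
  noncomm_ring

theorem sandwich_expand₁' {R : Type*} [Ring R] (a b f x y z v c d e : R) :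
    (f * x + (a - b) * y) * e + (f * z + (a - b) * v) * (c - d) =
      f * x * e + a * y * e - b * y * e + f * z * c - f * z * d +
        a * v * c - b * v * c - a * v * d + b * v * d := by
  noncomm_ring

variable (hs : s ≠ 0)
include hs

/-- In all four entries the second tensor factors are normally ordered, with powers of K^{1/2} on
the right, to match the monomials in the formulas for δ_w. -/
theorem sandwich_00 : sandwich s kp km K 0 0 =
    s ^ 2 • tensorR kp km (wMono 0 (Uq.gen s .Kh * Uq.gen s .Kh)) (HahnSeries.single (-2) 1 * K 0 0)
      - tensorR kp km (wMono 2 1) (HahnSeries.single 0 1 * K 0 0)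
      - tensorR kp km (wMono (-2) 1) (HahnSeries.single 0 1 * K 0 0)
      + (s ^ 2)⁻¹ • tensorR kp km (wMono 0 (Uq.gen s .Kih * Uq.gen s .Kih)) (HahnSeries.single 2 1 * K 0 0)
      + (s * (s ^ 2 - (s ^ 2)⁻¹)) • tensorR kp km (wMono 1 (Uq.gen s .F * Uq.gen s .Kh)) (HahnSeries.single (-1) 1 * K 1 0)
      - (s⁻¹ * (s ^ 2 - (s ^ 2)⁻¹)) • tensorR kp km (wMono (-1) (Uq.gen s .F * Uq.gen s .Kih)) (HahnSeries.single 1 1 * K 1 0)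
      + (s ^ 3 * (s ^ 2 - (s ^ 2)⁻¹)) • tensorR kp km (wMono (-1) (Uq.gen s .E * Uq.gen s .Kh)) (HahnSeries.single (-1) 1 * K 0 1)
      - (s⁻¹ ^ 3 * (s ^ 2 - (s ^ 2)⁻¹)) • tensorR kp km (wMono 1 (Uq.gen s .E * Uq.gen s .Kih)) (HahnSeries.single 1 1 * K 0 1)
      + (s ^ 2 - (s ^ 2)⁻¹) ^ 2 • tensorR kp km (wMono 0 (Uq.gen s .F * Uq.gen s .E)) (HahnSeries.single 0 1 * K 1 1) := by
  rw [sandwich_sum]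
  obtain ⟨e1, e2, e3, e4⟩ := second_lHalf (s := s) (kp := kp) (km := km) (-1)
  obtain ⟨f1, f2, f3, f4⟩ := second_lHalf (s := s) (kp := kp) (km := km) 1
  rw [e1, e3, f1, f4]
  refine (sandwich_expand (R := HahnSeries ℤ (CoactTarget s kp km)) ..).trans ?_
  simp only [single_first_single, wMono_mul, smul_mul_assoc, mul_smul_comm, smul_smul, wMono_smul,
    Uq.Kh_mul_E, Uq.Kih_mul_E hs, Uq.Kh_mul_Kih, Uq.Kih_mul_Kh, tensorR_smul_left,
    Int.reduceNeg, Int.reduceAdd]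
  match_scalars <;> field_simp

theorem sandwich_01 : sandwich s kp km K 0 1 =
    (s⁻¹ * (s ^ 2 - (s ^ 2)⁻¹)) • tensorR kp km (wMono (-1) (Uq.gen s .F * Uq.gen s .Kh)) (HahnSeries.single (-1) 1 * K 0 0)
      - (s * (s ^ 2 - (s ^ 2)⁻¹)) • tensorR kp km (wMono 1 (Uq.gen s .F * Uq.gen s .Kih)) (HahnSeries.single 1 1 * K 0 0)
      + (s ^ 2 - (s ^ 2)⁻¹) ^ 2 • tensorR kp km (wMono 0 (Uq.gen s .F * Uq.gen s .F)) (HahnSeries.single 0 1 * K 1 0)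
      + s ^ 2 • tensorR kp km (wMono 0 1) (HahnSeries.single (-2) 1 * K 0 1)
      - tensorR kp km (wMono 2 (Uq.gen s .Kih * Uq.gen s .Kih)) (HahnSeries.single 0 1 * K 0 1)
      - tensorR kp km (wMono (-2) (Uq.gen s .Kh * Uq.gen s .Kh)) (HahnSeries.single 0 1 * K 0 1)
      + (s ^ 2)⁻¹ • tensorR kp km (wMono 0 1) (HahnSeries.single 2 1 * K 0 1)
      + (s * (s ^ 2 - (s ^ 2)⁻¹)) • tensorR kp km (wMono 1 (Uq.gen s .F * Uq.gen s .Kih)) (HahnSeries.single (-1) 1 * K 1 1)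
      - (s⁻¹ * (s ^ 2 - (s ^ 2)⁻¹)) • tensorR kp km (wMono (-1) (Uq.gen s .F * Uq.gen s .Kh)) (HahnSeries.single 1 1 * K 1 1) := by
  rw [sandwich_sum]
  obtain ⟨e1, e2, e3, e4⟩ := second_lHalf (s := s) (kp := kp) (km := km) (-1)
  obtain ⟨f1, f2, f3, f4⟩ := second_lHalf (s := s) (kp := kp) (km := km) 1
  rw [e1, e3, f3, f2]
  refine (sandwich_expand' (R := HahnSeries ℤ (CoactTarget s kp km)) ..).trans ?_
  simp only [single_first_single, wMono_mul, smul_mul_assoc, mul_smul_comm, smul_smul, wMono_smul,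
    Uq.Kh_mul_F, Uq.Kih_mul_F hs, Uq.Kh_mul_Kih, Uq.Kih_mul_Kh, tensorR_smul_left,
    Int.reduceNeg, Int.reduceAdd]
  match_scalars <;> field_simp

theorem sandwich_10 : sandwich s kp km K 1 0 =
    (s * (s ^ 2 - (s ^ 2)⁻¹)) • tensorR kp km (wMono 1 (Uq.gen s .E * Uq.gen s .Kh)) (HahnSeries.single (-1) 1 * K 0 0)
      - (s⁻¹ * (s ^ 2 - (s ^ 2)⁻¹)) • tensorR kp km (wMono (-1) (Uq.gen s .E * Uq.gen s .Kih)) (HahnSeries.single 1 1 * K 0 0)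
      + s ^ 2 • tensorR kp km (wMono 0 1) (HahnSeries.single (-2) 1 * K 1 0)
      - tensorR kp km (wMono 2 (Uq.gen s .Kh * Uq.gen s .Kh)) (HahnSeries.single 0 1 * K 1 0)
      - tensorR kp km (wMono (-2) (Uq.gen s .Kih * Uq.gen s .Kih)) (HahnSeries.single 0 1 * K 1 0)
      + (s ^ 2)⁻¹ • tensorR kp km (wMono 0 1) (HahnSeries.single 2 1 * K 1 0)
      + (s ^ 2 - (s ^ 2)⁻¹) ^ 2 • tensorR kp km (wMono 0 (Uq.gen s .E * Uq.gen s .E)) (HahnSeries.single 0 1 * K 0 1)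
      + (s⁻¹ * (s ^ 2 - (s ^ 2)⁻¹)) • tensorR kp km (wMono (-1) (Uq.gen s .E * Uq.gen s .Kih)) (HahnSeries.single (-1) 1 * K 1 1)
      - (s * (s ^ 2 - (s ^ 2)⁻¹)) • tensorR kp km (wMono 1 (Uq.gen s .E * Uq.gen s .Kh)) (HahnSeries.single 1 1 * K 1 1) := by
  rw [sandwich_sum]
  obtain ⟨e1, e2, e3, e4⟩ := second_lHalf (s := s) (kp := kp) (km := km) (-1)
  obtain ⟨f1, f2, f3, f4⟩ := second_lHalf (s := s) (kp := kp) (km := km) 1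
  rw [e4, e2, f1, f4]
  refine (sandwich_expand₁ (R := HahnSeries ℤ (CoactTarget s kp km)) ..).trans ?_
  simp only [single_first_single, wMono_mul, smul_mul_assoc, mul_smul_comm, smul_smul, wMono_smul,
    Uq.Kh_mul_E, Uq.Kih_mul_E hs, Uq.Kh_mul_Kih, Uq.Kih_mul_Kh, tensorR_smul_left,
    Int.reduceNeg, Int.reduceAdd]
  match_scalars <;> field_simp

theorem sandwich_11 : sandwich s kp km K 1 1 =
    (s ^ 2 - (s ^ 2)⁻¹) ^ 2 • tensorR kp km (wMono 0 (Uq.gen s .E * Uq.gen s .F)) (HahnSeries.single 0 1 * K 0 0)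
      + (s ^ 3 * (s ^ 2 - (s ^ 2)⁻¹)) • tensorR kp km (wMono (-1) (Uq.gen s .F * Uq.gen s .Kih)) (HahnSeries.single (-1) 1 * K 1 0)
      - (s⁻¹ ^ 3 * (s ^ 2 - (s ^ 2)⁻¹)) • tensorR kp km (wMono 1 (Uq.gen s .F * Uq.gen s .Kh)) (HahnSeries.single 1 1 * K 1 0)
      + (s * (s ^ 2 - (s ^ 2)⁻¹)) • tensorR kp km (wMono 1 (Uq.gen s .E * Uq.gen s .Kih)) (HahnSeries.single (-1) 1 * K 0 1)
      - (s⁻¹ * (s ^ 2 - (s ^ 2)⁻¹)) • tensorR kp km (wMono (-1) (Uq.gen s .E * Uq.gen s .Kh)) (HahnSeries.single 1 1 * K 0 1)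
      + s ^ 2 • tensorR kp km (wMono 0 (Uq.gen s .Kih * Uq.gen s .Kih)) (HahnSeries.single (-2) 1 * K 1 1)
      - tensorR kp km (wMono (-2) 1) (HahnSeries.single 0 1 * K 1 1)
      - tensorR kp km (wMono 2 1) (HahnSeries.single 0 1 * K 1 1)
      + (s ^ 2)⁻¹ • tensorR kp km (wMono 0 (Uq.gen s .Kh * Uq.gen s .Kh)) (HahnSeries.single 2 1 * K 1 1) := by
  rw [sandwich_sum]
  obtain ⟨e1, e2, e3, e4⟩ := second_lHalf (s := s) (kp := kp) (km := km) (-1)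
  obtain ⟨f1, f2, f3, f4⟩ := second_lHalf (s := s) (kp := kp) (km := km) 1
  rw [e4, e2, f3, f2]
  refine (sandwich_expand₁' (R := HahnSeries ℤ (CoactTarget s kp km)) ..).trans ?_
  simp only [single_first_single, wMono_mul, smul_mul_assoc, mul_smul_comm, smul_smul, wMono_smul,
    Uq.Kh_mul_F, Uq.Kih_mul_F hs, Uq.Kh_mul_Kih, Uq.Kih_mul_Kh, tensorR_smul_left,
    Int.reduceNeg, Int.reduceAdd]
  match_scalars <;> field_simp

end Values

/-! ### Order and leading terms of the dressed operator; existence of δ. -/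

section Coefficients

variable {s kp km : ℂ}

theorem prefactor_one (s : ℂ) : prefactor s 1 = (s ^ 2 + (s ^ 2)⁻¹)⁻¹ • (uCap s)⁻¹ := by
  rw [prefactor, Finset.Icc_self, Finset.prod_singleton]
  norm_num [shift_one]

theorem dressK_apply (K : Matrix (Fin 2) (Fin 2) (HahnSeries ℤ (Aq s kp km))) (i j : Fin 2) :
    dressK s kp km K i j =
      (s ^ 2 + (s ^ 2)⁻¹)⁻¹ • (scal (CoactTarget s kp km) (uCap s)⁻¹ * sandwich s kp km K i j) := by
  change scal _ (prefactor s 1) * sandwich s kp km K i j = _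
  rw [prefactor_one, scal_smul, smul_mul_hahn]

variable (hs : s ≠ 0) (hq : s ^ 2 - (s ^ 2)⁻¹ ≠ 0) (hq' : s ^ 2 + (s ^ 2)⁻¹ ≠ 0)

theorem tensorR_graded {d e f : ℤ} {x : HahnSeries ℤ (Aq s kp km)} (hx : Graded d x)
    (c : (Uq s)[T;T⁻¹]) (k : ℕ) (h : e + d = f + 2 * k) :
    Graded f (tensorR kp km c (HahnSeries.single e 1 * x)) :=
  Graded.coeffMap (((Graded.single e 1).mul hx).mono k h) _

/-- The fundamental K-operator of `𝒜_q`. -/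
abbrev aqKHalf (s kp km : ℂ) : Matrix (Fin 2) (Fin 2) (HahnSeries ℤ (Aq s kp km)) :=
  kHalf s kp km (Aq.gen s kp km)

include hs hq'

/-- Dressing raises the order of each entry by u²; this is exactly undone by U⁻¹ ∈ u⁻²ℂ[[u⁻²]], so
the dressed matrix has the order and parity of 𝒦. -/
theorem sandwich_graded :
    Graded (-1) (sandwich s kp km (aqKHalf s kp km) 0 0) ∧
    Graded (-2) (sandwich s kp km (aqKHalf s kp km) 0 1) ∧
    Graded (-2) (sandwich s kp km (aqKHalf s kp km) 1 0) ∧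
    Graded (-1) (sandwich s kp km (aqKHalf s kp km) 1 1) := by
  obtain ⟨g00, g01, g10, g11⟩ := kHalf_graded (kp := kp) (km := km) hs hq' (Aq.gen s kp km)
  rw [sandwich_00 _ hs, sandwich_01 _ hs, sandwich_10 _ hs, sandwich_11 _ hs]
  refine ⟨?_, ?_, ?_, ?_⟩
  · exact ((((((((((tensorR_graded g00 _ 0 (by norm_num)).smul _).sub
      (tensorR_graded g00 _ 1 (by norm_num))).sub
      (tensorR_graded g00 _ 1 (by norm_num))).add
      ((tensorR_graded g00 _ 2 (by norm_num)).smul _)).add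
      ((tensorR_graded g10 _ 0 (by norm_num)).smul _)).sub
      ((tensorR_graded g10 _ 1 (by norm_num)).smul _)).add
      ((tensorR_graded g01 _ 0 (by norm_num)).smul _)).sub
      ((tensorR_graded g01 _ 1 (by norm_num)).smul _)).add
      ((tensorR_graded g11 _ 1 (by norm_num)).smul _))
  · exact ((((((((((tensorR_graded g00 _ 1 (by norm_num)).smul _).sub
      ((tensorR_graded g00 _ 2 (by norm_num)).smul _)).add
      ((tensorR_graded g10 _ 1 (by norm_num)).smul _)).add
      ((tensorR_graded g01 _ 0 (by norm_num)).smul _)).sub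
      (tensorR_graded g01 _ 1 (by norm_num))).sub
      (tensorR_graded g01 _ 1 (by norm_num))).add
      ((tensorR_graded g01 _ 2 (by norm_num)).smul _)).add
      ((tensorR_graded g11 _ 1 (by norm_num)).smul _)).sub
      ((tensorR_graded g11 _ 2 (by norm_num)).smul _))
  · exact ((((((((((tensorR_graded g00 _ 1 (by norm_num)).smul _).sub
      ((tensorR_graded g00 _ 2 (by norm_num)).smul _)).add
      ((tensorR_graded g10 _ 0 (by norm_num)).smul _)).sub
      (tensorR_graded g10 _ 1 (by norm_num))).sub
      (tensorR_graded g10 _ 1 (by norm_num))).add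
      ((tensorR_graded g10 _ 2 (by norm_num)).smul _)).add
      ((tensorR_graded g01 _ 1 (by norm_num)).smul _)).add
      ((tensorR_graded g11 _ 1 (by norm_num)).smul _)).sub
      ((tensorR_graded g11 _ 2 (by norm_num)).smul _))
  · exact ((((((((((tensorR_graded g00 _ 1 (by norm_num)).smul _).add
      ((tensorR_graded g10 _ 0 (by norm_num)).smul _)).sub
      ((tensorR_graded g10 _ 1 (by norm_num)).smul _)).add
      ((tensorR_graded g01 _ 0 (by norm_num)).smul _)).sub
      ((tensorR_graded g01 _ 1 (by norm_num)).smul _)).add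
      ((tensorR_graded g11 _ 0 (by norm_num)).smul _)).sub
      (tensorR_graded g11 _ 1 (by norm_num))).sub
      (tensorR_graded g11 _ 1 (by norm_num))).add
      ((tensorR_graded g11 _ 2 (by norm_num)).smul _))

include hq

/-- The diagonal terms yield δ_w(W₀) and δ_w(W₁); the off-diagonal ones are the scalars required by
`exists_kHalf`. -/
theorem sandwich_coeff :
    (sandwich s kp km (aqKHalf s kp km) 0 0).coeff (-1) =
      (s ^ 2 * (s ^ 2 + (s ^ 2)⁻¹)) • (
        1 ⊗ₜ (wMono (-1) ((kp * s) • (Uq.gen s UqGen.E * Uq.gen s UqGen.Kh))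
        + wMono 1 ((km * s⁻¹) • (Uq.gen s UqGen.F * Uq.gen s UqGen.Kh)))
      + Aq.gen s kp km (AqGen.Wm 0) ⊗ₜ wMono 0 (Uq.gen s UqGen.Kh ^ 2)) ∧
    (sandwich s kp km (aqKHalf s kp km) 1 1).coeff (-1) =
      (s ^ 2 * (s ^ 2 + (s ^ 2)⁻¹)) • (
      1 ⊗ₜ (wMono 1 ((kp * s⁻¹) • (Uq.gen s UqGen.E * Uq.gen s UqGen.Kih))
        + wMono (-1) ((km * s) • (Uq.gen s UqGen.F * Uq.gen s UqGen.Kih)))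
      + Aq.gen s kp km (AqGen.Wp 0) ⊗ₜ wMono 0 (Uq.gen s UqGen.Kih ^ 2)) ∧
    (sandwich s kp km (aqKHalf s kp km) 0 1).coeff (-2) = s ^ 2 •
      algebraMap ℂ _ (kp * (s ^ 2 + (s ^ 2)⁻¹) / (s ^ 2 - (s ^ 2)⁻¹)) ∧
    (sandwich s kp km (aqKHalf s kp km) 1 0).coeff (-2) = s ^ 2 •
      algebraMap ℂ _ (km * (s ^ 2 + (s ^ 2)⁻¹) / (s ^ 2 - (s ^ 2)⁻¹)) := by
  obtain ⟨g00, g01, g10, g11⟩ := kHalf_graded (kp := kp) (km := km) hs hq' (Aq.gen s kp km)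
  have c00 := kHalf_coeff_00 (kp := kp) (km := km) hs hq' (Aq.gen s kp km)
  have c11 := kHalf_coeff_11 (kp := kp) (km := km) hs hq' (Aq.gen s kp km)
  have c01 := kHalf_coeff_01 (kp := kp) (km := km) hs hq' (Aq.gen s kp km)
  have c10 := kHalf_coeff_10 (kp := kp) (km := km) hs hq' (Aq.gen s kp km)
  have z00 : ∀ n : ℤ, n < 1 → _ := fun n => g00.coeff_eq_zero_of_lt
  have z11 : ∀ n : ℤ, n < 1 → _ := fun n => g11.coeff_eq_zero_of_lt
  have z01 : ∀ n : ℤ, n < 0 → _ := fun n => g01.coeff_eq_zero_of_lt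
  have z10 : ∀ n : ℤ, n < 0 → _ := fun n => g10.coeff_eq_zero_of_lt
  rw [sandwich_00 _ hs, sandwich_01 _ hs, sandwich_10 _ hs, sandwich_11 _ hs]
  have w1 : (wMono 0 1 : (Uq s)[T;T⁻¹]) = 1 := by
    rw [wMono, LaurentPolynomial.T_zero, map_one, one_mul]
  have h1 := quartic_sub_ne hs hq
  have h2 : s ^ 4 - 1 ≠ 0 := by rwa [← neg_ne_zero, neg_sub]
  refine ⟨?_, ?_, ?_, ?_⟩
  all_goals
    simp only [HahnSeries.coeff_add, HahnSeries.coeff_sub, HahnSeries.coeff_smul, tensorR_coeff,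
      HahnSeries.coeff_single_mul, one_mul]
    norm_num [z00, z11, z01, z10, c00, c11, c01, c10, -map_mul, -map_div₀]
  · simp only [Algebra.algebraMap_eq_smul_one, ← TensorProduct.smul_tmul', TensorProduct.tmul_add,
      wMono_smul, TensorProduct.tmul_smul, sq (Uq.gen s UqGen.Kh)]
    match_scalars <;> field_simp
  · simp only [Algebra.algebraMap_eq_smul_one, ← TensorProduct.smul_tmul', TensorProduct.tmul_add,
      wMono_smul, TensorProduct.tmul_smul, sq (Uq.gen s UqGen.Kih)]
    match_scalars <;> field_simp
  · rw [w1]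
  · rw [w1]

/-- The dressed K-operator is again the K-operator of a family of elements. -/
theorem exists_kHalf_eq_dressK (hkp : kp ≠ 0) (hkm : km ≠ 0) :
    ∃ g : AqGen → CoactTarget s kp km, kHalf s kp km g = dressK s kp km (aqKHalf s kp km) := by
  obtain ⟨n00, n01, n10, n11⟩ := sandwich_graded (kp := kp) (km := km) hs hq'
  obtain ⟨-, -, c01, c10⟩ := sandwich_coeff (kp := kp) (km := km) hs hq hq'
  have hU : Graded 2 (scal (CoactTarget s kp km) (uCap s)⁻¹) :=
    (uCap_inv_graded hs hq').coeffMap _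
  have hU2 : (scal (CoactTarget s kp km) (uCap s)⁻¹).coeff 2 =
      algebraMap ℂ _ ((s ^ 2 + (s ^ 2)⁻¹) * (s ^ 2)⁻¹) :=
    (show _ = algebraMap ℂ (CoactTarget s kp km) ((uCap s)⁻¹.coeff 2) from rfl).trans
      (congrArg _ (uCap_inv_coeff_two hs hq'))
  have hc : ∀ x : HahnSeries ℤ (CoactTarget s kp km), ∀ c : ℂ, Graded (-2) x →
      x.coeff (-2) = s ^ 2 • algebraMap ℂ _ c →
      ((s ^ 2 + (s ^ 2)⁻¹)⁻¹ • (scal (CoactTarget s kp km) (uCap s)⁻¹ * x)).coeff 0 =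
        algebraMap ℂ _ c := by
    intro x c hx hxc
    rw [HahnSeries.coeff_smul, show (0 : ℤ) = 2 + -2 by norm_num, hU.coeff_mul hx, hU2, hxc,
      ← Algebra.smul_def, smul_smul, smul_smul]
    rw [show (s ^ 2 + (s ^ 2)⁻¹)⁻¹ * ((s ^ 2 + (s ^ 2)⁻¹) * (s ^ 2)⁻¹) * s ^ 2 = 1 by
      rw [inv_mul_cancel_left₀ hq', inv_mul_cancel₀ (pow_ne_zero _ hs)], one_smul]
  refine exists_kHalf hs hq' hkp hkm _ ?_ ?_ ?_ ?_ ?_ ?_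
  · rw [dressK_apply]; exact (hU.mul n00).smul _
  · rw [dressK_apply]; exact (hU.mul n01).smul _
  · rw [dressK_apply]; exact (hU.mul n10).smul _
  · rw [dressK_apply]; exact (hU.mul n11).smul _
  · rw [dressK_apply]; exact hc _ _ n01 c01
  · rw [dressK_apply]; exact hc _ _ n10 c10

/-- There is an algebra map whose action on `𝒦^{(1/2)}` is dressing by L-operators. -/
theorem exists_coaction (hkp : kp ≠ 0) (hkm : km ≠ 0) :
    ∃ δ : Aq s kp km →ₐ[ℂ] CoactTarget s kp km,
      kHalf s kp km (fun x => δ (Aq.gen s kp km x)) = dressK s kp km (aqKHalf s kp km) := by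
  obtain ⟨g, hg⟩ := exists_kHalf_eq_dressK (kp := kp) (km := km) hs hq hq' hkp hkm
  obtain ⟨δ, hδ⟩ := exists_aqLift g (by rw [hg]; exact dressK_reflection hq hs aq_reflection)
  refine ⟨δ, ?_⟩
  rw [← hg]
  congr 1
  exact funext hδ

end Coefficients

/-! ### Entries of 𝒦 expressed through W₀, W₁ and the G_k. -/

section Currents

/-- The family `G_k` extended by the constant `G_0`. -/
def gExt {A : Type*} [Ring A] [Algebra ℂ A] (s kp km : ℂ) (g : AqGen → A) : ℕ → A
  | 0 => algebraMap ℂ _ (kp * km * (s ^ 2 + (s ^ 2)⁻¹) ^ 2 / (s ^ 2 - (s ^ 2)⁻¹))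
  | k + 1 => g (AqGen.G k)

theorem gElt_eq (s kp km : ℂ) : gElt s kp km = gExt s kp km (Aq.gen s kp km) := by
  funext k
  cases k <;> rfl

variable {A : Type*} [Ring A] [Algebra ℂ A] {s kp km : ℂ}
  (hs : s ≠ 0) (hq : s ^ 2 - (s ^ 2)⁻¹ ≠ 0) (hq' : s ^ 2 + (s ^ 2)⁻¹ ≠ 0)
  (hkp : kp ≠ 0) (hkm : km ≠ 0) (g : AqGen → A)

theorem genFun_qComm (q : ℂ) (x : A) (a : ℕ → A) : genFun s (fun k => qComm q x (a k)) =
    q • (HahnSeries.single 0 x * genFun s a) - q⁻¹ • (genFun s a * HahnSeries.single 0 x) := by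
  simp only [qComm]
  rw [genFun_sub, genFun_smul, genFun_smul, single_mul_genFun, genFun_mul_single]

theorem genFun_qComm' (q : ℂ) (x : A) (a : ℕ → A) : genFun s (fun k => qComm q (a k) x) =
    q • (genFun s a * HahnSeries.single 0 x) - q⁻¹ • (HahnSeries.single 0 x * genFun s a) := by
  simp only [qComm]
  rw [genFun_sub, genFun_smul, genFun_smul, single_mul_genFun, genFun_mul_single]

theorem genFun_lie (x : A) (a : ℕ → A) : genFun s (fun k => ⁅x, a k⁆) =
    HahnSeries.single 0 x * genFun s a - genFun s a * HahnSeries.single 0 x := by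
  simp only [Ring.lie_def]
  rw [genFun_sub, single_mul_genFun, genFun_mul_single]

include hs hq hq' hkm in
-- The scalar term of 𝒦₁₂ is absorbed by starting the family at G_0, at the price of one factor U.
-- That factor later cancels the prefactor U⁻¹ of the dressing.
theorem kHalf_01_eq : kHalf s kp km g 0 1 = (km * (s ^ 2 + (s ^ 2)⁻¹))⁻¹ •
    (scal A (uCap s) * genFun s (gExt s kp km g)) := by
  rw [scal_uCap_mul_genFun hs hq']
  change (km * (s ^ 2 + (s ^ 2)⁻¹))⁻¹ • genFun s (fun k => g (AqGen.G k)) +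
    (kp * (s ^ 2 + (s ^ 2)⁻¹) / (s ^ 2 - (s ^ 2)⁻¹)) • (1 : HahnSeries ℤ A) = _
  rw [gExt, ← algebraMap_eq_single, Algebra.algebraMap_eq_smul_one]
  have h1 := quartic_add_ne hs hq'
  have h2 : s ^ 4 + 1 ≠ 0 := by rwa [add_comm]
  have h3 := quartic_sub_ne hs hq
  have h4 : s ^ 4 - 1 ≠ 0 := by rwa [← neg_ne_zero, neg_sub]
  change _ = _ • (_ + genFun s (fun k => g (AqGen.G k)))
  match_scalars <;> field_simp

include hs hq' in
-- These two combinations accompany FK^{1/2} and FK^{-1/2} in the upper right entry of the dressed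
-- operator.
theorem kHalf_diag_eq :
    uVar A * kHalf s kp km g 0 0 - uInv A * kHalf s kp km g 1 1 = (s ^ 2 + (s ^ 2)⁻¹) •
      (scal A (uCap s) * genFun s (fun k => g (AqGen.Wm k)) - genFun s fun k => g (AqGen.Wp k)) ∧
    uVar A * kHalf s kp km g 1 1 - uInv A * kHalf s kp km g 0 0 = (s ^ 2 + (s ^ 2)⁻¹) •
      (scal A (uCap s) * genFun s (fun k => g (AqGen.Wp k)) - genFun s fun k => g (AqGen.Wm k)) := by
  have k00 : kHalf s kp km g 0 0 = s ^ 2 • (uVar A * genFun s (fun k => g (AqGen.Wm k))) -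
      (s ^ 2)⁻¹ • (uInv A * genFun s (fun k => g (AqGen.Wp k))) := rfl
  have k11 : kHalf s kp km g 1 1 = s ^ 2 • (uVar A * genFun s (fun k => g (AqGen.Wp k))) -
      (s ^ 2)⁻¹ • (uInv A * genFun s (fun k => g (AqGen.Wm k))) := rfl
  have h1 := quartic_add_ne hs hq'
  have h2 : s ^ 4 + 1 ≠ 0 := by rwa [add_comm]
  simp only [k00, k11, mul_sub, mul_smul_hahn, uVar_mul_uInv_mul, uInv_mul_uVar_mul,
    scal_uCap_eq hs hq']
  constructor <;> match_scalars <;> field_simp <;> ring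

variable {g} (hg : reLHS s (kHalf s kp km g) = reRHS s (kHalf s kp km g))
include hs hq hq' hkp hkm hg

/-- The first two formulas are the q-commutators of W₀ and W₁ with 𝒦₁₂, the latter written through
the G_k. For the third, [W₀, 𝒲₋] is a combination of 𝒦₁₂ and 𝒦₂₁, while the commutator of W₀ with
the first formula computes −[W₀, 𝒲₋], because [W₀, 𝒲₊] = 0; solving for 𝒦₂₁ produces the double
commutator. -/
theorem current_relations :
    scal A (uCap s) * genFun s (fun k => g (AqGen.Wm k)) - genFun s (fun k => g (AqGen.Wp k)) =
      (kp * km * (s ^ 2 + (s ^ 2)⁻¹) ^ 2)⁻¹ • (scal A (uCap s) *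
        genFun s (fun k => qComm (s ^ 2) (g (AqGen.Wm 0)) (gExt s kp km g k))) ∧
    scal A (uCap s) * genFun s (fun k => g (AqGen.Wp k)) - genFun s (fun k => g (AqGen.Wm k)) =
      (kp * km * (s ^ 2 + (s ^ 2)⁻¹) ^ 2)⁻¹ • (scal A (uCap s) *
        genFun s (fun k => qComm (s ^ 2) (gExt s kp km g k) (g (AqGen.Wp 0)))) ∧
    kHalf s kp km g 1 0 = (kp * (s ^ 2 + (s ^ 2)⁻¹))⁻¹ • (scal A (uCap s) * genFun s (fun k =>
      gExt s kp km g k - ((s ^ 2 + (s ^ 2)⁻¹) / (kp * km * (s ^ 2 + (s ^ 2)⁻¹) ^ 2)) •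
        ⁅g (AqGen.Wm 0), qComm (s ^ 2) (g (AqGen.Wm 0)) (gExt s kp km g k)⁆)) := by
  obtain ⟨r1, r2, r3, r4⟩ := genFun_relations hs hq hq' hg rfl rfl rfl rfl rfl rfl
  have hU : ∀ x y : HahnSeries ℤ A, x * (scal A (uCap s) * y) = scal A (uCap s) * (x * y) := by
    intro x y
    rw [← mul_assoc, Subring.mem_center_iff.1 (scal_mem_center _), mul_assoc]
  have h1 := quartic_add_ne hs hq'
  have h2 : s ^ 4 + 1 ≠ 0 := by rwa [add_comm]
  have p1 : scal A (uCap s) * genFun s (fun k => g (AqGen.Wm k)) - genFun s (fun k => g (AqGen.Wp k)) =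
      (kp * km * (s ^ 2 + (s ^ 2)⁻¹) ^ 2)⁻¹ • (scal A (uCap s) *
        genFun s (fun k => qComm (s ^ 2) (g (AqGen.Wm 0)) (gExt s kp km g k))) := by
    rw [kHalf_01_eq hs hq hq' hkm g, mul_smul_hahn, smul_mul_hahn, hU, mul_assoc] at r3
    rw [genFun_qComm, mul_sub, mul_smul_hahn, mul_smul_hahn]
    linear_combination (norm := skip) -(kp * (s ^ 2 + (s ^ 2)⁻¹))⁻¹ • r3
    match_scalars <;> field_simp <;> ring
  refine ⟨p1, ?_, ?_⟩
  · rw [kHalf_01_eq hs hq hq' hkm g, mul_smul_hahn, smul_mul_hahn, hU, mul_assoc] at r4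
    rw [genFun_qComm', mul_sub, mul_smul_hahn, mul_smul_hahn]
    linear_combination (norm := skip) -(kp * (s ^ 2 + (s ^ 2)⁻¹))⁻¹ • r4
    match_scalars <;> field_simp <;> ring
  · have p2 := congrArg (fun x => HahnSeries.single 0 (g (AqGen.Wm 0)) * x -
      x * HahnSeries.single 0 (g (AqGen.Wm 0))) p1
    have r1' := congrArg (fun x => scal A (uCap s) * x) r1
    rw [kHalf_01_eq hs hq hq' hkm g] at r2
    rw [genFun_sub, genFun_smul, genFun_lie]
    simp only [mul_sub, sub_mul, mul_smul_hahn, smul_mul_hahn, hU, mul_assoc, mul_zero] at p2 r1' ⊢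
    linear_combination (norm := skip) -kp⁻¹ • r2 - kp⁻¹ • p2 + kp⁻¹ • r1'
    match_scalars <;> field_simp <;> ring

end Currents

/-! ### Values of the dressing map on W₀, W₁ and G_{k+1}. -/

section Coaction

variable {s kp km : ℂ} (hs : s ≠ 0) (hq : s ^ 2 - (s ^ 2)⁻¹ ≠ 0) (hq' : s ^ 2 + (s ^ 2)⁻¹ ≠ 0)
  (hkp : kp ≠ 0) (hkm : km ≠ 0)
include hs hq hq'

/-- Comparison of the coefficients of u⁻¹ in the diagonal entries, where 𝒦 has leading coefficients
(q+q⁻¹)W₀ and (q+q⁻¹)W₁. -/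
theorem coaction_W {g : AqGen → CoactTarget s kp km}
    (hg : kHalf s kp km g = dressK s kp km (aqKHalf s kp km)) :
    g (AqGen.Wm 0) =
      1 ⊗ₜ (wMono (-1) ((kp * s) • (Uq.gen s UqGen.E * Uq.gen s UqGen.Kh))
        + wMono 1 ((km * s⁻¹) • (Uq.gen s UqGen.F * Uq.gen s UqGen.Kh)))
      + Aq.gen s kp km (AqGen.Wm 0) ⊗ₜ wMono 0 (Uq.gen s UqGen.Kh ^ 2) ∧
    g (AqGen.Wp 0) =
      1 ⊗ₜ (wMono 1 ((kp * s⁻¹) • (Uq.gen s UqGen.E * Uq.gen s UqGen.Kih))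
        + wMono (-1) ((km * s) • (Uq.gen s UqGen.F * Uq.gen s UqGen.Kih)))
      + Aq.gen s kp km (AqGen.Wp 0) ⊗ₜ wMono 0 (Uq.gen s UqGen.Kih ^ 2) := by
  obtain ⟨n00, -, -, n11⟩ := sandwich_graded (kp := kp) (km := km) hs hq'
  obtain ⟨c00, c11, -, -⟩ := sandwich_coeff (kp := kp) (km := km) hs hq hq'
  have hU : Graded 2 (scal (CoactTarget s kp km) (uCap s)⁻¹) :=
    (uCap_inv_graded hs hq').coeffMap _
  have hU2 : (scal (CoactTarget s kp km) (uCap s)⁻¹).coeff 2 =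
      algebraMap ℂ _ ((s ^ 2 + (s ^ 2)⁻¹) * (s ^ 2)⁻¹) :=
    (show _ = algebraMap ℂ (CoactTarget s kp km) ((uCap s)⁻¹.coeff 2) from rfl).trans
      (congrArg _ (uCap_inv_coeff_two hs hq'))
  have hc : ∀ x : HahnSeries ℤ (CoactTarget s kp km), ∀ a b : CoactTarget s kp km, Graded (-1) x →
      x.coeff (-1) = (s ^ 2 * (s ^ 2 + (s ^ 2)⁻¹)) • b →
      (s ^ 2 + (s ^ 2)⁻¹) • a =
        ((s ^ 2 + (s ^ 2)⁻¹)⁻¹ • (scal (CoactTarget s kp km) (uCap s)⁻¹ * x)).coeff 1 → a = b := by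
    intro x a b hx hxc h
    rw [HahnSeries.coeff_smul, show (1 : ℤ) = 2 + -1 by norm_num, hU.coeff_mul hx, hU2, hxc,
      ← Algebra.smul_def, smul_smul, smul_smul] at h
    refine smul_right_injective _ hq' (h.trans ?_)
    congr 1
    have hq0 : s ^ 2 ≠ 0 := pow_ne_zero _ hs
    field_simp
  refine ⟨hc _ _ _ n00 c00 ?_, hc _ _ _ n11 c11 ?_⟩
  · rw [← kHalf_coeff_00 (kp := kp) (km := km) hs hq' g, hg, dressK_apply]
  · rw [← kHalf_coeff_11 (kp := kp) (km := km) hs hq' g, hg, dressK_apply]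

omit hq in
theorem sandwich_01_currents (K : Matrix (Fin 2) (Fin 2) (HahnSeries ℤ (Aq s kp km))) :
    sandwich s kp km K 0 1 =
      (s⁻¹ * (s ^ 2 - (s ^ 2)⁻¹)) • tensorR kp km (wMono (-1) (Uq.gen s .F * Uq.gen s .Kh))
        (uVar _ * K 0 0 - uInv _ * K 1 1) +
      (s * (s ^ 2 - (s ^ 2)⁻¹)) • tensorR kp km (wMono 1 (Uq.gen s .F * Uq.gen s .Kih))
        (uVar _ * K 1 1 - uInv _ * K 0 0) +
      (s ^ 2 - (s ^ 2)⁻¹) ^ 2 • tensorR kp km (wMono 0 (Uq.gen s .F * Uq.gen s .F)) (K 1 0) +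
      (s ^ 2 + (s ^ 2)⁻¹) • (scal _ (uCap s) * tensorR kp km (wMono 0 1) (K 0 1)) -
      tensorR kp km (wMono 2 (Uq.gen s .Kih * Uq.gen s .Kih)) (K 0 1) -
      tensorR kp km (wMono (-2) (Uq.gen s .Kh * Uq.gen s .Kh)) (K 0 1) := by
  rw [sandwich_01 _ hs, ← tensorR_uCap hs hq', scal_uCap_eq hs hq', tensorR_smul, map_add,
    tensorR_smul, tensorR_smul, map_sub, map_sub]
  have e0 : (HahnSeries.single 0 1 : HahnSeries ℤ (Aq s kp km)) = 1 := rfl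
  have e2 : (HahnSeries.single 2 1 : HahnSeries ℤ (Aq s kp km)) = uInv _ * uInv _ := by
    rw [uInv, HahnSeries.single_mul_single, mul_one]; rfl
  have e3 : (HahnSeries.single (-2) 1 : HahnSeries ℤ (Aq s kp km)) = uVar _ * uVar _ := by
    rw [uVar, HahnSeries.single_mul_single, mul_one]; rfl
  have e4 : (HahnSeries.single 1 1 : HahnSeries ℤ (Aq s kp km)) = uInv _ := rfl
  have e5 : (HahnSeries.single (-1) 1 : HahnSeries ℤ (Aq s kp km)) = uVar _ := rfl
  rw [e0, e2, e3, e4, e5, one_mul, one_mul, mul_assoc, mul_assoc]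
  have h1 := quartic_add_ne hs hq'
  have h2 : s ^ 4 + 1 ≠ 0 := by rwa [add_comm]
  match_scalars <;> field_simp

include hkp hkm in
-- After `current_relations` every term of the upper right entry of ℒ𝒦ℒ carries a factor U times a
-- generating function, so U⁻¹ cancels. The term with U² leaves one U on the G_k ⊗ 1; it shifts k to
-- k + 1. Injectivity of the generating function then gives the values.
theorem coaction_G {g : AqGen → CoactTarget s kp km}
    (hg : kHalf s kp km g = dressK s kp km (aqKHalf s kp km)) (k : ℕ) :
    g (AqGen.G k) =
    (km / kp * (s ^ 2 - (s ^ 2)⁻¹) ^ 2 / (s ^ 2 + (s ^ 2)⁻¹)) •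
      ((gElt s kp km k
          - ((s ^ 2 + (s ^ 2)⁻¹) / (kp * km * (s ^ 2 + (s ^ 2)⁻¹) ^ 2)) •
            ⁅Aq.gen s kp km (AqGen.Wm 0),
              qComm (s ^ 2) (Aq.gen s kp km (AqGen.Wm 0)) (gElt s kp km k)⁆)
        ⊗ₜ wMono 0 (Uq.gen s UqGen.F ^ 2))
    + ((s ^ 2 - (s ^ 2)⁻¹) / (kp * (s ^ 2 + (s ^ 2)⁻¹))) •
      (s⁻¹ • (qComm (s ^ 2) (Aq.gen s kp km (AqGen.Wm 0)) (gElt s kp km k)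
          ⊗ₜ wMono (-1) (Uq.gen s UqGen.F * Uq.gen s UqGen.Kh))
        + s • (qComm (s ^ 2) (gElt s kp km k) (Aq.gen s kp km (AqGen.Wp 0))
          ⊗ₜ wMono 1 (Uq.gen s UqGen.F * Uq.gen s UqGen.Kih)))
    + gElt s kp km (k + 1) ⊗ₜ 1
    - (s ^ 2 + (s ^ 2)⁻¹)⁻¹ •
      (gElt s kp km k ⊗ₜ
        (wMono 2 (Uq.gen s UqGen.Kih ^ 2) + wMono (-2) (Uq.gen s UqGen.Kh ^ 2))) := by
  obtain ⟨r1, r2, r3⟩ := current_relations hs hq hq' hkp hkm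
    (aq_reflection (s := s) (kp := kp) (km := km))
  obtain ⟨d1, d2⟩ := kHalf_diag_eq (kp := kp) (km := km) hs hq' (Aq.gen s kp km)
  have h01 := kHalf_01_eq (kp := kp) hs hq hq' hkm (Aq.gen s kp km)
  have e := (kHalf_01_eq (kp := kp) hs hq hq' hkm g).symm
  rw [hg, dressK_apply, sandwich_01_currents hs hq'] at e
  dsimp only [aqKHalf] at e
  rw [d1, d2, r1, r2, r3, h01, ← gElt_eq] at e
  simp only [tensorR_smul, tensorR_uCap hs hq', tensorR_genFun] at e
  have w1 : (wMono 0 1 : (Uq s)[T;T⁻¹]) = 1 := by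
    rw [wMono, LaurentPolynomial.T_zero, map_one, one_mul]
  have hUU : ∀ x, scal (CoactTarget s kp km) (uCap s)⁻¹ * (scal _ (uCap s) * x) = x := by
    intro x
    rw [← mul_assoc, ← scalHom_apply, ← scalHom_apply, ← map_mul, mul_comm (uCap s)⁻¹,
      uCap_mul_inv hs hq', map_one, one_mul]
  simp only [mul_add, mul_sub, mul_smul_hahn, hUU, w1] at e
  rw [scal_uCap_mul_genFun hs hq' (gExt s kp km g),
    scal_uCap_mul_genFun hs hq' (fun k => gElt s kp km k ⊗ₜ[ℂ] (1 : (Uq s)[T;T⁻¹]))] at e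
  -- G_0 is a scalar, so the constant terms split off on the two sides are the same and cancel.
  have e0 : gElt s kp km 0 ⊗ₜ[ℂ] (1 : (Uq s)[T;T⁻¹]) = gExt s kp km g 0 := rfl
  rw [e0] at e
  refine congrFun (genFun_injective hs hq' (a₁ := fun k => g (AqGen.G k)) (a₂ := fun k =>
    (km / kp * (s ^ 2 - (s ^ 2)⁻¹) ^ 2 / (s ^ 2 + (s ^ 2)⁻¹)) •
      ((gElt s kp km k
          - ((s ^ 2 + (s ^ 2)⁻¹) / (kp * km * (s ^ 2 + (s ^ 2)⁻¹) ^ 2)) •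
            ⁅Aq.gen s kp km (AqGen.Wm 0),
              qComm (s ^ 2) (Aq.gen s kp km (AqGen.Wm 0)) (gElt s kp km k)⁆)
        ⊗ₜ wMono 0 (Uq.gen s UqGen.F ^ 2))
    + ((s ^ 2 - (s ^ 2)⁻¹) / (kp * (s ^ 2 + (s ^ 2)⁻¹))) •
      (s⁻¹ • (qComm (s ^ 2) (Aq.gen s kp km (AqGen.Wm 0)) (gElt s kp km k)
          ⊗ₜ wMono (-1) (Uq.gen s UqGen.F * Uq.gen s UqGen.Kh))
        + s • (qComm (s ^ 2) (gElt s kp km k) (Aq.gen s kp km (AqGen.Wp 0))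
          ⊗ₜ wMono 1 (Uq.gen s UqGen.F * Uq.gen s UqGen.Kih)))
    + gElt s kp km (k + 1) ⊗ₜ 1
    - (s ^ 2 + (s ^ 2)⁻¹)⁻¹ •
      (gElt s kp km k ⊗ₜ
        (wMono 2 (Uq.gen s UqGen.Kih ^ 2) + wMono (-2) (Uq.gen s UqGen.Kh ^ 2)))) ?_) k
  simp only [TensorProduct.tmul_add, sq (Uq.gen s _)]
  rw [genFun_sub, genFun_add, genFun_add, genFun_smul, genFun_smul, genFun_smul, genFun_add,
    genFun_add, genFun_smul, genFun_smul]
  have eg : (fun k => gExt s kp km g (k + 1)) = fun k => g (AqGen.G k) := rfl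
  rw [eg, ← mul_add, ← mul_add] at e
  have h1 := quartic_add_ne hs hq'
  have h2 : s ^ 4 + 1 ≠ 0 := by rwa [add_comm]
  linear_combination (norm := skip) (km * (s ^ 2 + (s ^ 2)⁻¹)) • e
  match_scalars <;> field_simp <;> ring

end Coaction

/-! ### Generation of 𝒜_q by W₀, W₁, G_{k+1} and uniqueness of the coaction. -/

section Uniqueness

variable {s kp km : ℂ} (hs : s ≠ 0) (hq : s ^ 2 - (s ^ 2)⁻¹ ≠ 0) (hq' : s ^ 2 + (s ^ 2)⁻¹ ≠ 0)
  (hkp : kp ≠ 0) (hkm : km ≠ 0)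

theorem aq_algHom_ext {B : Type*} [Ring B] [Algebra ℂ B] {f f' : Aq s kp km →ₐ[ℂ] B}
    (h : ∀ x, f (Aq.gen s kp km x) = f' (Aq.gen s kp km x)) : f = f' :=
  RingQuot.ringQuot_ext' ℂ (s := AqRel s kp km) _ _ (FreeAlgebra.hom_ext (funext h))

include hs hq hq' hkp hkm

/-- `𝒜_q` is generated by `W_0`, `W_1` and the `G_{k+1}`. -/
theorem aq_algHom_ext_of_WG {B : Type*} [Ring B] [Algebra ℂ B] {f f' : Aq s kp km →ₐ[ℂ] B}
    (h0 : f (Aq.gen s kp km (AqGen.Wm 0)) = f' (Aq.gen s kp km (AqGen.Wm 0)))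
    (h1 : f (Aq.gen s kp km (AqGen.Wp 0)) = f' (Aq.gen s kp km (AqGen.Wp 0)))
    (hG : ∀ k, f (Aq.gen s kp km (AqGen.G k)) = f' (Aq.gen s kp km (AqGen.G k))) : f = f' := by
  have rel := alternating_relations hs hq hq' hkp hkm (aq_reflection (s := s) (kp := kp) (km := km))
  have hρ : kp * km * (s ^ 2 + (s ^ 2)⁻¹) ^ 2 ≠ 0 :=
    mul_ne_zero (mul_ne_zero hkp hkm) (pow_ne_zero _ hq')
  have hW : ∀ k, f (Aq.gen s kp km (AqGen.Wm k)) = f' (Aq.gen s kp km (AqGen.Wm k)) ∧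
      f (Aq.gen s kp km (AqGen.Wp k)) = f' (Aq.gen s kp km (AqGen.Wp k)) := by
    intro k
    induction k with
    | zero => exact ⟨h0, h1⟩
    | succ k ih =>
      -- [W₀, G_{k+1}]_q = ρ(W_{-k-1} − W_{k+1}) and [G_{k+1}, W₁]_q = ρ(W_{k+2} − W_{-k}) determine
      -- the next pair, as ρ ≠ 0.
      obtain ⟨-, -, r3, r4⟩ := rel k
      have e3 := congrArg f r3
      have e3' := congrArg f' r3
      have e4 := congrArg f r4
      have e4' := congrArg f' r4
      simp only [qComm, map_sub, map_smul, map_mul, h0, h1, hG, ih.1, ih.2] at e3 e3' e4 e4'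
      exact ⟨sub_left_injective (smul_right_injective _ hρ (e3.symm.trans e3')),
        sub_left_injective (smul_right_injective _ hρ (e4.symm.trans e4'))⟩
  refine aq_algHom_ext fun x => ?_
  rcases x with k | k | k | k
  · exact (hW k).1
  · exact (hW k).2
  · exact hG k
  · obtain ⟨-, r2, -, -⟩ := rel k
    have e := congrArg f r2
    have e' := congrArg f' r2
    simp only [map_sub, map_smul, map_mul, h0, (hW k).2, hG] at e e'
    exact sub_left_injective (e.symm.trans e')

theorem isEvaluatedCoaction_of_dressK {δ : Aq s kp km →ₐ[ℂ] CoactTarget s kp km}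
    (hδ : kHalf s kp km (fun x => δ (Aq.gen s kp km x)) = dressK s kp km (aqKHalf s kp km)) :
    IsEvaluatedCoaction s kp km δ where
  map_W0 := (coaction_W hs hq hq' hδ).1
  map_W1 := (coaction_W hs hq hq' hδ).2
  map_G := coaction_G hs hq hq' hkp hkm hδ

theorem existsUnique_isEvaluatedCoaction :
    ∃! δ : Aq s kp km →ₐ[ℂ] CoactTarget s kp km, IsEvaluatedCoaction s kp km δ := by
  obtain ⟨δ, hδ⟩ := exists_coaction (kp := kp) (km := km) hs hq hq' hkp hkm
  refine ⟨δ, isEvaluatedCoaction_of_dressK hs hq hq' hkp hkm hδ, fun δ' h' => ?_⟩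
  have h := isEvaluatedCoaction_of_dressK hs hq hq' hkp hkm hδ
  refine aq_algHom_ext_of_WG hs hq hq' hkp hkm ?_ ?_ fun k => ?_
  · rw [h.map_W0, h'.map_W0]
  · rw [h.map_W1, h'.map_W1]
  · rw [h.map_G, h'.map_G]

/-- The prescribed values mention only some generators; by uniqueness the map is the one built by
dressing, which controls all of 𝒦. -/
theorem IsEvaluatedCoaction.map_kHalf {δ : Aq s kp km →ₐ[ℂ] CoactTarget s kp km}
    (h : IsEvaluatedCoaction s kp km δ) :
    (aqKHalf s kp km).map (mapCoeff δ) = dressK s kp km (aqKHalf s kp km) := by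
  obtain ⟨δ', hδ'⟩ := exists_coaction (kp := kp) (km := km) hs hq hq' hkp hkm
  have e : δ = δ' := (existsUnique_isEvaluatedCoaction hs hq hq' hkp hkm).unique h
    (isEvaluatedCoaction_of_dressK hs hq hq' hkp hkm hδ')
  rw [kHalf_map, ← hδ', e]

end Uniqueness

/-! ### q-numbers and the entries of the intertwiner ℰ. -/

section QNumbers

variable {s : ℂ} (hs : s ≠ 0) (hq : ∀ n : ℕ, 0 < n → (s ^ 2) ^ n ≠ 1)

theorem qNum_zero (s : ℂ) : qNum s 0 = 0 := by simp [qNum]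

include hs hq

theorem qNum_ne_zero {n : ℕ} (hn : 0 < n) : qNum s n ≠ 0 := by
  refine div_ne_zero (fun h => ?_) (qSq_sub_ne hs hq)
  have h0 : (s ^ 2) ^ n ≠ 0 := pow_ne_zero _ (pow_ne_zero _ hs)
  refine hq (n + n) (by omega) ?_
  rw [pow_add]
  nth_rewrite 1 [sub_eq_zero.1 h]
  exact inv_mul_cancel₀ h0

theorem qNum_one : qNum s 1 = 1 := by
  rw [qNum, pow_one]
  exact div_self (qSq_sub_ne hs hq)

omit hs hq in
-- Apart from the value √1 = 1 for `bCoef s 1 0`, the square root is used only through this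
-- identity, so its branch is immaterial.
theorem bCoef_sq (s : ℂ) (N p : ℕ) : bCoef s N p ^ 2 = qNum s (N - p) * qNum s (p + 1) := by
  rw [bCoef, ← Complex.cpow_nat_mul]
  norm_num

theorem bCoef_ne_zero {N p : ℕ} (h : p < N) : bCoef s N p ≠ 0 := by
  intro h0
  have := bCoef_sq s N p
  rw [h0] at this
  exact mul_ne_zero (qNum_ne_zero hs hq (Nat.sub_pos_of_lt h)) (qNum_ne_zero hs hq p.succ_pos)
    (by rw [← this]; simp)

omit hs hq in
theorem bCoef_self (s : ℂ) (N : ℕ) : bCoef s N N = 0 := by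
  rw [← sq_eq_zero_iff, bCoef_sq, Nat.sub_self, qNum_zero, zero_mul]

theorem bCoef_one_zero : bCoef s 1 0 = 1 := by
  rw [bCoef]
  simp [qNum_one hs hq]

omit hs hq in
theorem eDiag_zero (s : ℂ) (N : ℕ) : eDiag s N 0 = 1 := by simp [eDiag]

omit hs hq in
theorem eDiag_succ (s : ℂ) (N n : ℕ) :
    eDiag s N (n + 1) = eDiag s N n * (bCoef s N n / bCoef s (N + 1) n) :=
  Finset.prod_range_succ _ _

theorem eDiag_ne_zero {N n : ℕ} (h : n ≤ N) : eDiag s N n ≠ 0 :=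
  Finset.prod_ne_zero_iff.2 fun p hp =>
    div_ne_zero (bCoef_ne_zero hs hq (by have := Finset.mem_range.1 hp; omega))
      (bCoef_ne_zero hs hq (by have := Finset.mem_range.1 hp; omega))

theorem eLow_ne_zero {N n : ℕ} (h : n ≤ N) : eLow s N n ≠ 0 :=
  div_ne_zero (mul_ne_zero (qNum_ne_zero hs hq (by omega)) (eDiag_ne_zero hs hq h))
    (bCoef_ne_zero hs hq (by omega))

/-- Compatibility of the intertwiners of two consecutive spins; it is what turns membership in the
image of ℰ into a symmetry of two legs. -/
theorem eDiag_mul_eLow {N n : ℕ} (h : n ≤ N) :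
    eDiag s (N + 1) (n + 1) * eLow s N n = eLow s (N + 1) n * eDiag s N n := by
  have h1 := bCoef_ne_zero hs hq (show n < N + 1 by omega)
  have h2 := bCoef_ne_zero hs hq (show n < N + 1 + 1 by omega)
  rw [eDiag_succ, eLow, eLow]
  field_simp

theorem bCoef_mul_eDiag {N n : ℕ} (h : n ≤ N) :
    bCoef s (N + 1) n * eDiag s N (n + 1) = bCoef s N n * eDiag s N n := by
  have h1 := bCoef_ne_zero hs hq (show n < N + 1 by omega)
  rw [eDiag_succ]
  field_simp

theorem bCoef_mul_eLow {N n : ℕ} (h : n ≤ N) :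
    bCoef s (N + 1) n * eLow s N n = qNum s (n + 1) * eDiag s N n := by
  have h1 := bCoef_ne_zero hs hq (show n < N + 1 by omega)
  rw [eLow]
  field_simp

theorem bCoef_mul_eDiag_self {N n : ℕ} (h : n ≤ N) :
    bCoef s (N + 1) n * eDiag s N n = qNum s (N + 1 - n) * eLow s N n := by
  have h1 := bCoef_ne_zero hs hq (show n < N + 1 by omega)
  have h2 := bCoef_sq s (N + 1) n
  rw [eLow]
  field_simp
  linear_combination eDiag s N n * h2

theorem bCoef_mul_eDiag_succ {N n : ℕ} (h : n ≤ N) :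
    bCoef s N n * eDiag s N (n + 1) = qNum s (N - n) * eLow s N n := by
  have h1 := bCoef_ne_zero hs hq (show n < N + 1 by omega)
  have h2 := bCoef_sq s N n
  rw [eLow, eDiag_succ]
  field_simp
  linear_combination eDiag s N n * h2

theorem bCoef_mul_eLow_self {N n : ℕ} (h : n < N) :
    bCoef s N n * eLow s N n = qNum s (n + 1) * eDiag s N (n + 1) := by
  have h1 := bCoef_ne_zero hs hq (show n < N + 1 by omega)
  rw [eLow, eDiag_succ]
  field_simp

theorem bCoef_mul_eLow_succ {N n : ℕ} (h : n < N) :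
    bCoef s (N + 1) (n + 1) * eLow s N n = bCoef s N n * eLow s N (n + 1) := by
  have h1 := bCoef_ne_zero hs hq (show n < N + 1 by omega)
  have h2 := bCoef_ne_zero hs hq (show n + 1 < N + 1 by omega)
  have h3 := bCoef_sq s N n
  have h4 := bCoef_sq s (N + 1) (n + 1)
  rw [Nat.add_sub_add_right] at h4
  rw [eLow, eLow, eDiag_succ]
  field_simp
  linear_combination eDiag s N n * qNum s (n + 1) * h4 - eDiag s N n * qNum s (n + 1 + 1) * h3

end QNumbers

/-! ### The identity ℱℰ = 1 and the image of ℰ. -/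

section Intertwiner

variable {s : ℂ} (hs : s ≠ 0) (hq : ∀ n : ℕ, 0 < n → (s ^ 2) ^ n ≠ 1)

theorem fin_sum_ite_eq {M : Type*} [AddCommMonoid M] {n k : ℕ} (f : Fin n → M) (hk : k < n) :
    (∑ i : Fin n, if k = (i : ℕ) then f i else 0) = f ⟨k, hk⟩ := by
  rw [Finset.sum_eq_single ⟨k, hk⟩]
  · simp
  · intro b _ hb
    rw [if_neg]
    rintro rfl
    exact hb rfl
  · simp

theorem fin_sum_ite_ne {M : Type*} [AddCommMonoid M] {n k : ℕ} (f : Fin n → M) (hk : n ≤ k) :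
    (∑ i : Fin n, if k = (i : ℕ) then f i else 0) = 0 :=
  Finset.sum_eq_zero fun i _ => if_neg (by omega)

include hs hq

/-- Only diagonal entries can be nonzero. In the middle range two terms contribute, and the upper
entry of ℱ is defined as what the lower one leaves over; hence the sum is 1 even where the sum of
squares in the denominator vanishes. -/
theorem fusF_mul_fusE (N : ℕ) : fusF s N * fusE s N = 1 := by
  ext b b'
  rw [Matrix.mul_apply, Fintype.sum_prod_type, Fin.sum_univ_two, Matrix.one_apply]
  obtain ⟨b', hb'⟩ := b'
  obtain ⟨b, hb⟩ := b
  simp only [fusF, fusE, if_true, one_ne_zero, if_false, mul_ite, mul_zero, Fin.mk.injEq]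
  have e1 : ∀ f : Fin (N + 1) → ℂ, (∑ x : Fin (N + 1), if b' = (x : ℕ) + 1 then f x else 0) =
      if h : 0 < b' then f ⟨b' - 1, by omega⟩ else 0 := by
    intro f
    split_ifs with h
    · rw [← fin_sum_ite_eq f]
      refine Finset.sum_congr rfl fun i _ => ?_
      congr 1
      simp only [eq_iff_iff]
      omega
    · exact Finset.sum_eq_zero fun i _ => if_neg (by omega)
  rw [e1]
  rcases Nat.lt_or_ge b' (N + 1) with h | h
  · rw [fin_sum_ite_eq _ h]
    rcases Nat.eq_zero_or_pos b' with h0 | h0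
    · subst h0
      rw [dif_neg (lt_irrefl 0), add_zero]
      split_ifs <;> simp_all [eDiag_zero]
    · rw [dif_pos h0]
      by_cases hbb : b = b'
      · subst hbb
        have hd := eDiag_ne_zero hs hq (show b ≤ N by omega)
        have h1 : b = b - 1 + 1 := by omega
        simp only [if_true, if_neg h0.ne', ← h1, if_neg (show ¬ b = N + 1 by omega)]
        rw [div_mul_cancel₀ _ hd]
        ring
      · have h1 : b' - 1 + 1 = b' := by omega
        simp [hbb, h1]
  · rw [fin_sum_ite_ne _ h, dif_pos (by omega), zero_add]
    have h2 : b' = N + 1 := by omega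
    subst h2
    by_cases hbb : b = N + 1
    · subst hbb
      simp [inv_mul_cancel₀ (eLow_ne_zero hs hq (le_refl N))]
    · simp [hbb]

variable {B : Type*} [Ring B] [Algebra ℂ B]

/-- The intertwiner as a matrix over a complex algebra. -/
def algE (B : Type*) [Ring B] [Algebra ℂ B] (s : ℂ) (N : ℕ) :
    Matrix (Fin 2 × Fin (N + 1)) (Fin (N + 2)) B := (fusE s N).map (algebraMap ℂ B)

/-- The pseudo-inverse of the intertwiner as a matrix over a complex algebra. -/
def algF (B : Type*) [Ring B] [Algebra ℂ B] (s : ℂ) (N : ℕ) :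
    Matrix (Fin (N + 2)) (Fin 2 × Fin (N + 1)) B := (fusF s N).map (algebraMap ℂ B)

theorem algF_mul_algE (N : ℕ) : algF B s N * algE B s N = 1 := by
  rw [algF, algE, ← Matrix.map_mul, fusF_mul_fusE hs hq]
  exact Matrix.map_one _ (map_zero _) (map_one _)

omit hs hq in
theorem algE_mul_apply_zero {m : Type*} (N : ℕ) (Y : Matrix (Fin (N + 2)) m B) (a : Fin (N + 1))
    (j : m) : (algE B s N * Y) (0, a) j = eDiag s N a • Y a.castSucc j := by
  rw [Matrix.mul_apply, Finset.sum_eq_single a.castSucc]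
  · simp [algE, fusE, Algebra.smul_def]
  · intro b _ hb
    have : ¬ (b : ℕ) = a := fun h => hb (Fin.ext h)
    simp [algE, fusE, this]
  · simp

omit hs hq in
theorem algE_mul_apply_one {m : Type*} (N : ℕ) (Y : Matrix (Fin (N + 2)) m B) (a : Fin (N + 1))
    (j : m) : (algE B s N * Y) (1, a) j = eLow s N a • Y a.succ j := by
  rw [Matrix.mul_apply, Finset.sum_eq_single a.succ]
  · simp [algE, fusE, Algebra.smul_def]
  · intro b _ hb
    have : ¬ (b : ℕ) = a + 1 := fun h => hb (Fin.ext h)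
    simp [algE, fusE, this]
  · simp

/-- The linear condition that cuts out the image of the intertwiner. -/
def InImage {m : Type*} (s : ℂ) (N : ℕ) (X : Matrix (Fin 2 × Fin (N + 1)) m B) : Prop :=
  ∀ (a : Fin N) (j : m),
    eDiag s N (a + 1) • X (1, a.castSucc) j = eLow s N a • X (0, a.succ) j

omit hs hq in
theorem inImage_algE_mul {m : Type*} (N : ℕ) (Y : Matrix (Fin (N + 2)) m B) :
    InImage s N (algE B s N * Y) := by
  intro a j
  rw [algE_mul_apply_zero, algE_mul_apply_one, smul_smul, smul_smul, mul_comm]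
  rfl

/-- ℰℱ acts as the identity on the image of ℰ by ℱℰ = 1. So one needs only a preimage of X. -/
theorem InImage.algE_algF_mul {m : Type*} {N : ℕ} {X : Matrix (Fin 2 × Fin (N + 1)) m B}
    (hX : InImage s N X) : algE B s N * (algF B s N * X) = X := by
  suffices h : ∃ Y : Matrix (Fin (N + 2)) m B, X = algE B s N * Y by
    obtain ⟨Y, rfl⟩ := h
    rw [← Matrix.mul_assoc (algF B s N), algF_mul_algE hs hq, Matrix.one_mul]
  -- The top row comes from |↑⟩ ⊗ |j,j⟩ and the remaining rows from the ↓ block divided by its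
  -- nonzero weights; the linear condition makes the ↑ block consistent.
  refine ⟨Matrix.of (Fin.cases (X (0, 0)) fun a j => (eLow s N a)⁻¹ • X (1, a) j), ?_⟩
  ext ⟨i, a⟩ j
  fin_cases i
  · change X (0, a) j = _
    refine Eq.trans ?_ (algE_mul_apply_zero N _ a j).symm
    refine Fin.cases ?_ (fun b => ?_) a
    · simp [eDiag_zero]
    · rw [← Fin.succ_castSucc]
      have e := hX b j
      simp only [Matrix.of_apply, Fin.cases_succ, Fin.val_succ, Fin.val_castSucc]
      rw [smul_smul, mul_comm, ← smul_smul, e, smul_smul,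
        inv_mul_cancel₀ (eLow_ne_zero hs hq (by omega)), one_smul]
  · change X (1, a) j = _
    refine Eq.trans ?_ (algE_mul_apply_one N _ a j).symm
    simp only [Matrix.of_apply, Fin.cases_succ]
    rw [smul_smul, mul_inv_cancel₀ (eLow_ne_zero hs hq (by omega)), one_smul]

end Intertwiner

/-! ### Operators and symmetry on ℂ² ⊗ (ℂ² ⊗ V). -/

section ThreeLegs

variable {X Y : Type*} [Ring X] [Ring Y] {V W Z m : Type*} [Fintype V] [Fintype W] [Fintype Z]
  [DecidableEq V] [DecidableEq W] [DecidableEq Z]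

/-- A matrix on `ℂ² ⊗ ℂ²` acting on the first two factors of `ℂ² ⊗ (ℂ² ⊗ V)`. -/
def abLeg (V : Type*) [DecidableEq V] (T : Matrix (Fin 2 × Fin 2) (Fin 2 × Fin 2) X) :
    Matrix (Fin 2 × (Fin 2 × V)) (Fin 2 × (Fin 2 × V)) X :=
  Matrix.of fun a b => if a.2.2 = b.2.2 then T (a.1, a.2.1) (b.1, b.2.1) else 0

/-- A matrix on `ℂ² ⊗ V` acting on the first and the third factor of `ℂ² ⊗ (ℂ² ⊗ V)`. -/
def acLeg (T : Matrix (Fin 2 × V) (Fin 2 × W) X) :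
    Matrix (Fin 2 × (Fin 2 × V)) (Fin 2 × (Fin 2 × W)) X :=
  Matrix.of fun a b => if a.2.1 = b.2.1 then T (a.1, a.2.2) (b.1, b.2.2) else 0

theorem abLeg_apply (T : Matrix (Fin 2 × Fin 2) (Fin 2 × Fin 2) X) (a b : Fin 2 × (Fin 2 × V)) :
    abLeg V T a b = if a.2.2 = b.2.2 then T (a.1, a.2.1) (b.1, b.2.1) else 0 := rfl

theorem acLeg_apply (T : Matrix (Fin 2 × V) (Fin 2 × W) X) (a : Fin 2 × (Fin 2 × V))
    (b : Fin 2 × (Fin 2 × W)) :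
    acLeg T a b = if a.2.1 = b.2.1 then T (a.1, a.2.2) (b.1, b.2.2) else 0 := rfl

theorem abLeg_mul (S T : Matrix (Fin 2 × Fin 2) (Fin 2 × Fin 2) X) :
    abLeg V (S * T) = abLeg V S * abLeg V T := by
  ext a b
  simp only [abLeg_apply, Matrix.mul_apply, Fintype.sum_prod_type, mul_ite, ite_mul, zero_mul,
    mul_zero, Finset.sum_ite_eq', Finset.mem_univ, if_true]
  split_ifs <;> simp_all

theorem acLeg_mul (S : Matrix (Fin 2 × V) (Fin 2 × W) X) (T : Matrix (Fin 2 × W) (Fin 2 × Z) X) :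
    acLeg (S * T) = acLeg S * acLeg T := by
  ext a b
  simp only [acLeg_apply, Matrix.mul_apply, Fintype.sum_prod_type, Fin.sum_univ_two, mul_ite,
    ite_mul, zero_mul, mul_zero]
  obtain ⟨a1, a2, a3⟩ := a
  obtain ⟨b1, b2, b3⟩ := b
  fin_cases a2 <;> fin_cases b2 <;> simp

theorem abLeg_aLeg (M : Matrix (Fin 2) (Fin 2) X) : abLeg V (aLeg (Fin 2) M) = aLeg (Fin 2 × V) M := by
  ext ⟨i, j, c⟩ ⟨i', j', c'⟩
  simp only [abLeg_apply, aLeg_apply, Prod.mk.injEq]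
  split_ifs <;> simp_all

theorem abLeg_vLeg (M : Matrix (Fin 2) (Fin 2) X) : abLeg V (vLeg M) = vLeg (aLeg V M) := by
  ext ⟨i, j, c⟩ ⟨i', j', c'⟩
  simp only [abLeg_apply, aLeg_apply, vLeg_apply]
  split_ifs <;> rfl

theorem acLeg_vLeg (M : Matrix V W X) : acLeg (vLeg M) = vLeg (vLeg M) := by
  ext ⟨i, j, c⟩ ⟨i', j', c'⟩
  simp only [acLeg_apply, vLeg_apply]
  split_ifs <;> rfl

theorem acLeg_aLeg (M : Matrix (Fin 2) (Fin 2) X) : acLeg (aLeg V M) = aLeg (Fin 2 × V) M := by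
  ext ⟨i, j, c⟩ ⟨i', j', c'⟩
  simp only [acLeg_apply, aLeg_apply, Prod.mk.injEq]
  split_ifs <;> simp_all

theorem abLeg_map (f : X →+* Y) (T : Matrix (Fin 2 × Fin 2) (Fin 2 × Fin 2) X) :
    (abLeg V T).map f = abLeg V (T.map f) := by
  ext a b
  simp only [Matrix.map_apply, abLeg_apply]
  split_ifs <;> simp

theorem acLeg_map (f : X →+* Y) (T : Matrix (Fin 2 × V) (Fin 2 × W) X) :
    (acLeg T).map f = acLeg (T.map f) := by
  ext a b
  simp only [Matrix.map_apply, acLeg_apply]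
  split_ifs <;> simp

theorem abLeg_comm {T : Matrix (Fin 2 × Fin 2) (Fin 2 × Fin 2) X} {N : Matrix V W X}
    (h : ∀ i j v w, T i j * N v w = N v w * T i j) :
    abLeg V T * vLeg (vLeg N) = vLeg (vLeg N) * abLeg W T := by
  ext ⟨i, j, c⟩ ⟨i', j', c'⟩
  simp only [Matrix.mul_apply, Fintype.sum_prod_type, abLeg_apply, vLeg_apply, mul_ite, ite_mul,
    zero_mul, mul_zero, Finset.sum_ite_eq, Finset.sum_ite_eq', Finset.mem_univ, if_true,
    Finset.sum_ite_irrel, Finset.sum_const_zero]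
  exact h _ _ _ _

theorem acLeg_comm {T : Matrix (Fin 2 × V) (Fin 2 × W) X} {M : Matrix (Fin 2) (Fin 2) X}
    (h : ∀ i j v w, T v w * M i j = M i j * T v w) :
    acLeg T * vLeg (aLeg W M) = vLeg (aLeg V M) * acLeg T := by
  ext ⟨i, j, c⟩ ⟨i', j', c'⟩
  simp only [Matrix.mul_apply, Fintype.sum_prod_type, acLeg_apply, vLeg_apply, aLeg_apply, mul_ite,
    ite_mul, zero_mul, mul_zero, Finset.sum_ite_eq, Finset.sum_ite_eq', Finset.mem_univ, if_true,
    Finset.sum_ite_irrel, Finset.sum_const_zero]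
  exact h _ _ _ _

/-- Exchange of the first two factors of `ℂ² ⊗ (ℂ² ⊗ V)`. -/
def swapRows (A : Matrix (Fin 2 × (Fin 2 × V)) m X) : Matrix (Fin 2 × (Fin 2 × V)) m X :=
  A.submatrix (fun a => (a.2.1, a.1, a.2.2)) id

theorem swapRows_apply (A : Matrix (Fin 2 × (Fin 2 × V)) m X) (i j : Fin 2) (c : V) (k : m) :
    swapRows A (i, j, c) k = A (j, i, c) k := rfl

theorem swapRows_aLeg_mul (M : Matrix (Fin 2) (Fin 2) X) (A : Matrix (Fin 2 × (Fin 2 × V)) m X) :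
    swapRows (aLeg (Fin 2 × V) M * A) = vLeg (aLeg V M) * swapRows A := by
  ext ⟨i, j, c⟩ k
  rw [swapRows_apply, Matrix.mul_apply, Matrix.mul_apply]
  simp only [Fintype.sum_prod_type, aLeg_apply, vLeg_apply, swapRows_apply, ite_mul, zero_mul,
    Prod.mk.injEq]
  rw [Finset.sum_comm]
  fin_cases i <;> simp

theorem swapRows_swapRows (A : Matrix (Fin 2 × (Fin 2 × V)) m X) : swapRows (swapRows A) = A := rfl

theorem swapRows_vLeg_aLeg_mul (M : Matrix (Fin 2) (Fin 2) X)
    (A : Matrix (Fin 2 × (Fin 2 × V)) m X) :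
    swapRows (vLeg (aLeg V M) * A) = aLeg (Fin 2 × V) M * swapRows A := by
  rw [← swapRows_swapRows (aLeg _ _ * _), swapRows_aLeg_mul, swapRows_swapRows]

theorem swapRows_vLeg_vLeg_mul (N : Matrix W V X) (A : Matrix (Fin 2 × (Fin 2 × V)) m X) :
    swapRows (vLeg (vLeg N) * A) = vLeg (vLeg N) * swapRows A := by
  ext ⟨i, j, c⟩ k
  rw [swapRows_apply, Matrix.mul_apply, Matrix.mul_apply]
  simp only [Fintype.sum_prod_type, vLeg_apply, swapRows_apply, ite_mul, zero_mul]
  rw [Finset.sum_comm]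
  fin_cases i <;> fin_cases j <;> simp

/-- The columns are symmetric in the first two factors. -/
def SwapInv (A : Matrix (Fin 2 × (Fin 2 × V)) m X) : Prop :=
  ∀ c k, A (0, 1, c) k = A (1, 0, c) k

theorem SwapInv.swapRows {A : Matrix (Fin 2 × (Fin 2 × V)) m X} (h : SwapInv A) : swapRows A = A := by
  ext ⟨i, j, c⟩ k
  rw [swapRows_apply]
  fin_cases i <;> fin_cases j
  · rfl
  · exact (h c k).symm
  · exact h c k
  · rfl

theorem swapInv_of_swapRows {A : Matrix (Fin 2 × (Fin 2 × V)) m X} (h : QOnsager.swapRows A = A) :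
    SwapInv A := by
  intro c k
  nth_rewrite 1 [← h]
  rfl

theorem SwapInv.vLeg_vLeg_mul {A : Matrix (Fin 2 × (Fin 2 × V)) m X} (h : SwapInv A)
    (N : Matrix W V X) : SwapInv (vLeg (vLeg N) * A) :=
  swapInv_of_swapRows (by rw [swapRows_vLeg_vLeg_mul, h.swapRows])

theorem SwapInv.mul_right {k : Type*} [Fintype k] [Fintype m] {A : Matrix (Fin 2 × (Fin 2 × V)) m X}
    (h : SwapInv A) (N : Matrix m k X) : SwapInv (A * N) := by
  intro c j
  simp only [Matrix.mul_apply, h c]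

/-- Operators preserving the symmetric tensors of the first two factors. -/
structure SymPres (T : Matrix (Fin 2 × (Fin 2 × V)) (Fin 2 × (Fin 2 × V)) X) : Prop where
  col_00 (c c' : V) : T (0, 1, c) (0, 0, c') = T (1, 0, c) (0, 0, c')
  col_11 (c c' : V) : T (0, 1, c) (1, 1, c') = T (1, 0, c) (1, 1, c')
  col_sym (c c' : V) : T (0, 1, c) (0, 1, c') + T (0, 1, c) (1, 0, c') =
    T (1, 0, c) (0, 1, c') + T (1, 0, c) (1, 0, c')

/-- For fixed third index a symmetric column is a combination of ↑↑, ↓↓ and ↑↓ + ↓↑, and the three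
conditions handle these in turn. The coefficients stay on the right, as they need not commute with
the entries of T. -/
theorem SymPres.mul {T : Matrix (Fin 2 × (Fin 2 × V)) (Fin 2 × (Fin 2 × V)) X} (h : SymPres T)
    {A : Matrix (Fin 2 × (Fin 2 × V)) m X} (hA : SwapInv A) : SwapInv (T * A) := by
  intro c k
  simp only [Matrix.mul_apply, Fintype.sum_prod_type, Fin.sum_univ_two, ← Finset.sum_add_distrib]
  refine Finset.sum_congr rfl fun c' _ => ?_
  rw [h.col_00, h.col_11, ← hA c' k]
  have e := congrArg (· * A (0, 1, c') k) (h.col_sym c c')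
  simp only [add_mul] at e
  linear_combination (norm := abel) e

theorem SymPres.map {T : Matrix (Fin 2 × (Fin 2 × V)) (Fin 2 × (Fin 2 × V)) X} (h : SymPres T)
    (f : X →+* Y) : SymPres (T.map f) where
  col_00 c c' := congrArg f (h.col_00 c c')
  col_11 c c' := congrArg f (h.col_11 c c')
  col_sym c c' := by
    have := congrArg f (h.col_sym c c')
    rw [map_add, map_add] at this
    exact this

theorem symPres_abLeg {T : Matrix (Fin 2 × Fin 2) (Fin 2 × Fin 2) X}
    (h0 : T (0, 1) (0, 0) = T (1, 0) (0, 0)) (h1 : T (0, 1) (1, 1) = T (1, 0) (1, 1))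
    (h2 : T (0, 1) (0, 1) + T (0, 1) (1, 0) = T (1, 0) (0, 1) + T (1, 0) (1, 0)) :
    SymPres (abLeg V T) where
  col_00 c c' := by simp only [abLeg_apply, h0]
  col_11 c c' := by simp only [abLeg_apply, h1]
  col_sym c c' := by
    simp only [abLeg_apply]
    split_ifs
    · exact h2
    · rfl

end ThreeLegs

/-! ### The image of ℰ as a symmetry condition. -/

section Image

variable {s : ℂ} (hs : s ≠ 0) (hq : ∀ n : ℕ, 0 < n → (s ^ 2) ^ n ≠ 1)
  {B : Type*} [Ring B] [Algebra ℂ B] {m : Type*}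
include hs hq

/-- After ℰ is applied in the second leg, the ↑↓ and ↓↑ components of A are eLow·A(↑, a+1) and
eDiag·A(↓, a) with the weights of level N. By `eDiag_mul_eLow` their equality is, up to a nonzero
factor, the condition cutting out the image at level N + 1. -/
theorem swapInv_vLeg_algE_iff (N : ℕ) (A : Matrix (Fin 2 × Fin (N + 2)) m B) :
    SwapInv (vLeg (algE B s N) * A) ↔ InImage s (N + 1) A := by
  have h : ∀ (i : Fin 2) (r : Fin 2 × Fin (N + 1)) k, (vLeg (algE B s N) * A) (i, r) k =
      (algE B s N * Matrix.of fun a k => A (i, a) k) r k := by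
    intro i r k
    simp only [Matrix.mul_apply, Fintype.sum_prod_type, vLeg_apply, ite_mul, zero_mul]
    fin_cases i <;> simp
  have key : ∀ (a : Fin (N + 1)) k,
      (vLeg (algE B s N) * A) (0, 1, a) k = (vLeg (algE B s N) * A) (1, 0, a) k ↔
      eDiag s (N + 1) (a + 1) • A (1, a.castSucc) k = eLow s (N + 1) a • A (0, a.succ) k := by
    intro a k
    rw [h, h]
    refine (Eq.congr (algE_mul_apply_one N _ a k) (algE_mul_apply_zero N _ a k)).trans ?_
    have e := eDiag_mul_eLow hs hq (show (a : ℕ) ≤ N by omega)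
    have n1 := eDiag_ne_zero hs hq (show (a : ℕ) ≤ N by omega)
    have n2 := eDiag_ne_zero hs hq (show (a : ℕ) + 1 ≤ N + 1 by omega)
    change eLow s N a • A (0, a.succ) k = eDiag s N a • A (1, a.castSucc) k ↔ _
    constructor
    · intro h
      refine smul_right_injective _ n1 ?_
      change eDiag s N a • _ = eDiag s N a • _
      rw [smul_comm, ← h, smul_smul, smul_smul, e, mul_comm]
    · intro h
      refine smul_right_injective _ n2 ?_
      change eDiag s (N + 1) (a + 1) • _ = eDiag s (N + 1) (a + 1) • _
      rw [smul_comm _ (eDiag s N a), h, smul_smul, smul_smul, e, mul_comm]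
  exact ⟨fun h a k => (key a k).1 (h a k), fun h a k => (key a k).2 (h a k)⟩

theorem swapInv_vLeg_algE_mul_algE (N : ℕ) :
    SwapInv (vLeg (algE B s N) * algE B s (N + 1)) := by
  rw [swapInv_vLeg_algE_iff hs hq]
  have := inImage_algE_mul (s := s) (N + 1) (1 : Matrix (Fin (N + 1 + 2)) (Fin (N + 1 + 2)) B)
  rwa [Matrix.mul_one] at this

theorem vLeg_algE_injective (N : ℕ) {A A' : Matrix (Fin 2 × Fin (N + 2)) m B}
    (h : vLeg (algE B s N) * A = vLeg (algE B s N) * A') : A = A' := by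
  have e := congrArg (vLeg (algF B s N) * ·) h
  simp only [← Matrix.mul_assoc, ← vLeg_mul, algF_mul_algE hs hq] at e
  have e1 : vLeg (1 : Matrix (Fin (N + 2)) (Fin (N + 2)) B) = 1 := Matrix.one_kronecker_one
  rwa [e1, Matrix.one_mul, Matrix.one_mul] at e

end Image

/-! ### Fusion of R-matrices in the second leg, and symmetric tensors. -/

section Fusion

variable {k : Type*} [Field k] [Algebra ℂ k] {s : ℂ}

/-- The entries of `R^{(1/2,j)}(t)` without the scalar factor. -/
def rEnt (s : ℂ) (N : ℕ) (t : k) (i : Fin 2) (c : ℕ) (m : Fin 2) (c' : ℕ) : k :=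
  if i = 0 then
    if m = 0 then (if c = c' then cFun (algebraMap ℂ k (s ^ (1 + (N : ℤ) - 2 * c)) * t) else 0)
    else (if c = c' + 1 then algebraMap ℂ k ((s ^ 2 - (s ^ 2)⁻¹) * bCoef s N c') else 0)
  else
    if m = 0 then (if c' = c + 1 then algebraMap ℂ k ((s ^ 2 - (s ^ 2)⁻¹) * bCoef s N c) else 0)
    else (if c = c' then cFun (algebraMap ℂ k (s ^ (1 - (N : ℤ) + 2 * c)) * t) else 0)

/-- `R^{(1/2,j)}(t)` without the scalar factor. -/
def rOp (s : ℂ) (N : ℕ) (t : k) : Matrix (Fin 2 × Fin (N + 1)) (Fin 2 × Fin (N + 1)) k :=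
  Matrix.of fun x y => rEnt s N t x.1 x.2 y.1 y.2

theorem rMat_eq (N : ℕ) (t : k) : rMat s N t =
    (∏ i ∈ Finset.range (N - 1), cFun (algebraMap ℂ k (s ^ ((N : ℤ) - 1 - 2 * i)) * t)) •
      rOp s N t := by
  rw [rMat]
  congr 1
  ext ⟨i, c⟩ ⟨m, c'⟩
  fin_cases i <;> fin_cases m <;> simp [rOp, rEnt, repE, repF, Fin.ext_iff (a := c)] <;>
    split_ifs <;> simp

theorem vLeg_algE_mul_rOp_apply (N : ℕ) (t : k) (i j : Fin 2) (c : Fin (N + 1)) (m : Fin 2)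
    (n : Fin (N + 2)) :
    (vLeg (algE k s N) * rOp s (N + 1) t) (i, j, c) (m, n) =
      if j = 0 then algebraMap ℂ k (eDiag s N c) * rEnt s (N + 1) t i c m n
      else algebraMap ℂ k (eLow s N c) * rEnt s (N + 1) t i (c + 1) m n := by
  have h : (vLeg (algE k s N) * rOp s (N + 1) t) (i, j, c) (m, n) =
      (algE k s N * (Matrix.of fun a (b : Fin 2 × Fin (N + 2)) => rOp s (N + 1) t (i, a) b))
        (j, c) (m, n) := by
    simp only [Matrix.mul_apply, Fintype.sum_prod_type, vLeg_apply, ite_mul, zero_mul]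
    fin_cases i <;> simp
  rw [h]
  fin_cases j
  · exact (algE_mul_apply_zero N _ c (m, n)).trans (Algebra.smul_def _ _)
  · exact (algE_mul_apply_one N _ c (m, n)).trans (Algebra.smul_def _ _)

theorem acLeg_rOp_mul_vLeg_algE_apply (N : ℕ) (t : k) (i j : Fin 2) (c : Fin (N + 1)) (m : Fin 2)
    (n : Fin (N + 2)) :
    (acLeg (rOp s N t) * vLeg (algE k s N)) (i, j, c) (m, n) =
      if j = 0 then algebraMap ℂ k (eDiag s N n) * rEnt s N t i c m n
      else if (n : ℕ) = 0 then 0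
        else algebraMap ℂ k (eLow s N (n - 1)) * rEnt s N t i c m (n - 1) := by
  have h : (acLeg (rOp s N t) * vLeg (algE k s N)) (i, j, c) (m, n) =
      ∑ c' : Fin (N + 1), rEnt s N t i c m c' * algE k s N (j, c') n := by
    simp only [Matrix.mul_apply, Fintype.sum_prod_type, Fin.sum_univ_two, vLeg_apply, acLeg_apply,
      ite_mul, mul_ite, mul_zero, zero_mul]
    fin_cases j <;> fin_cases m <;> simp [rOp]
  rw [h]
  obtain ⟨n, hn⟩ := n
  fin_cases j
  · simp only [algE, Matrix.map_apply, fusE, if_true, Fin.zero_eta]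
    rcases Nat.lt_or_ge n (N + 1) with h | h
    · rw [Finset.sum_eq_single ⟨n, h⟩]
      · simp [mul_comm]
      · intro b _ hb
        rw [if_neg (fun e => hb (Fin.ext e.symm)), map_zero, mul_zero]
      · simp
    -- Out of range for the sum. The right-hand side vanishes too: the only possible nonzero entry
    -- carries `bCoef s N N = 0`.
    · obtain rfl : n = N + 1 := by omega
      rw [Finset.sum_eq_zero]
      · have hc := c.2
        have : rEnt s N t i c m (N + 1) = 0 := by
          rw [rEnt]
          split_ifs <;> first | rfl | omega | skip
          rw [show (c : ℕ) = N by omega, bCoef_self, mul_zero, map_zero]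
        rw [this, mul_zero]
      · intro b _
        rw [if_neg (by omega), map_zero, mul_zero]
  · simp only [algE, Matrix.map_apply, fusE, Fin.mk_one, one_ne_zero, if_false]
    split_ifs with h0
    · refine Finset.sum_eq_zero fun b _ => ?_
      rw [if_neg (by omega), map_zero, mul_zero]
    · rw [Finset.sum_eq_single ⟨n - 1, by omega⟩]
      · rw [if_pos (by simp; omega), mul_comm]
      · intro b _ hb
        rw [if_neg (fun e => hb (Fin.ext (by simp; omega))), map_zero, mul_zero]
      · simp

theorem algebraMap_omega_mul_qNum (hq : s ^ 2 - (s ^ 2)⁻¹ ≠ 0) (n : ℕ) :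
    algebraMap ℂ k (s ^ 2 - (s ^ 2)⁻¹) * algebraMap ℂ k (qNum s n) =
      (algebraMap ℂ k s ^ n) ^ 2 - ((algebraMap ℂ k s ^ n) ^ 2)⁻¹ := by
  rw [← map_mul, qNum, mul_div_cancel₀ _ hq]
  simp only [map_sub, map_inv₀, map_pow]
  ring

/-- Rows of `R₁₂ Y` for `R = R^{(1/2,1/2)}`. -/
theorem abLeg_rOp_mul_apply {V m : Type*} [Fintype V] [DecidableEq V] [Fintype m]
    (hb : bCoef s 1 0 = 1) (t : k) (Y : Matrix (Fin 2 × (Fin 2 × V)) m k) (i j : Fin 2) (c : V)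
    (b : m) :
    (abLeg V (rOp s 1 t) * Y) (i, j, c) b =
      if i = j then cFun (algebraMap ℂ k (s ^ 2) * t) * Y (i, j, c) b
      else cFun t * Y (i, j, c) b + algebraMap ℂ k (s ^ 2 - (s ^ 2)⁻¹) * Y (j, i, c) b := by
  simp only [Matrix.mul_apply, Fintype.sum_prod_type, abLeg_apply, Fin.sum_univ_two, ite_mul,
    zero_mul, Finset.sum_ite_eq, Finset.mem_univ, if_true]
  have e : (1 : ℤ) + 1 = 2 := rfl
  fin_cases i <;> fin_cases j <;> simp [rOp, rEnt, hb, e]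
  exact add_comm _ _

theorem algebraMap_zpow (a : ℤ) : algebraMap ℂ k (s ^ a) = algebraMap ℂ k s ^ a := map_zpow₀ _ _ _

variable (hs : s ≠ 0) (hq : ∀ n : ℕ, 0 < n → (s ^ 2) ^ n ≠ 1)
include hs hq

omit hq in
/-- `c(τ) [m] + c(τ q^{m+1}) = c(τ q) [m+1]`. -/
theorem cFun_mul_qNum_add (hω : s ^ 2 - (s ^ 2)⁻¹ ≠ 0) {τ : k} (hτ : τ ≠ 0) (m : ℕ) :
    cFun τ * algebraMap ℂ k (qNum s m) + cFun (algebraMap ℂ k (s ^ (2 * (m : ℤ) + 2)) * τ) =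
      cFun (algebraMap ℂ k (s ^ 2) * τ) * algebraMap ℂ k (qNum s (m + 1)) := by
  have hx : algebraMap ℂ k s ≠ 0 := by simpa using hs
  have hω' : algebraMap ℂ k (s ^ 2 - (s ^ 2)⁻¹) ≠ 0 := (map_ne_zero _).2 hω
  refine mul_left_cancel₀ hω' ?_
  have e1 := algebraMap_omega_mul_qNum (k := k) hω m
  have e2 := algebraMap_omega_mul_qNum (k := k) hω (m + 1)
  have e3 : algebraMap ℂ k (s ^ (2 * (m : ℤ) + 2)) =
      (algebraMap ℂ k s ^ m) ^ 2 * algebraMap ℂ k s ^ 2 := by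
    rw [algebraMap_zpow, zpow_add₀ hx, mul_comm 2 (m : ℤ), zpow_mul, zpow_natCast]
    norm_cast
  calc _ = cFun τ * (algebraMap ℂ k (s ^ 2 - (s ^ 2)⁻¹) * algebraMap ℂ k (qNum s m)) +
        algebraMap ℂ k (s ^ 2 - (s ^ 2)⁻¹) * cFun (algebraMap ℂ k (s ^ (2 * (m : ℤ) + 2)) * τ) := by
        ring
    _ = cFun (algebraMap ℂ k (s ^ 2) * τ) *
        (algebraMap ℂ k (s ^ 2 - (s ^ 2)⁻¹) * algebraMap ℂ k (qNum s (m + 1))) := by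
        rw [e1, e2, e3, pow_succ (algebraMap ℂ k s) m]
        have hm : algebraMap ℂ k s ^ m ≠ 0 := pow_ne_zero _ hx
        generalize algebraMap ℂ k s ^ m = p at hm ⊢
        simp only [cFun, map_sub, map_inv₀, map_pow]
        generalize algebraMap ℂ k s = x at hx ⊢
        field_simp
        ring
    _ = _ := by ring

omit hq in
/-- `c(τ) c(τ q^{m+1}) + (q - q⁻¹)² [m] = c(τ q) c(τ q^m)`. -/
theorem cFun_mul_cFun_add (hω : s ^ 2 - (s ^ 2)⁻¹ ≠ 0) {τ : k} (hτ : τ ≠ 0) (m : ℕ) :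
    cFun τ * cFun (algebraMap ℂ k (s ^ (2 * (m : ℤ) + 2)) * τ) +
      algebraMap ℂ k (s ^ 2 - (s ^ 2)⁻¹) ^ 2 * algebraMap ℂ k (qNum s m) =
      cFun (algebraMap ℂ k (s ^ 2) * τ) * cFun (algebraMap ℂ k (s ^ (2 * (m : ℤ))) * τ) := by
  have hx : algebraMap ℂ k s ≠ 0 := by simpa using hs
  have e1 := algebraMap_omega_mul_qNum (k := k) hω m
  have e2 : algebraMap ℂ k (s ^ (2 * (m : ℤ))) = (algebraMap ℂ k s ^ m) ^ 2 := by
    rw [algebraMap_zpow, mul_comm 2 (m : ℤ), zpow_mul, zpow_natCast]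
    norm_cast
  have e3 : algebraMap ℂ k (s ^ (2 * (m : ℤ) + 2)) =
      (algebraMap ℂ k s ^ m) ^ 2 * algebraMap ℂ k s ^ 2 := by
    rw [algebraMap_zpow, zpow_add₀ hx, ← algebraMap_zpow, e2]
    norm_cast
  rw [sq (algebraMap ℂ k (s ^ 2 - (s ^ 2)⁻¹)), mul_assoc, e1, e2, e3]
  have hm : algebraMap ℂ k s ^ m ≠ 0 := pow_ne_zero _ hx
  generalize algebraMap ℂ k s ^ m = p at hm ⊢
  simp only [cFun, map_sub, map_inv₀, map_pow]
  generalize algebraMap ℂ k s = x at hx ⊢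
  field_simp
  ring

/-- Entry by entry both sides live on the same few diagonals. Where R₁₂ mixes ↑↓ and ↓↑ the two
contributions combine through `cFun_mul_qNum_add` or `cFun_mul_cFun_add`, after the weights of ℰ
have turned products of B's into q-numbers. The scalar c(q τ), with τ the argument of R₁₂, is the
extra factor in the normalization of R^{(1/2,j+1/2)}. -/
theorem rOp_fusion (N : ℕ) {t : k} (ht : t ≠ 0) :
    cFun (algebraMap ℂ k (s ^ (2 - (N : ℤ))) * t) • (vLeg (algE k s N) * rOp s (N + 1) t) =
      abLeg (Fin (N + 1)) (rOp s 1 (algebraMap ℂ k (s ^ (-(N : ℤ))) * t)) *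
        (acLeg (rOp s N (algebraMap ℂ k s * t)) * vLeg (algE k s N)) := by
  have hω := qSq_sub_ne hs hq
  have hb1 : bCoef s 1 0 = 1 := bCoef_one_zero hs hq
  -- τ = q^{-N/2} t is the argument of R₁₂; all other arguments are written as a power of q^{1/2}
  -- times τ.
  set τ := algebraMap ℂ k (s ^ (-(N : ℤ))) * t with hτd
  have hτ : τ ≠ 0 := mul_ne_zero ((map_ne_zero _).2 (zpow_ne_zero _ hs)) ht
  have htt : ∀ a : ℤ, algebraMap ℂ k (s ^ a) * t = algebraMap ℂ k (s ^ (a + N)) * τ := by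
    intro a
    rw [hτd, ← mul_assoc, ← map_mul, ← zpow_add₀ hs]
    congr 3
    ring_nf
  have hts : ∀ a : ℤ, algebraMap ℂ k (s ^ a) * (algebraMap ℂ k s * t) =
      algebraMap ℂ k (s ^ (a + 1 + N)) * τ := by
    intro a
    rw [← htt, ← mul_assoc, ← map_mul, zpow_add_one₀ hs]
  ext ⟨i, j, c⟩ ⟨m, n⟩
  rw [Matrix.smul_apply, smul_eq_mul, vLeg_algE_mul_rOp_apply, abLeg_rOp_mul_apply hb1,
    acLeg_rOp_mul_vLeg_algE_apply, acLeg_rOp_mul_vLeg_algE_apply]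
  obtain ⟨c, hc⟩ := c
  obtain ⟨n, hn⟩ := n
  have eC : cFun (algebraMap ℂ k (s ^ (2 - (N : ℤ))) * t) = cFun (algebraMap ℂ k (s ^ 2) * τ) := by
    rw [htt]
    norm_num
  rw [eC]
  have A : ∀ {x y : ℂ}, x = y → algebraMap ℂ k x = algebraMap ℂ k y := fun h => congrArg _ h
  fin_cases i <;> fin_cases j <;> fin_cases m <;>
    simp only [rEnt, Fin.zero_eta, Fin.mk_one, if_true, one_ne_zero, zero_ne_one, if_false, htt, hts]
  · split_ifs with h1
    · subst h1
      rw [show 1 + ((N + 1 : ℕ) : ℤ) - 2 * c + N = 1 + (N : ℤ) - 2 * c + 1 + N by push_cast; ring]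
    · ring
  · split_ifs with h1
    · subst h1
      have := A (bCoef_mul_eDiag hs hq (show n ≤ N by omega))
      simp only [map_mul] at this ⊢
      linear_combination cFun (algebraMap ℂ k (s ^ 2) * τ) * algebraMap ℂ k (s ^ 2 - (s ^ 2)⁻¹) * this
    · ring
  · by_cases h1 : c + 1 = n
    · subst h1
      have h3 := A (bCoef_mul_eDiag_succ hs hq (show c ≤ N by omega))
      have h4 := cFun_mul_cFun_add hs hω hτ (N - c)
      rw [show 1 + ((N + 1 : ℕ) : ℤ) - 2 * ((c + 1 : ℕ) : ℤ) + N = 2 * ((N - c : ℕ) : ℤ) by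
        rw [Nat.cast_sub (by omega)]; push_cast; ring,
        show 1 + (N : ℤ) - 2 * c + 1 + N = 2 * ((N - c : ℕ) : ℤ) + 2 by
        rw [Nat.cast_sub (by omega)]; ring]
      simp only [if_true, Nat.succ_ne_zero, Nat.add_sub_cancel, if_false, map_mul] at h3 ⊢
      linear_combination (-algebraMap ℂ k (eLow s N c)) * h4 -
        algebraMap ℂ k (s ^ 2 - (s ^ 2)⁻¹) ^ 2 * h3
    · rw [if_neg h1, if_neg (Ne.symm h1)]
      split_ifs <;> first | omega | simp
  · by_cases h1 : c = n
    · subst h1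
      have h3 := A (bCoef_mul_eLow hs hq (show c ≤ N by omega))
      have h4 := cFun_mul_qNum_add hs hω hτ c
      rw [show 1 - (N : ℤ) + 2 * c + 1 + N = 2 * (c : ℤ) + 2 by ring]
      simp only [if_true, map_mul] at h3 ⊢
      -- At c = 0 there is no neighbour c − 1; the missing contribution agrees with [0] = 0.
      rcases Nat.eq_zero_or_pos c with rfl | h0
      · simp only [if_true, zero_add, qNum_zero, map_zero, mul_zero] at h3 h4 ⊢
        linear_combination cFun (algebraMap ℂ k (s ^ 2) * τ) * algebraMap ℂ k (s ^ 2 - (s ^ 2)⁻¹) * h3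
          - algebraMap ℂ k (s ^ 2 - (s ^ 2)⁻¹) * algebraMap ℂ k (eDiag s N 0) * h4
      · have h5 := A (bCoef_mul_eLow_self hs hq (show c - 1 < N by omega))
        rw [Nat.sub_add_cancel h0] at h5
        simp only [if_neg h0.ne', if_pos (Nat.sub_add_cancel h0).symm, map_mul] at h5 ⊢
        linear_combination cFun (algebraMap ℂ k (s ^ 2) * τ) * algebraMap ℂ k (s ^ 2 - (s ^ 2)⁻¹) * h3
          - algebraMap ℂ k (s ^ 2 - (s ^ 2)⁻¹) * algebraMap ℂ k (eDiag s N c) * h4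
          - cFun τ * algebraMap ℂ k (s ^ 2 - (s ^ 2)⁻¹) * h5
    · rw [if_neg h1, if_neg (by omega : ¬ c + 1 = n + 1)]
      split_ifs <;> first | omega | simp
  · by_cases h1 : c + 1 = n
    · subst h1
      have h2 := A (bCoef_mul_eDiag_self hs hq (show c ≤ N by omega))
      have h3 := A (bCoef_mul_eDiag_succ hs hq (show c ≤ N by omega))
      have h4 := cFun_mul_qNum_add hs hω hτ (N - c)
      rw [show 1 + (N : ℤ) - 2 * c + 1 + N = 2 * ((N - c : ℕ) : ℤ) + 2 by
        rw [Nat.cast_sub (by omega)]; ring]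
      rw [show N + 1 - c = N - c + 1 by omega] at h2
      simp only [if_true, Nat.succ_ne_zero, Nat.add_sub_cancel, if_false, map_mul] at h2 h3 ⊢
      linear_combination cFun (algebraMap ℂ k (s ^ 2) * τ) * algebraMap ℂ k (s ^ 2 - (s ^ 2)⁻¹) * h2
          - algebraMap ℂ k (s ^ 2 - (s ^ 2)⁻¹) * algebraMap ℂ k (eLow s N c) * h4
          - cFun τ * algebraMap ℂ k (s ^ 2 - (s ^ 2)⁻¹) * h3
    · rw [if_neg (Ne.symm h1)]
      split_ifs <;> first | omega | simp
  · by_cases h1 : c = n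
    · subst h1
      have h4 := cFun_mul_cFun_add hs hω hτ c
      rw [show 1 - ((N + 1 : ℕ) : ℤ) + 2 * c + N = 2 * (c : ℤ) by push_cast; ring,
        show 1 - (N : ℤ) + 2 * c + 1 + N = 2 * (c : ℤ) + 2 by ring]
      simp only [if_true, map_mul]
      rcases Nat.eq_zero_or_pos c with rfl | h0
      · simp only [if_true, qNum_zero, map_zero, mul_zero] at h4 ⊢
        linear_combination (-algebraMap ℂ k (eDiag s N 0)) * h4
      · have h5 := A (bCoef_mul_eLow_self hs hq (show c - 1 < N by omega))
        rw [Nat.sub_add_cancel h0] at h5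
        simp only [if_neg h0.ne', if_pos (Nat.sub_add_cancel h0).symm, map_mul] at h5 ⊢
        linear_combination (-algebraMap ℂ k (eDiag s N c)) * h4 -
          algebraMap ℂ k (s ^ 2 - (s ^ 2)⁻¹) ^ 2 * h5
    · rw [if_neg h1, if_neg h1]
      split_ifs <;> first | omega | simp
  · by_cases h1 : n = c + 2
    · subst h1
      have h3 := A (bCoef_mul_eLow_succ hs hq (show c < N by omega))
      simp only [if_true, Nat.add_eq_zero_iff, OfNat.ofNat_ne_zero, and_false, if_false,
        show c + 2 - 1 = c + 1 by omega, map_mul] at h3 ⊢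
      linear_combination cFun (algebraMap ℂ k (s ^ 2) * τ) * algebraMap ℂ k (s ^ 2 - (s ^ 2)⁻¹) * h3
    · rw [if_neg (by omega : ¬ n = c + 1 + 1)]
      split_ifs <;> first | omega | simp
  · by_cases h1 : c + 1 = n
    · subst h1
      rw [show 1 - ((N + 1 : ℕ) : ℤ) + 2 * ((c + 1 : ℕ) : ℤ) + N = 1 - (N : ℤ) + 2 * c + 1 + N by
        push_cast; ring]
      simp
    · rw [if_neg h1]
      split_ifs <;> first | omega | simp

/-- Fusion of R-matrices in the second factor. -/
theorem vLeg_algE_mul_rMat (N : ℕ) (hN : 1 ≤ N) {t : k} (ht : t ≠ 0) :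
    vLeg (algE k s N) * rMat s (N + 1) t =
      abLeg (Fin (N + 1)) (rMat s 1 (algebraMap ℂ k (s ^ (-(N : ℤ))) * t)) *
        (acLeg (rMat s N (algebraMap ℂ k s * t)) * vLeg (algE k s N)) := by
  obtain ⟨M, rfl⟩ : ∃ M, N = M + 1 := ⟨N - 1, by omega⟩
  have h := rOp_fusion hs hq (M + 1) ht
  have hsm : ∀ (c : k) (Y : Matrix (Fin 2 × Fin (M + 1 + 1)) (Fin 2 × Fin (M + 1 + 1)) k),
      acLeg (c • Y) = c • acLeg Y := by
    intro c Y
    ext a b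
    simp [acLeg_apply]
  rw [rMat_eq, rMat_eq 1, rMat_eq (M + 1)]
  simp only [Nat.sub_self, Finset.range_zero, Finset.prod_empty, one_smul, hsm, Matrix.mul_smul,
    Matrix.smul_mul, Nat.add_sub_cancel]
  rw [← h, smul_smul, Finset.prod_range_succ]
  congr 2
  -- The factors of R^{(1/2,j)} at q^{1/2} t are the first N − 1 factors of R^{(1/2,j+1/2)} at t;
  -- the last one, with exponent 2 − N, is the scalar of `rOp_fusion`.
  · refine Finset.prod_congr rfl fun i _ => ?_
    rw [← mul_assoc, ← map_mul, ← zpow_add_one₀ hs]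
    congr 4
    push_cast
    ring
  · congr 4
    push_cast
    ring

omit hs hq in
theorem sum_rEnt_mul (N : ℕ) (t : k) (i m : Fin 2) (c : Fin (N + 1)) (f : ℕ → k) :
    ∑ d : Fin (N + 1), rEnt s N t i c m d * f d =
      if i = m then rEnt s N t i c i c * f c
      else if i = 0 then
        if (c : ℕ) = 0 then 0
        else algebraMap ℂ k ((s ^ 2 - (s ^ 2)⁻¹) * bCoef s N (c - 1)) * f (c - 1)
      else algebraMap ℂ k ((s ^ 2 - (s ^ 2)⁻¹) * bCoef s N c) * f (c + 1) := by
  obtain ⟨c, hc⟩ := c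
  by_cases him : i = m
  · subst him
    rw [if_pos rfl, Finset.sum_eq_single ⟨c, hc⟩]
    · intro b _ hb
      have : ¬ c = b := fun e => hb (Fin.ext e.symm)
      fin_cases i <;> simp [rEnt, this]
    · simp
  rw [if_neg him]
  fin_cases i <;> fin_cases m
  · exact absurd rfl him
  · simp only [rEnt, Fin.zero_eta, Fin.mk_one, if_true, one_ne_zero, if_false]
    split_ifs with h0
    · refine Finset.sum_eq_zero fun b _ => ?_
      rw [if_neg (by omega), zero_mul]
    · rw [Finset.sum_eq_single ⟨c - 1, by omega⟩]
      · rw [if_pos (by simp; omega)]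
      · intro b _ hb
        rw [if_neg (fun e => hb (Fin.ext (by simp; omega))), zero_mul]
      · simp
  · simp only [rEnt, Fin.zero_eta, Fin.mk_one, if_true, one_ne_zero, if_false]
    rcases Nat.lt_or_ge c N with h | h
    · rw [Finset.sum_eq_single ⟨c + 1, by omega⟩]
      · rw [if_pos rfl]
      · intro b _ hb
        rw [if_neg (fun e => hb (Fin.ext e)), zero_mul]
      · simp
    -- There is no row N + 1: whatever `f` is at that index, it is multiplied by `bCoef s N N = 0`.
    · obtain rfl : c = N := by omega
      rw [Finset.sum_eq_zero, bCoef_self, mul_zero, map_zero, zero_mul]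
      intro b _
      rw [if_neg (by omega), zero_mul]
  · exact absurd rfl him

/-- This is the analogue of `lGen_sym` in the spin-N/2 representation. The columns ↑↑ and ↓↓ match
at once, since conjugation by K shifts the argument by q. For ↑↓ + ↓↑ the products of B's are
q-numbers, and a rational identity remains. -/
theorem symPres_rOp (N : ℕ) {t : k} (ht : t ≠ 0) :
    SymPres (acLeg (rOp s N t) * vLeg (rOp s N (algebraMap ℂ k (s ^ 2) * t))) := by
  have hω := qSq_sub_ne hs hq
  have hprod := fun (i j : Fin 2) (c : Fin (N + 1)) (i' j' : Fin 2) (c' : Fin (N + 1)) =>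
    (show (acLeg (rOp s N t) * vLeg (rOp s N (algebraMap ℂ k (s ^ 2) * t))) (i, j, c) (i', j', c') =
      ∑ d : Fin (N + 1), rEnt s N t i c i' d * rEnt s N (algebraMap ℂ k (s ^ 2) * t) j d j' c' by
    simp only [Matrix.mul_apply, Fintype.sum_prod_type, acLeg_apply, vLeg_apply, mul_ite, ite_mul,
      zero_mul, mul_zero]
    fin_cases i' <;> fin_cases j <;> simp [rOp]).trans
      (sum_rEnt_mul N t i i' c fun d => rEnt s N (algebraMap ℂ k (s ^ 2) * t) j d j' c')
  have hα : ∀ a : ℤ, algebraMap ℂ k (s ^ a) * (algebraMap ℂ k (s ^ 2) * t) =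
      algebraMap ℂ k (s ^ (a + 2)) * t := by
    intro a
    rw [← mul_assoc, ← map_mul, zpow_add₀ hs]
    norm_cast
  constructor
  · intro c c'
    rw [hprod, hprod]
    simp only [rEnt, if_true, one_ne_zero, if_false, hα]
    by_cases h : (c' : ℕ) = c + 1
    · rw [if_pos h, if_pos h.symm, mul_comm]
      congr 4
      push_cast
      ring_nf
    · rw [if_neg h, if_neg (Ne.symm h)]
      simp
  · intro c c'
    rw [hprod, hprod]
    simp only [rEnt, if_true, one_ne_zero, zero_ne_one, if_false, hα]
    by_cases h : (c : ℕ) = c' + 1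
    · rw [if_neg (by omega), if_pos (by omega), if_pos h, mul_comm, h, Nat.add_sub_cancel]
      congr 4
      push_cast
      ring_nf
    · rw [if_neg h]
      split_ifs <;> first | omega | simp
  · intro c c'
    rw [hprod, hprod, hprod, hprod]
    simp only [rEnt, if_true, one_ne_zero, zero_ne_one, if_false, hα]
    obtain ⟨c, hc⟩ := c
    obtain ⟨c', hc'⟩ := c'
    by_cases h : c = c'
    · subst h
      have e0 := bCoef_sq s N c
      have hx : algebraMap ℂ k s ≠ 0 := (map_ne_zero _).2 hs
      have eq1 : ∀ n, algebraMap ℂ k (s ^ 2 - (s ^ 2)⁻¹) * algebraMap ℂ k (qNum s n) =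
        (algebraMap ℂ k s ^ n) ^ 2 - ((algebraMap ℂ k s ^ n) ^ 2)⁻¹ :=
          algebraMap_omega_mul_qNum hω
      -- Under natural subtraction the case c = 0 must be separate; the factor [c] makes the formula
      -- uniform.
      have b1 : (if c = 0 then 0 else algebraMap ℂ k ((s ^ 2 - (s ^ 2)⁻¹) * bCoef s N (c - 1)) *
            if c = c - 1 + 1 then algebraMap ℂ k ((s ^ 2 - (s ^ 2)⁻¹) * bCoef s N (c - 1)) else 0) =
          (algebraMap ℂ k (s ^ 2 - (s ^ 2)⁻¹) * algebraMap ℂ k (qNum s (N - c + 1))) *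
          (algebraMap ℂ k (s ^ 2 - (s ^ 2)⁻¹) * algebraMap ℂ k (qNum s c)) := by
        rcases Nat.eq_zero_or_pos c with rfl | h0
        · simp [qNum_zero]
        · rw [if_neg h0.ne', if_pos (Nat.sub_add_cancel h0).symm, ← map_mul, ← map_mul, ← map_mul,
            ← map_mul]
          congr 1
          have := bCoef_sq s N (c - 1)
          rw [Nat.sub_add_cancel h0, show N - (c - 1) = N - c + 1 by omega] at this
          linear_combination (s ^ 2 - (s ^ 2)⁻¹) ^ 2 * this
      have b2 : algebraMap ℂ k ((s ^ 2 - (s ^ 2)⁻¹) * bCoef s N c) *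
            algebraMap ℂ k ((s ^ 2 - (s ^ 2)⁻¹) * bCoef s N c) =
          (algebraMap ℂ k (s ^ 2 - (s ^ 2)⁻¹) * algebraMap ℂ k (qNum s (N - c))) *
          (algebraMap ℂ k (s ^ 2 - (s ^ 2)⁻¹) * algebraMap ℂ k (qNum s (c + 1))) := by
        rw [← map_mul, ← map_mul, ← map_mul, ← map_mul]
        congr 1
        linear_combination (s ^ 2 - (s ^ 2)⁻¹) ^ 2 * e0
      rw [b1]
      simp only [if_true]
      rw [b2, eq1, eq1, eq1, eq1]
      -- With N = M + c everything is rational in s, s^c, s^M and t.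
      obtain ⟨M, rfl⟩ : ∃ M, N = M + c := ⟨N - c, by omega⟩
      rw [Nat.add_sub_cancel, pow_succ _ M, pow_succ _ c,
        show 1 + ((M + c : ℕ) : ℤ) - 2 * c = (M : ℤ) - c + 1 by push_cast; ring,
        show 1 - ((M + c : ℕ) : ℤ) + 2 * c + 2 = (c : ℤ) - M + 1 + 2 by push_cast; ring,
        show 1 - ((M + c : ℕ) : ℤ) + 2 * c = (c : ℤ) - M + 1 by push_cast; ring]
      simp only [algebraMap_zpow, zpow_add₀ hx, zpow_sub₀ hx, zpow_natCast, zpow_one, cFun]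
      have hc : algebraMap ℂ k s ^ c ≠ 0 := pow_ne_zero _ hx
      have hM : algebraMap ℂ k s ^ M ≠ 0 := pow_ne_zero _ hx
      generalize algebraMap ℂ k s ^ c = y at hc ⊢
      generalize algebraMap ℂ k s ^ M = z at hM ⊢
      generalize algebraMap ℂ k s = x at hx ⊢
      rw [show x ^ (2 : ℤ) = x ^ 2 by norm_cast]
      field_simp
      ring
    · simp only [h, if_false, mul_zero]
      split_ifs <;> first | omega | simp

/-- `R₁₃(t) R₂₃(qt)` preserves the symmetric tensors of the first two factors. -/
theorem symPres_rMat (N : ℕ) {t : k} (ht : t ≠ 0) :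
    SymPres (acLeg (rMat s N t) * vLeg (rMat s N (algebraMap ℂ k (s ^ 2) * t))) := by
  have hsm : ∀ (c : k) (Y : Matrix (Fin 2 × Fin (N + 1)) (Fin 2 × Fin (N + 1)) k),
      acLeg (c • Y) = c • acLeg Y := by
    intro c Y
    ext a b
    simp [acLeg_apply]
  rw [rMat_eq, rMat_eq, hsm, vLeg_smul, Matrix.mul_smul, Matrix.smul_mul]
  have h := symPres_rOp hs hq N ht
  constructor
  · intro c c'
    simp only [Matrix.smul_apply, h.col_00 c c']
  · intro c c'
    simp only [Matrix.smul_apply, h.col_11 c c']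
  · intro c c'
    simp only [Matrix.smul_apply, ← smul_add, h.col_sym c c']

end Fusion

/-! ### Substitutions u ↦ a u on matrices. -/

section MapShift

variable {A : Type*} [Ring A] [Algebra ℂ A] {l m n : Type*} [Fintype m]

theorem map_shift_mul {a : ℂ} (ha : a ≠ 0) (M : Matrix l m (HahnSeries ℤ A))
    (N : Matrix m n (HahnSeries ℤ A)) :
    (M * N).map (shift a) = M.map (shift a) * N.map (shift a) :=
  Matrix.map_mul (f := shiftHom ha)

theorem map_shift_map_shift (a b : ℂ) (M : Matrix l n (HahnSeries ℤ A)) :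
    (M.map (shift a)).map (shift b) = M.map (shift (a * b)) := by
  ext1 i j
  exact shift_shift b a _

theorem map_shift_one (M : Matrix l n (HahnSeries ℤ A)) : M.map (shift 1) = M := by
  ext1 i j
  exact shift_one _

variable {V W : Type*} [Fintype V] [DecidableEq V] [Fintype W] [DecidableEq W]

theorem aLeg_map_shift {a : ℂ} (ha : a ≠ 0) (M : Matrix (Fin 2) (Fin 2) (HahnSeries ℤ A)) :
    (aLeg V M).map (shift a) = aLeg V (M.map (shift a)) := aLeg_map (shiftHom ha) M

theorem vLeg_map_shift {a : ℂ} (ha : a ≠ 0) (M : Matrix V W (HahnSeries ℤ A)) :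
    (vLeg M).map (shift a) = vLeg (M.map (shift a)) := vLeg_map (shiftHom ha) M

theorem algE_map {X Y : Type*} [Ring X] [Ring Y] [Algebra ℂ X] [Algebra ℂ Y] (f : X →+* Y)
    (hf : ∀ c, f (algebraMap ℂ X c) = algebraMap ℂ Y c) (s : ℂ) (N : ℕ) :
    (algE X s N).map f = algE Y s N := by
  ext1 i j
  exact hf _

theorem algF_map {X Y : Type*} [Ring X] [Ring Y] [Algebra ℂ X] [Algebra ℂ Y] (f : X →+* Y)
    (hf : ∀ c, f (algebraMap ℂ X c) = algebraMap ℂ Y c) (s : ℂ) (N : ℕ) :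
    (algF X s N).map f = algF Y s N := by
  ext1 i j
  exact hf _

theorem algE_map_shift {a : ℂ} (ha : a ≠ 0) (s : ℂ) (N : ℕ) :
    (algE (HahnSeries ℤ A) s N).map (shift a) = algE (HahnSeries ℤ A) s N :=
  algE_map (shiftHom ha) (fun c => shift_algebraMap a c) s N

theorem aLeg_mul_vLeg_algE {X : Type*} [Ring X] [Algebra ℂ X] (s : ℂ) (N : ℕ)
    (M : Matrix (Fin 2) (Fin 2) X) :
    vLeg (algE X s N) * aLeg (Fin (N + 2)) M = aLeg (Fin 2 × Fin (N + 1)) M * vLeg (algE X s N) :=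
  (aLeg_vLeg_comm fun _ _ _ _ => (Algebra.commutes _ _).symm).symm

theorem constMat_fusE (s : ℂ) (N : ℕ) : constMat A (fusE s N) = algE (HahnSeries ℤ A) s N :=
  constMat_eq A _

theorem constMat_fusF (s : ℂ) (N : ℕ) : constMat A (fusF s N) = algF (HahnSeries ℤ A) s N :=
  constMat_eq A _

end MapShift

/-! ### Both orders of fusion for the L-operators. -/

section FusedL

variable {s : ℂ} (hs : s ≠ 0) (hq : ∀ n : ℕ, 0 < n → (s ^ 2) ^ n ≠ 1)
include hs hq

omit hs hq in
theorem id_eval : LEval (RingHom.id (HahnSeries ℤ (Uq s))) (constAlg (Uq s))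
    ⟨HahnSeries.single (-1) 1, single_mem_center _ (Subring.one_mem _)⟩
    ⟨HahnSeries.single 1 1, single_mem_center _ (Subring.one_mem _)⟩ where
  inv := Subtype.ext (by
    change HahnSeries.single (-1) (1 : Uq s) * HahnSeries.single 1 1 = 1
    rw [HahnSeries.single_mul_single]
    simp)
  map_zero a := rfl
  map_neg a := by
    change HahnSeries.single (-1) a = HahnSeries.single (-1) 1 * HahnSeries.single 0 a
    rw [HahnSeries.single_mul_single, one_mul, add_zero]
  map_pos a := by
    change HahnSeries.single 1 a = HahnSeries.single 1 1 * HahnSeries.single 0 a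
    rw [HahnSeries.single_mul_single, one_mul, add_zero]

/-- `ℒ₂(x) ℒ₁(q x)` preserves symmetric tensors. -/
theorem symPres_lHalf {V : Type*} [Fintype V] [DecidableEq V] {a : ℂ} (ha : a ≠ 0) :
    SymPres (vLeg (aLeg V ((lHalf s).map (shift a))) *
      aLeg (Fin 2 × V) ((lHalf s).map (shift (a * s ^ 2)))) := by
  rw [← abLeg_vLeg, ← abLeg_aLeg, ← abLeg_mul]
  have h := (id_eval (s := s)).comp_shift ha
  have hs2 : s ^ 2 ≠ 0 := pow_ne_zero _ hs
  have h1 : (lHalf s).map (shift a) = _ := h.lHalf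
  have h2 : ((lHalf s).map (shift (s ^ 2))).map (shift a) = _ := (h.comp_shift hs2).lHalf
  rw [map_shift_map_shift, mul_comm] at h2
  have key := fun m l => lGen_sym (uqTuple hs (qSq_sub_ne hs hq) (constAlg (Uq s))) h.inv m l
  have e1 : ∀ x, cst (HahnSeries ℤ (Uq s)) (s ^ 2) * x = x * cst _ s ^ 2 := fun x => by
    rw [mul_comm, sq, sq, cst_mul]
  have e2 : ∀ x, cst (HahnSeries ℤ (Uq s)) (s ^ 2)⁻¹ * x = x * cst _ s⁻¹ ^ 2 := fun x => by
    rw [mul_comm, sq, sq, cst_mul, mul_inv]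
  rw [e1, e2] at h2
  rw [h1, h2]
  -- For equal indices `lGen_sym` gives twice the wanted identity.
  have two : ∀ y z : HahnSeries ℤ (Uq s), y + y = z + z → y = z := by
    intro y z h
    refine smul_right_injective _ (two_ne_zero (α := ℂ)) ?_
    change (2 : ℂ) • y = (2 : ℂ) • z
    rwa [two_smul, two_smul]
  refine symPres_abLeg ?_ ?_ ?_
  · rw [vLeg_mul_aLeg_apply, vLeg_mul_aLeg_apply]
    exact two _ _ (key 0 0)
  · rw [vLeg_mul_aLeg_apply, vLeg_mul_aLeg_apply]
    exact two _ _ (key 1 1)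
  · rw [vLeg_mul_aLeg_apply, vLeg_mul_aLeg_apply, vLeg_mul_aLeg_apply, vLeg_mul_aLeg_apply]
    exact key 0 1

omit hs hq in
theorem fusedL_succ (N : ℕ) : fusedL s (N + 2) = algF (HahnSeries ℤ (Uq s)) s (N + 1) *
    (vLeg ((fusedL s (N + 1)).map (shift s⁻¹)) *
      aLeg (Fin (N + 2)) ((lHalf s).map (shift (s ^ (N + 1)))) *
        algE (HahnSeries ℤ (Uq s)) s (N + 1)) := by
  rw [fusedL, constMat_fusE, constMat_fusF, leg1_eq, leg2_eq, Matrix.mul_assoc, Matrix.mul_assoc,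
    Matrix.mul_assoc]

/-- For N = 0 the intertwiner is the identification ℂ² = ℂ² ⊗ ℂ, which allows the inductions on ℒ to
start at spin 0. -/
theorem aLeg_mul_algE_zero {X : Type*} [Ring X] [Algebra ℂ X] (M : Matrix (Fin 2) (Fin 2) X) :
    aLeg (Fin 1) M * algE X s 0 = algE X s 0 * M := by
  have h1 : eLow s 0 0 = 1 := by
    rw [eLow, eDiag_zero, bCoef_one_zero hs hq, zero_add, qNum_one hs hq, mul_one, div_one]
  ext ⟨i, c⟩ j
  obtain rfl : c = 0 := Subsingleton.elim _ _
  rw [Matrix.mul_apply, Matrix.mul_apply]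
  simp only [Fintype.sum_prod_type, aLeg_apply, algE, Matrix.map_apply, fusE]
  fin_cases i <;> fin_cases j <;> simp [Fin.sum_univ_two, eDiag_zero, h1]

/-- The recursion holds without the projection ℱ. Applying the previous ℰ in the second leg splits
off one more spin-1/2 factor, and the two such factors have arguments in ratio q, so `symPres_lHalf`
shows that the image of ℰ is preserved. -/
theorem vLeg_fusedL_mul (N : ℕ) :
    vLeg ((fusedL s N).map (shift s⁻¹)) * aLeg (Fin (N + 1)) ((lHalf s).map (shift (s ^ N))) *
        algE (HahnSeries ℤ (Uq s)) s N =
      algE (HahnSeries ℤ (Uq s)) s N * fusedL s (N + 1) := by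
  have hsi : s⁻¹ ≠ 0 := inv_ne_zero hs
  induction N with
  | zero =>
    have e : (fusedL s 0).map (shift s⁻¹) = 1 :=
      Matrix.map_one (shiftHom hsi) (map_zero _) (map_one _)
    have e1 : vLeg (1 : Matrix (Fin 1) (Fin 1) (HahnSeries ℤ (Uq s))) = 1 :=
      Matrix.one_kronecker_one
    rw [e, e1, Matrix.one_mul, pow_zero, map_shift_one, aLeg_mul_algE_zero hs hq]
    rfl
  | succ N ih =>
    rw [fusedL_succ]
    refine (InImage.algE_algF_mul hs hq ((swapInv_vLeg_algE_iff hs hq N _).1 ?_)).symm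
    have h := congrArg (fun M => M.map (shift s⁻¹)) ih
    simp only [map_shift_mul hsi, vLeg_map_shift hsi, aLeg_map_shift hsi, algE_map_shift hsi,
      map_shift_map_shift] at h
    rw [← Matrix.mul_assoc, ← Matrix.mul_assoc, ← vLeg_mul, ← h, vLeg_mul, vLeg_mul,
      Matrix.mul_assoc _ (vLeg (algE _ s N)), aLeg_mul_vLeg_algE]
    simp only [Matrix.mul_assoc]
    refine SwapInv.vLeg_vLeg_mul ?_ _
    rw [← Matrix.mul_assoc (vLeg _)]
    refine SymPres.mul ?_ (swapInv_vLeg_algE_mul_algE hs hq N)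
    have h2 := symPres_lHalf hs hq (V := Fin (N + 1)) (mul_ne_zero (pow_ne_zero N hs) hsi)
    rwa [show s ^ N * s⁻¹ * s ^ 2 = s ^ (N + 1) by
      field_simp
      exact (pow_succ s N).symm] at h2

/-- Fusing with the spin-1/2 leg on the left and the shifts of the 𝒦-recursion gives the same
operator. This is the order in which the ℒ-factors appear when dressed K-operators are fused. -/
theorem aLeg_lHalf_mul (N : ℕ) :
    aLeg (Fin (N + 1)) ((lHalf s).map (shift (s ^ (-(N : ℤ))))) *
        vLeg ((fusedL s N).map (shift s)) * algE (HahnSeries ℤ (Uq s)) s N =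
      algE (HahnSeries ℤ (Uq s)) s N * fusedL s (N + 1) := by
  have hsi : s⁻¹ ≠ 0 := inv_ne_zero hs
  induction N with
  | zero =>
    have e : (fusedL s 0).map (shift s) = 1 :=
      Matrix.map_one (shiftHom hs) (map_zero _) (map_one _)
    have e1 : vLeg (1 : Matrix (Fin 1) (Fin 1) (HahnSeries ℤ (Uq s))) = 1 :=
      Matrix.one_kronecker_one
    rw [e, e1, Matrix.mul_one, Nat.cast_zero, neg_zero, zpow_zero, map_shift_one,
      aLeg_mul_algE_zero hs hq]
    rfl
  | succ N ih =>
    have hα := vLeg_fusedL_mul hs hq (N + 1)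
    have hα' := congrArg (fun M => M.map (shift s)) (vLeg_fusedL_mul hs hq N)
    have hβ := congrArg (fun M => M.map (shift s⁻¹)) ih
    simp only [map_shift_mul hsi, vLeg_map_shift hsi, aLeg_map_shift hsi, algE_map_shift hsi,
      map_shift_map_shift, mul_inv_cancel₀ hs, map_shift_one] at hβ
    simp only [map_shift_mul hs, vLeg_map_shift hs, aLeg_map_shift hs, algE_map_shift hs,
      map_shift_map_shift, inv_mul_cancel₀ hs, map_shift_one] at hα'
    -- The right side is symmetric in the two spin-1/2 legs, so these may be exchanged in it. With
    -- `hα` and the induction hypothesis `hβ` it is ℒ_b ℒ_c ℒ_a; after the exchange it is ℒ_a ℒ_c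
    -- ℒ_b, which `hα'` recombines into the left side.
    have hinv : SwapInv (vLeg (algE (HahnSeries ℤ (Uq s)) s N) *
        (algE (HahnSeries ℤ (Uq s)) s (N + 1) * fusedL s (N + 1 + 1))) := by
      rw [← Matrix.mul_assoc]
      exact (swapInv_vLeg_algE_mul_algE hs hq N).mul_right _
    refine vLeg_algE_injective hs hq N ?_
    rw [← hinv.swapRows, ← hα, ← Matrix.mul_assoc (vLeg (algE (HahnSeries ℤ (Uq s)) s N)),
      ← Matrix.mul_assoc (vLeg (algE (HahnSeries ℤ (Uq s)) s N)),
      ← Matrix.mul_assoc (vLeg (algE (HahnSeries ℤ (Uq s)) s N)),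
      ← Matrix.mul_assoc (vLeg (algE (HahnSeries ℤ (Uq s)) s N)),
      aLeg_mul_vLeg_algE, ← vLeg_mul, ← hβ, vLeg_mul, vLeg_mul,
      Matrix.mul_assoc _ (vLeg (algE _ s N)) (aLeg _ _), aLeg_mul_vLeg_algE,
      Matrix.mul_assoc _ (vLeg (algE _ s N)) (vLeg _), ← vLeg_mul, ← hα', vLeg_mul, vLeg_mul]
    simp only [Matrix.mul_assoc]
    rw [swapRows_vLeg_aLeg_mul, swapRows_vLeg_vLeg_mul, swapRows_aLeg_mul,
      (swapInv_vLeg_algE_mul_algE hs hq N).swapRows, pow_succ,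
      show s ^ (-((N + 1 : ℕ) : ℤ)) = s ^ (-(N : ℤ)) * s⁻¹ by
        rw [← zpow_sub_one₀ hs]; congr 1; push_cast; ring]

end FusedL

/-! ### Exchange relation of ℒ^{(1/2)} with fused ℒ^{(j)}. -/

section FusedExchange

theorem intertwine {X m n : Type*} [Ring X] [Fintype m] [Fintype n] {e : Matrix m n X}
    {a b : Matrix n n X} {a' b' : Matrix m m X} (ha : e * a = a' * e) (hb : e * b = b' * e) :
    e * (a * b) = a' * b' * e := by
  rw [← Matrix.mul_assoc, ha, Matrix.mul_assoc, hb, Matrix.mul_assoc]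

theorem exchange_of_factors {M : Type*} [Ring M] {a b c r r' : M} (h1 : a * r * b = b * r * a)
    (h2 : a * r' * c = c * r' * a) (h3 : r' * b = b * r') (h4 : r * c = c * r) :
    a * (r * r') * (b * c) = b * c * (r * r') * a := by
  calc a * (r * r') * (b * c) = a * r * (r' * b) * c := by simp only [mul_assoc]
    _ = a * r * b * r' * c := by rw [h3]; simp only [mul_assoc]
    _ = b * r * (a * r' * c) := by rw [h1]; simp only [mul_assoc]
    _ = b * (r * c) * r' * a := by rw [h2]; simp only [mul_assoc]
    _ = b * c * (r * r') * a := by rw [h4]; simp only [mul_assoc]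

variable {s : ℂ} (hs : s ≠ 0) (hq : ∀ n : ℕ, 0 < n → (s ^ 2) ^ n ≠ 1)
  {B : Type*} [Ring B] [Algebra ℂ B] {k : Type*} [Field k] [Algebra ℂ k]
  {θ : k →+* B} (hθ : ∀ c, θ (algebraMap ℂ k c) = algebraMap ℂ B c)
  (hθc : ∀ z, θ z ∈ Subring.center B)

theorem LEval.map_algebraMap {φ : HahnSeries ℤ (Uq s) →+* B} {ι : Uq s →ₐ[ℂ] B}
    {x x' : Subring.center B} (h : LEval φ ι x x') (c : ℂ) :
    φ (algebraMap ℂ (HahnSeries ℤ (Uq s)) c) = algebraMap ℂ B c := by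
  rw [algebraMap_eq_single, h.map_zero, AlgHom.commutes]

include hs hq hθ hθc

/-- `ℒ₁^{(1/2)}(x) R^{(1/2,j)}(xy) ℒ₂^{(j)}(y) = ℒ₂^{(j)}(y) R^{(1/2,j)}(xy) ℒ₁^{(1/2)}(x)`. -/
theorem lHalf_rMat_fusedL {φ ψ : HahnSeries ℤ (Uq s) →+* B} {ι : Uq s →ₐ[ℂ] B}
    {x x' y y' : Subring.center B} (hφ : LEval φ ι x x') (hψ : LEval ψ ι y y') {t : k}
    (ht : t ≠ 0) (hz : θ t = (x * y : Subring.center B)) (hz' : θ t⁻¹ = (x' * y' : Subring.center B))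
    (N : ℕ) (hN : 1 ≤ N) :
    aLeg (Fin (N + 1)) ((lHalf s).map φ) * (rMat s N t).map θ * vLeg ((fusedL s N).map ψ) =
      vLeg ((fusedL s N).map ψ) * (rMat s N t).map θ * aLeg (Fin (N + 1)) ((lHalf s).map φ) := by
  have hω := qSq_sub_ne hs hq
  induction N, hN using Nat.le_induction generalizing ψ y y' t with
  | base =>
    rw [rMat_one_map hω θ hθ hz hz']
    exact lrl hs hω hφ hψ
  | succ N hN ih =>
    have hsN : s ^ (-(N : ℤ)) ≠ 0 := zpow_ne_zero _ hs
    have hψb := hψ.comp_shift hsN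
    have hψc := hψ.comp_shift hs
    have key : ∀ (c : ℂ) (hc : c ≠ 0), θ (algebraMap ℂ k c * t) =
        (x * (cst B c * y) : Subring.center B) ∧ θ (algebraMap ℂ k c * t)⁻¹ =
        (x' * (cst B c⁻¹ * y') : Subring.center B) := by
      intro c hc
      rw [mul_left_comm x, mul_left_comm x', mul_inv, ← map_inv₀, map_mul, map_mul, hθ, hθ, hz, hz']
      exact ⟨rfl, rfl⟩
    have hsub : ∀ c : ℂ, c ≠ 0 → algebraMap ℂ k c * t ≠ 0 := fun c hc =>
      mul_ne_zero ((map_ne_zero _).2 hc) ht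
    have h1 := lrl hs hω hφ hψb
    rw [← rMat_one_map hω θ hθ (key _ hsN).1 (key _ hsN).2] at h1
    have h2 := ih hψc (hsub s hs) (key s hs).1 (key s hs).2
    have h3 := congrArg (fun M => M.map θ) (vLeg_algE_mul_rMat hs hq N hN ht)
    simp only [Matrix.map_mul, vLeg_map, algE_map θ hθ, abLeg_map, acLeg_map] at h3
    have h4 := congrArg (fun M => M.map ψ) (aLeg_lHalf_mul hs hq N)
    simp only [Matrix.map_mul, vLeg_map, aLeg_map, algE_map ψ hψ.map_algebraMap, Matrix.map_map] at h4
    have h5 := congrArg (abLeg (Fin (N + 1))) h1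
    simp only [abLeg_mul, abLeg_aLeg, abLeg_vLeg] at h5
    have h6 := congrArg acLeg h2
    simp only [acLeg_mul, acLeg_aLeg, acLeg_vLeg] at h6
    -- After ℰ is pulled through, both R and ℒ^{(j)} factor over legs b and c; the relation follows
    -- from the exchanges a–b and a–c, since R-entries are central.
    have h7 := exchange_of_factors h5 h6
      (acLeg_comm fun i j v w => (Subring.mem_center_iff.1 (hθc _) _).symm)
      (abLeg_comm fun i j v w => (Subring.mem_center_iff.1 (hθc _) _).symm)
    have hA := aLeg_mul_vLeg_algE s N ((lHalf s).map φ)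
    have hL : vLeg (algE B s N) * vLeg ((fusedL s (N + 1)).map ψ) = _ :=
      (vLeg_mul _ _).symm.trans (congrArg vLeg h4.symm)
    rw [vLeg_mul, vLeg_mul] at hL
    rw [← Matrix.mul_assoc] at h3
    refine vLeg_algE_injective hs hq N ?_
    rw [intertwine (intertwine hA h3) hL, intertwine (intertwine hL h3) hA]
    exact congrArg (· * vLeg (algE B s N)) h7

end FusedExchange

/-! ### Specialization of two-variable series to a line. -/

section Specialization

open Filter

variable {A : Type*} [Ring A] [Algebra ℂ A] {α β : ℂ}

/-- The contribution of `u^{-m} v^{-(l-m)}` to the coefficient of `u^{-l}` of `Z(αu, βu)`. -/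
def specTerm (α β : ℂ) (Z : TwoVar A) (l m : ℤ) : A :=
  (α ^ (-m) * β ^ (-(l - m))) • (Z.coeff m).coeff (l - m)

/-- The series `z(u)` is the specialization `Z(αu, βu)`, all of whose coefficients are finite sums. -/
def IsSpec (α β : ℂ) (Z : TwoVar A) (z : HahnSeries ℤ A) : Prop :=
  ∀ l, ∀ᶠ S : Finset ℤ in atTop, ∑ m ∈ S, specTerm α β Z l m = z.coeff l

variable {Z Z' : TwoVar A} {z z' : HahnSeries ℤ A}

/-- Both sums are eventually constant along the finite subsets of ℤ. Not every two-variable series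
can be specialized, so specialization is treated as a relation closed under the operations that
occur in the reflection equation. -/
theorem IsSpec.unique (h : IsSpec α β Z z) (h' : IsSpec α β Z z') : z = z' := by
  ext l
  obtain ⟨S, h1, h2⟩ := ((h l).and (h' l)).exists
  rw [← h1, h2]

theorem isSpec_zero : IsSpec α β (0 : TwoVar A) 0 := fun l =>
  Eventually.of_forall fun S => by simp [specTerm]

theorem IsSpec.add (h : IsSpec α β Z z) (h' : IsSpec α β Z' z') :
    IsSpec α β (Z + Z') (z + z') := fun l => by
  filter_upwards [h l, h' l] with S h1 h2
  rw [HahnSeries.coeff_add, ← h1, ← h2, ← Finset.sum_add_distrib]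
  refine Finset.sum_congr rfl fun m _ => ?_
  rw [specTerm, HahnSeries.coeff_add, HahnSeries.coeff_add, smul_add]
  rfl

theorem IsSpec.smul (c : ℂ) (h : IsSpec α β Z z) : IsSpec α β (c • Z) (c • z) := fun l => by
  filter_upwards [h l] with S h1
  rw [HahnSeries.coeff_smul, ← h1, Finset.smul_sum]
  refine Finset.sum_congr rfl fun m _ => ?_
  rw [specTerm, HahnSeries.coeff_smul, HahnSeries.coeff_smul, smul_comm]
  rfl

theorem IsSpec.sub (h : IsSpec α β Z z) (h' : IsSpec α β Z' z') :
    IsSpec α β (Z - Z') (z - z') := fun l => by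
  filter_upwards [h l, h' l] with S h1 h2
  rw [HahnSeries.coeff_sub, ← h1, ← h2, ← Finset.sum_sub_distrib]
  refine Finset.sum_congr rfl fun m _ => ?_
  rw [specTerm, HahnSeries.coeff_sub, HahnSeries.coeff_sub, smul_sub]
  rfl

/-- The specialization of the central monomial `u^{-m} v^{-n}`. -/
def specC (A : Type*) [Ring A] [Algebra ℂ A] (α β : ℂ) (m n : ℤ) :
    Subring.center (HahnSeries ℤ A) :=
  ⟨HahnSeries.single (m + n) (algebraMap ℂ A (α ^ (-m) * β ^ (-n))),
    single_mem_center _ (algebraMap_mem_center _)⟩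

theorem IsSpec.uvC_mul (hα : α ≠ 0) (hβ : β ≠ 0) (h : IsSpec α β Z z) (m n : ℤ) :
    IsSpec α β ((uvC A m n : TwoVar A) * Z) ((specC A α β m n : HahnSeries ℤ A) * z) := by
  intro l
  obtain ⟨S₀, h0⟩ := eventually_atTop.1 (h (l - (m + n)))
  -- Multiplication by u^{-m} shifts the summation index by m, and the stabilizing set with it.
  refine eventually_atTop.2 ⟨S₀.map (addRightEmbedding m), fun S hS => ?_⟩
  have h1 : S₀ ≤ S.map (addRightEmbedding (-m)) := by
    intro a ha
    refine Finset.mem_map.2 ⟨a + m, hS (Finset.mem_map.2 ⟨a, ha, rfl⟩), ?_⟩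
    simp [addRightEmbedding]
  have h2 := h0 _ h1
  rw [Finset.sum_map] at h2
  change _ = (HahnSeries.single (m + n) _ * z).coeff l
  rw [HahnSeries.coeff_single_mul, ← h2, Finset.mul_sum]
  refine Finset.sum_congr rfl fun a _ => ?_
  rw [specTerm, specTerm, uvC_mul_coeff, HahnSeries.coeff_single_mul, one_mul,
    ← Algebra.smul_def, smul_smul]
  simp only [addRightEmbedding_apply, ← sub_eq_add_neg]
  rw [show l - (m + n) - (a - m) = l - a - n by ring, mul_mul_mul_comm, ← zpow_add₀ hα,
    ← zpow_add₀ hβ]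
  congr 3
  · ring
  · ring

theorem IsSpec.rDiag_mul {s : ℂ} {y y' : Subring.center (TwoVar A)}
    {x x' : Subring.center (HahnSeries ℤ A)}
    (hy : ∀ {Z z}, IsSpec α β Z z → IsSpec α β ((y : TwoVar A) * Z) ((x : HahnSeries ℤ A) * z))
    (hy' : ∀ {Z z}, IsSpec α β Z z → IsSpec α β ((y' : TwoVar A) * Z) ((x' : HahnSeries ℤ A) * z))
    (h : IsSpec α β Z z) (i j : Fin 2) :
    IsSpec α β (((rDiag (cst _ s) (cst _ s⁻¹) y y' i j : Subring.center (TwoVar A)) : TwoVar A) * Z)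
      (((rDiag (cst _ s) (cst _ s⁻¹) x x' i j : Subring.center (HahnSeries ℤ A)) : HahnSeries ℤ A) * z) := by
  have hc : ∀ {B : Type _} [Ring B] [Algebra ℂ B] (c : ℂ) (Z : B),
      ((cst B c ^ 2 : Subring.center B) : B) * Z = c ^ 2 • Z := by
    intro B _ _ c Z
    rw [sq, cst_mul, cst_coe, ← Algebra.smul_def, sq]
  rw [rDiag, rDiag]
  split_ifs
  · rw [AddSubgroupClass.coe_sub, sub_mul, Subring.coe_mul, Subring.coe_mul, mul_assoc, mul_assoc,
      hc, hc, AddSubgroupClass.coe_sub, sub_mul, Subring.coe_mul, Subring.coe_mul, mul_assoc,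
      mul_assoc, hc, hc]
    exact (hy (h.smul _)).sub (hy' (h.smul _))
  · rw [AddSubgroupClass.coe_sub, sub_mul, AddSubgroupClass.coe_sub, sub_mul]
    exact (hy h).sub (hy' h)

/-- The sum is stable once S contains the first components of the finite antidiagonal. -/
theorem sum_mul_coeff_sub (x y : HahnSeries ℤ A) (l : ℤ) :
    ∀ᶠ S : Finset ℤ in atTop, ∑ m ∈ S, x.coeff m * y.coeff (l - m) = (x * y).coeff l := by
  set D := Finset.antidiagonal x.isPWO_support y.isPWO_support l with hD
  refine eventually_atTop.2 ⟨D.image Prod.fst, fun S hS => ?_⟩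
  rw [HahnSeries.coeff_mul, ← Finset.sum_subset hS]
  · rw [Finset.sum_image]
    · refine Finset.sum_congr rfl fun p hp => ?_
      rw [← (Finset.mem_antidiagonal.1 hp).2.2, add_sub_cancel_left]
    · intro p hp p' hp' e
      have h1 := (Finset.mem_antidiagonal.1 hp).2.2
      have h2 := (Finset.mem_antidiagonal.1 hp').2.2
      exact Prod.ext e (by omega)
  · intro m _ hm
    by_contra h
    refine hm (Finset.mem_image.2 ⟨(m, l - m), Finset.mem_antidiagonal.2
      ⟨left_ne_zero_of_mul h, right_ne_zero_of_mul h, ?_⟩, rfl⟩)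
    exact add_sub_cancel _ _

theorem sum_coeff_sub_mul (x y : HahnSeries ℤ A) (l : ℤ) :
    ∀ᶠ S : Finset ℤ in atTop, ∑ m ∈ S, y.coeff (l - m) * x.coeff m = (y * x).coeff l := by
  set D := Finset.antidiagonal y.isPWO_support x.isPWO_support l with hD
  refine eventually_atTop.2 ⟨D.image Prod.snd, fun S hS => ?_⟩
  rw [HahnSeries.coeff_mul, ← Finset.sum_subset hS]
  · rw [Finset.sum_image]
    · refine Finset.sum_congr rfl fun p hp => ?_
      rw [← (Finset.mem_antidiagonal.1 hp).2.2, add_sub_cancel_right]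
    · intro p hp p' hp' e
      have h1 := (Finset.mem_antidiagonal.1 hp).2.2
      have h2 := (Finset.mem_antidiagonal.1 hp').2.2
      exact Prod.ext (by omega) e
  · intro m _ hm
    by_contra h
    refine hm (Finset.mem_image.2 ⟨(l - m, m), Finset.mem_antidiagonal.2
      ⟨left_ne_zero_of_mul h, right_ne_zero_of_mul h, ?_⟩, rfl⟩)
    exact sub_add_cancel _ _

theorem C_mul_coeff (a : A) (y : HahnSeries ℤ A) (n : ℤ) :
    ((HahnSeries.C a : HahnSeries ℤ A) * y).coeff n = a * y.coeff n :=
  HahnSeries.coeff_single_zero_mul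

theorem mul_C_coeff (a : A) (y : HahnSeries ℤ A) (n : ℤ) :
    (y * (HahnSeries.C a : HahnSeries ℤ A)).coeff n = y.coeff n * a :=
  HahnSeries.coeff_mul_single_zero

theorem isSpec_inU_mul_inV (x y : HahnSeries ℤ A) :
    IsSpec α β (inU x * inV y) (shift α x * shift β y) := fun l => by
  filter_upwards [sum_mul_coeff_sub (shift α x) (shift β y) l] with S hS
  rw [← hS]
  refine Finset.sum_congr rfl fun m _ => ?_
  rw [specTerm, inU_mul_inV_coeff, C_mul_coeff]
  exact (smul_mul_smul_comm _ _ _ _).symm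

theorem isSpec_inV_mul_inU (x y : HahnSeries ℤ A) :
    IsSpec α β (inV y * inU x) (shift β y * shift α x) := fun l => by
  filter_upwards [sum_coeff_sub_mul (shift α x) (shift β y) l] with S hS
  rw [← hS]
  refine Finset.sum_congr rfl fun m _ => ?_
  rw [specTerm, inV_mul_inU_coeff, mul_C_coeff, mul_comm (α ^ _)]
  exact (smul_mul_smul_comm _ _ _ _).symm

theorem isSpec_krk (hα : α ≠ 0) (hβ : β ≠ 0) (s : ℂ)
    (K : Matrix (Fin 2) (Fin 2) (HahnSeries ℤ A)) (i j m l : Fin 2) :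
    IsSpec α β (krk s K i j m l) ((aLeg (Fin 2) (K.map (shift α)) *
      (rGen (cst _ s) (cst _ s⁻¹) (specC A α β (-1) (-1)) (specC A α β 1 1)).map
        (Subring.center _).subtype * vLeg (K.map (shift β))) (i, j) (m, l)) := by
  rw [aLeg_rGen_vLeg_apply, krk]
  refine IsSpec.add ((isSpec_inU_mul_inV _ _).rDiag_mul (fun h => h.uvC_mul hα hβ _ _)
    (fun h => h.uvC_mul hα hβ _ _) _ _) ?_
  split_ifs
  · rw [omega_smul]
    exact (isSpec_inU_mul_inV _ _).smul _
  · exact isSpec_zero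

/-- Only the existence of a value matters: these terms cancel in the symmetry argument. -/
theorem exists_isSpec_krk' (hα : α ≠ 0) (hβ : β ≠ 0) (s : ℂ)
    (K : Matrix (Fin 2) (Fin 2) (HahnSeries ℤ A)) (i j m l : Fin 2) :
    ∃ z, IsSpec α β (krk' s K i j m l) z := by
  refine ⟨_, IsSpec.add ((isSpec_inV_mul_inU _ _).rDiag_mul (fun h => h.uvC_mul hα hβ _ _)
    (fun h => h.uvC_mul hα hβ _ _) _ _) (z' := if i = l then (s ^ 2 - (s ^ 2)⁻¹) •
      (shift β (K j (i + 1)) * shift α (K (i + 1) m)) else 0) ?_⟩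
  split_ifs
  · exact (isSpec_inV_mul_inU _ _).smul _
  · exact isSpec_zero

/-- At `u/v = q⁻¹` the operator `R(u/v)` becomes proportional to the antisymmetrizer. -/
theorem IsSpec.rDiag_uv_mul {s : ℂ} (hs : s ≠ 0) (hα : α ≠ 0) (h : IsSpec α (α * s ^ 2) Z z)
    (i j : Fin 2) :
    IsSpec α (α * s ^ 2)
      (((rDiag (cst _ s) (cst _ s⁻¹) (uvC A (-1) 1) (uvC A 1 (-1)) i j : Subring.center (TwoVar A)) :
        TwoVar A) * Z)
      (if i = j then 0 else -(s ^ 2 - (s ^ 2)⁻¹) • z) := by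
  have hs2 : s ^ 2 ≠ 0 := pow_ne_zero _ hs
  have hβ := mul_ne_zero hα hs2
  have e := h.rDiag_mul (s := s) (fun h => h.uvC_mul hα hβ (-1) 1) (fun h => h.uvC_mul hα hβ 1 (-1)) i j
  have e1 : specC A α (α * s ^ 2) (-1) 1 = cst _ s⁻¹ ^ 2 := by
    rw [sq (cst _ _), cst_mul]
    refine Subtype.ext ?_
    rw [cst_coe, algebraMap_eq_single]
    change HahnSeries.single 0 (algebraMap ℂ A _) = _
    congr 2
    simp
    field_simp
  have e2 : specC A α (α * s ^ 2) 1 (-1) = cst _ s ^ 2 := by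
    rw [sq (cst _ _), cst_mul]
    refine Subtype.ext ?_
    rw [cst_coe, algebraMap_eq_single]
    change HahnSeries.single 0 (algebraMap ℂ A _) = _
    congr 2
    simp
    field_simp
  convert e using 1
  rw [e1, e2, rDiag]
  split_ifs
  · rw [mul_comm, sub_self]
    simp
  · rw [neg_smul, ← omega_smul, center_smul_def, ← neg_mul, ← NegMemClass.coe_neg, neg_sub]

end Specialization

/-! ### The reflection equation at u/v = q⁻¹. -/

section Symmetry

variable {A : Type*} [Ring A] [Algebra ℂ A] {s : ℂ}

theorem smul_uVar_sq (c : ℂ) : c • uVar ℂ ^ 2 = (HahnSeries.single (-2) c : HahnSeries ℤ ℂ) := by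
  rw [uVar, sq, HahnSeries.single_mul_single, mul_one]
  ext n
  rw [HahnSeries.coeff_smul, HahnSeries.coeff_single, HahnSeries.coeff_single]
  split_ifs <;> simp_all

theorem rMat_one_scal (hω : s ^ 2 - (s ^ 2)⁻¹ ≠ 0) {α β : ℂ} (hα : α ≠ 0) (hβ : β ≠ 0) :
    (rMat s 1 ((α * β) • uVar ℂ ^ 2)).map (scal A) =
      (rGen (cst _ s) (cst _ s⁻¹) (specC A α β (-1) (-1)) (specC A α β 1 1)).map
        (Subring.center _).subtype := by
  have hti : (HahnSeries.single (-2) (α * β) : HahnSeries ℤ ℂ)⁻¹ = HahnSeries.single 2 (α * β)⁻¹ := by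
    symm
    refine eq_inv_of_mul_eq_one_left ?_
    rw [HahnSeries.single_mul_single, inv_mul_cancel₀ (mul_ne_zero hα hβ)]
    rfl
  refine rMat_one_map hω (scalHom A) scal_algebraMap ?_ ?_
  · rw [smul_uVar_sq, scalHom_apply]
    refine (coeffMap_single _ _ _).trans ?_
    simp [specC]
  · rw [smul_uVar_sq, hti, scalHom_apply]
    refine (coeffMap_single _ _ _).trans ?_
    simp [specC, mul_comm]

/-- `𝒦₁(u) R(qu²) 𝒦₂(qu)` preserves symmetric tensors. -/
theorem symPres_kRk (hs : s ≠ 0) (hω : s ^ 2 - (s ^ 2)⁻¹ ≠ 0)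
    {K : Matrix (Fin 2) (Fin 2) (HahnSeries ℤ A)} (hK : reLHS s K = reRHS s K)
    (V : Type*) [Fintype V] [DecidableEq V] {α : ℂ} (hα : α ≠ 0) :
    SymPres (abLeg V (aLeg (Fin 2) (K.map (shift α)) *
      (rMat s 1 ((α * (α * s ^ 2)) • uVar ℂ ^ 2)).map (scal A) *
      vLeg (K.map (shift (α * s ^ 2))))) := by
  have hβ : α * s ^ 2 ≠ 0 := mul_ne_zero hα (pow_ne_zero _ hs)
  rw [rMat_one_scal hω hα hβ]
  have hT := isSpec_krk hα hβ s K
  choose T' hT' using exists_isSpec_krk' hα hβ s K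
  set T := (aLeg (Fin 2) (K.map (shift α)) *
      (rGen (cst _ s) (cst _ s⁻¹) (specC A α (α * s ^ 2) (-1) (-1)) (specC A α (α * s ^ 2) 1 1)).map
        (Subring.center _).subtype * vLeg (K.map (shift (α * s ^ 2)))) with hTd
  -- Row (↑,↓) of the specialized equation: R(q⁻¹) takes the difference of rows (↑,↓) and (↓,↑) of T
  -- on the left, and of columns (m,l) and (l,m) of T' on the right.
  have key : ∀ m l, -(s ^ 2 - (s ^ 2)⁻¹) • T (0, 1) (m, l) + (s ^ 2 - (s ^ 2)⁻¹) • T (1, 0) (m, l) =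
      (if m = l then 0 else -(s ^ 2 - (s ^ 2)⁻¹) • T' 0 1 m l) +
      (if m = l then 0 else (s ^ 2 - (s ^ 2)⁻¹) • T' 0 1 l m) := by
    intro m l
    have h1 := ((hT 0 1 m l).rDiag_uv_mul hs hα 0 1).add ((hT 1 0 m l).smul (s ^ 2 - (s ^ 2)⁻¹))
    have h2 : IsSpec α (α * s ^ 2) (reRHS s K (0, 1) (m, l))
        ((if m = l then 0 else -(s ^ 2 - (s ^ 2)⁻¹) • T' 0 1 m l) +
          (if m = l then 0 else (s ^ 2 - (s ^ 2)⁻¹) • T' 0 1 l m)) := by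
      rw [reRHS_apply hω]
      refine ((hT' 0 1 m l).rDiag_uv_mul hs hα m l).add
        (z' := if m = l then 0 else (s ^ 2 - (s ^ 2)⁻¹) • T' 0 1 l m) ?_
      split_ifs
      · exact isSpec_zero
      · exact (hT' 0 1 l m).smul _
    refine IsSpec.unique ?_ h2
    rw [← hK, reLHS_apply hω]
    exact h1
  have cancel : ∀ x y : HahnSeries ℤ A,
      -(s ^ 2 - (s ^ 2)⁻¹) • x + (s ^ 2 - (s ^ 2)⁻¹) • y = 0 → x = y := by
    intro x y h
    refine smul_right_injective _ hω ?_
    change (s ^ 2 - (s ^ 2)⁻¹) • x = (s ^ 2 - (s ^ 2)⁻¹) • y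
    rw [neg_smul, neg_add_eq_zero] at h
    exact h
  refine symPres_abLeg (cancel _ _ ?_) (cancel _ _ ?_) (cancel _ _ ?_)
  · rw [key]; simp
  · rw [key]; simp
  -- The right side is antisymmetric in (m,l), so it disappears from the sum of the two columns.
  · have k1 := key 0 1
    have k2 := key 1 0
    simp only [zero_ne_one, one_ne_zero, if_false] at k1 k2
    rw [smul_add, smul_add, add_add_add_comm, k1, k2]
    module

end Symmetry

/-! ### The fusion recursion of 𝒦^{(j)} without projection. -/

section FusedK

theorem algebraMap_mul_single (c d : ℂ) (n : ℤ) :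
    algebraMap ℂ (HahnSeries ℤ ℂ) c * HahnSeries.single n d = HahnSeries.single n (c * d) := by
  rw [algebraMap_laurent, HahnSeries.single_mul_single, zero_add]

theorem rMat_map {k k' : Type*} [Field k] [Algebra ℂ k] [Field k'] [Algebra ℂ k'] (f : k →+* k')
    (hf : ∀ c, f (algebraMap ℂ k c) = algebraMap ℂ k' c) (s : ℂ) (N : ℕ) (t : k) :
    (rMat s N t).map f = rMat s N (f t) := by
  have hc : ∀ (c : ℂ), f (cFun (algebraMap ℂ k c * t)) = cFun (algebraMap ℂ k' c * f t) := by
    intro c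
    rw [cFun, cFun, map_sub, map_inv₀, map_mul, hf]
  have hr : ∀ i c m c', f (rEnt s N t i c m c') = rEnt s N (f t) i c m c' := by
    intro i c m c'
    unfold rEnt
    split_ifs <;> first | exact hc _ | exact hf _ | exact map_zero f
  rw [rMat_eq, rMat_eq, map_smul_matrix, map_prod]
  congr 1
  · exact Finset.prod_congr rfl fun i _ => hc _
  · ext1 x y
    exact hr _ _ _ _

variable {A : Type*} [Ring A] [Algebra ℂ A]

theorem rMat_scal_map_shift {a : ℂ} (ha : a ≠ 0) (s : ℂ) (N : ℕ) (t : HahnSeries ℤ ℂ) :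
    ((rMat s N t).map (scalHom A)).map (shift a) = (rMat s N (shift a t)).map (scalHom A) := by
  have h : (rMat s N t).map (shift a) = rMat s N (shift a t) :=
    rMat_map (shiftHom ha) (fun c => shift_algebraMap_laurent a c) s N t
  rw [← h]
  ext1 i j
  exact shift_scal a _

/-- The unprojected right-hand side of the fusion recursion for the K-operators. -/
def kStep (s : ℂ) (K : Matrix (Fin 2) (Fin 2) (HahnSeries ℤ A)) (N : ℕ) :
    Matrix (Fin 2 × Fin (N + 1)) (Fin 2 × Fin (N + 1)) (HahnSeries ℤ A) :=
  aLeg (Fin (N + 1)) (K.map (shift (s ^ (-(N : ℤ))))) *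
    (rMat s N (HahnSeries.single (-2) (s ^ (1 - (N : ℤ))))).map (scalHom A) *
    vLeg ((fusedK s K N).map (shift s))

theorem fusedK_succ (s : ℂ) (K : Matrix (Fin 2) (Fin 2) (HahnSeries ℤ A)) {N : ℕ} (hN : 1 ≤ N) :
    fusedK s K (N + 1) = algF (HahnSeries ℤ A) s N * (kStep s K N * algE (HahnSeries ℤ A) s N) := by
  obtain ⟨M, rfl⟩ : ∃ M, N = M + 1 := ⟨N - 1, by omega⟩
  rw [fusedK, constMat_fusE, constMat_fusF, leg1_eq, leg2_eq, smul_uVar_sq, kStep,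
    Nat.cast_succ]
  simp only [Matrix.mul_assoc]
  rfl

theorem vLeg_algE_zero_mul {X : Type*} [Ring X] [Algebra ℂ X] {s : ℂ} (hs : s ≠ 0)
    (hq : ∀ n : ℕ, 0 < n → (s ^ 2) ^ n ≠ 1) (T : Matrix (Fin 2 × Fin 2) (Fin 2 × Fin 2) X) :
    vLeg (algE X s 0) * T = abLeg (Fin 1) T * vLeg (algE X s 0) := by
  have h1 : eLow s 0 0 = 1 := by
    rw [eLow, eDiag_zero, bCoef_one_zero hs hq, zero_add, qNum_one hs hq, mul_one, div_one]
  have hE : ∀ (i : Fin 2) (c : Fin 1) (j : Fin 2), algE X s 0 (i, c) j = if i = j then 1 else 0 := by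
    intro i c j
    obtain rfl : c = 0 := Subsingleton.elim _ _
    fin_cases i <;> fin_cases j <;> simp [algE, fusE, h1, eDiag_zero]
  ext ⟨i, j, c⟩ ⟨m, l⟩
  obtain rfl : c = 0 := Subsingleton.elim (α := Fin 1) _ _
  simp only [Matrix.mul_apply, Fintype.sum_prod_type, vLeg_apply, abLeg_apply, hE]
  simp

variable {s : ℂ} (hs : s ≠ 0) (hq : ∀ n : ℕ, 0 < n → (s ^ 2) ^ n ≠ 1)
  {K : Matrix (Fin 2) (Fin 2) (HahnSeries ℤ A)} (hK : reLHS s K = reRHS s K)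
include hs hq hK

/-- Let a, b be the two spin-1/2 legs and c the remaining one. After ℰ is applied in the second leg
the product becomes 𝒦_a (R_ab R_ac)(𝒦_b R_bc 𝒦_c). As R_ac commutes with 𝒦_b this is (𝒦_a R_ab
𝒦_b)(R_ac R_bc) 𝒦_c. Each of the three groups preserves symmetry in a, b: by the reflection
equation, by `symPres_rMat`, and trivially. -/
theorem algE_mul_fusedK {N : ℕ} (hN : 1 ≤ N) :
    algE (HahnSeries ℤ A) s N * fusedK s K (N + 1) = kStep s K N * algE (HahnSeries ℤ A) s N := by
  have hω := qSq_sub_ne hs hq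
  have hR : ∀ a : ℤ, (HahnSeries.single (-2) (s ^ a) : HahnSeries ℤ ℂ) ≠ 0 := fun a =>
    HahnSeries.single_ne_zero (zpow_ne_zero _ hs)
  induction N, hN using Nat.le_induction with
  | base =>
    rw [fusedK_succ s K le_rfl]
    refine InImage.algE_algF_mul hs hq ((swapInv_vLeg_algE_iff hs hq 0 _).1 ?_)
    rw [← Matrix.mul_assoc, vLeg_algE_zero_mul hs hq, Matrix.mul_assoc]
    have h := symPres_kRk hs hω hK (Fin 1) (inv_ne_zero hs)
    rw [smul_uVar_sq] at h
    have e1 : s⁻¹ * s ^ 2 = s := by field_simp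
    rw [e1, inv_mul_cancel₀ hs] at h
    have e2 : kStep s K 1 = aLeg (Fin 2) (K.map (shift s⁻¹)) *
        (rMat s 1 (HahnSeries.single (-2) (1 : ℂ))).map (scal A) * vLeg (K.map (shift s)) := by
      rw [kStep, Nat.cast_one, sub_self, zpow_zero, zpow_neg_one]
      rfl
    rw [e2]
    exact h.mul (swapInv_vLeg_algE_mul_algE hs hq 0)
  | succ N hN ih =>
    rw [fusedK_succ s K (by omega)]
    refine InImage.algE_algF_mul hs hq ((swapInv_vLeg_algE_iff hs hq N _).1 ?_)
    have hA := aLeg_mul_vLeg_algE s N (K.map (shift (s ^ (-((N + 1 : ℕ) : ℤ)))))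
    have h3 := congrArg (fun M => M.map (scalHom A))
      (vLeg_algE_mul_rMat hs hq N hN (hR (1 - ((N + 1 : ℕ) : ℤ))))
    simp only [Matrix.map_mul, vLeg_map, algE_map (scalHom A) scal_algebraMap, abLeg_map, acLeg_map,
      algebraMap_mul_single] at h3
    rw [← Matrix.mul_assoc] at h3
    have h4 := congrArg (fun M => M.map (shift s)) ih
    simp only [kStep, map_shift_mul hs, vLeg_map_shift hs, aLeg_map_shift hs, algE_map_shift hs,
      map_shift_map_shift, rMat_scal_map_shift hs, shift_single] at h4
    have hL : vLeg (algE (HahnSeries ℤ A) s N) * vLeg ((fusedK s K (N + 1)).map (shift s)) = _ :=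
      (vLeg_mul _ _).symm.trans (congrArg vLeg h4)
    rw [vLeg_mul, vLeg_mul, vLeg_mul] at hL
    have hT := symPres_kRk hs hω hK (Fin (N + 1)) (zpow_ne_zero (-((N + 1 : ℕ) : ℤ)) hs)
    rw [smul_uVar_sq, abLeg_mul, abLeg_mul, abLeg_aLeg, abLeg_vLeg] at hT
    have hS := (symPres_rMat hs hq N (hR (1 - N))).map (scalHom A)
    rw [Matrix.map_mul, acLeg_map, vLeg_map, algebraMap_mul_single] at hS
    have e1 : s ^ (-((N + 1 : ℕ) : ℤ)) * s ^ 2 = s ^ (-(N : ℤ)) * s := by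
      rw [← zpow_natCast, ← zpow_add₀ hs, ← zpow_add_one₀ hs]
      congr 1
      push_cast
      ring
    have e2 : s ^ (-(N : ℤ)) * s ^ (1 - ((N + 1 : ℕ) : ℤ)) =
        s ^ (-((N + 1 : ℕ) : ℤ)) * (s ^ (-(N : ℤ)) * s) := by
      rw [← zpow_add_one₀ hs, ← zpow_add₀ hs, ← zpow_add₀ hs]
      congr 1
      push_cast
      ring
    have e3 : s * s ^ (1 - ((N + 1 : ℕ) : ℤ)) = s ^ (1 - (N : ℤ)) := by
      rw [← zpow_one_add₀ hs]
      congr 1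
      push_cast
      ring
    have e4 : s ^ (- -2 : ℤ) • s ^ (1 - (N : ℤ)) = s ^ 2 * s ^ (1 - (N : ℤ)) := by
      rw [smul_eq_mul, neg_neg]
      norm_cast
    rw [e1] at hT
    rw [e2, e3] at h3
    rw [e4] at hL
    rw [← Matrix.mul_assoc, kStep, intertwine (intertwine hA h3) hL, Matrix.mul_assoc]
    -- The commutation of R_ac with 𝒦_b.
    have hc := acLeg_comm (T := (rMat s N (HahnSeries.single (-2) (s ^ (1 - (N : ℤ))))).map
      (scalHom A)) (M := K.map (shift (s ^ (-(N : ℤ)) * s)))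
      (fun i j v w => (Subring.mem_center_iff.1 (scal_mem_center _) _).symm)
    have h := hT.mul (hS.mul ((swapInv_vLeg_algE_mul_algE (B := HahnSeries ℤ A) hs hq N).vLeg_vLeg_mul
      ((fusedK s K N).map (shift (s * s)))))
    refine Eq.mp (congrArg SwapInv ?_) h
    simp only [← Matrix.mul_assoc]
    rw [Matrix.mul_assoc _ (vLeg (aLeg _ _)) (acLeg _), ← hc]
    simp only [Matrix.mul_assoc]
    rfl

end FusedK

/-! ### Dressing of the fused K-operators. -/

section FusedCoaction

variable {s kp km : ℂ}

/-- The shift by q^{1/2} reproduces the factors p ≤ N; the factor p = N + 1 has exponent −N and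
belongs to 𝒦^{(1/2)}(u q^{-j}). -/
theorem prefactor_succ (hs : s ≠ 0) (N : ℕ) : prefactor s (N + 1) =
    shift (s ^ (-(N : ℤ))) (prefactor s 1) * shift s (prefactor s N) := by
  have h : shift s (prefactor s N) = ∏ p ∈ Finset.Icc 1 N, shift (s ^ (((N + 1 : ℕ) : ℤ) + 1 - 2 * p))
      ((s ^ 2 + (s ^ 2)⁻¹)⁻¹ • (uCap s)⁻¹) := by
    rw [prefactor, ← shiftHom_apply hs, map_prod]
    refine Finset.prod_congr rfl fun p _ => ?_
    rw [shiftHom_apply, shift_shift, ← zpow_add_one₀ hs]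
    congr 2
    push_cast
    ring_nf
  rw [h, prefactor, Finset.prod_Icc_succ_top (by omega), mul_comm]
  congr 1
  rw [prefactor, Finset.Icc_self, Finset.prod_singleton, shift_shift, ← zpow_add₀ hs]
  congr 2
  push_cast
  ring_nf

theorem single_neg_two_inv {c : ℂ} (hc : c ≠ 0) :
    (HahnSeries.single (-2) c : HahnSeries ℤ ℂ)⁻¹ = HahnSeries.single 2 c⁻¹ := by
  symm
  refine eq_inv_of_mul_eq_one_left ?_
  rw [HahnSeries.single_mul_single, inv_mul_cancel₀ hc]
  rfl

theorem second_shift (e : ℤ) (a : ℂ) (x : HahnSeries ℤ (Uq s)) :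
    second s kp km e (shift a x) = shift a (second s kp km e x) := by
  ext n
  change (1 : Aq s kp km) ⊗ₜ[ℂ] (LaurentPolynomial.C (a ^ (-n) • x.coeff n) * _) =
    a ^ (-n) • ((1 : Aq s kp km) ⊗ₜ[ℂ] (LaurentPolynomial.C (x.coeff n) * _))
  rw [← TensorProduct.tmul_smul, ← smul_mul_assoc, Algebra.smul_def (a ^ (-n)) (x.coeff n), map_mul,
    Algebra.smul_def (a ^ (-n)) (LaurentPolynomial.C (x.coeff n)), LaurentPolynomial.algebraMap_apply]

theorem map_mapHom_map_shift {A B m n : Type*} [Ring A] [Algebra ℂ A] [Ring B] [Algebra ℂ B]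
    (f : A →ₐ[ℂ] B) (a : ℂ) (M : Matrix m n (HahnSeries ℤ A)) :
    (M.map (shift a)).map (mapHom f) = (M.map (mapHom f)).map (shift a) := by
  ext1 i j
  exact mapCoeff_shift f a _

theorem mapHom_algebraMap {A B : Type*} [Ring A] [Algebra ℂ A] [Ring B] [Algebra ℂ B]
    (f : A →ₐ[ℂ] B) (c : ℂ) : mapHom f (algebraMap ℂ (HahnSeries ℤ A) c) =
      algebraMap ℂ (HahnSeries ℤ B) c := by
  rw [← scal_algebraMap, mapHom_apply, mapCoeff_scal, scal_algebraMap]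

theorem kStep_map {A B : Type*} [Ring A] [Algebra ℂ A] [Ring B] [Algebra ℂ B]
    (f : A →ₐ[ℂ] B) (K : Matrix (Fin 2) (Fin 2) (HahnSeries ℤ A)) (N : ℕ) :
    (kStep s K N).map (mapHom f) =
      aLeg (Fin (N + 1)) ((K.map (mapHom f)).map (shift (s ^ (-(N : ℤ))))) *
      (rMat s N (HahnSeries.single (-2) (s ^ (1 - (N : ℤ))))).map (scalHom B) *
      vLeg (((fusedK s K N).map (mapHom f)).map (shift s)) := by
  have h : ((rMat s N (HahnSeries.single (-2) (s ^ (1 - (N : ℤ))))).map (scalHom A)).map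
      (mapHom f) = (rMat s N (HahnSeries.single (-2) (s ^ (1 - (N : ℤ))))).map (scalHom B) := by
    ext1 i j
    exact mapCoeff_scal f _
  rw [kStep, Matrix.map_mul, Matrix.map_mul, aLeg_map, vLeg_map, h, map_mapHom_map_shift,
    map_mapHom_map_shift]

theorem map_shift_scal_smul {B m n : Type*} [Ring B] [Algebra ℂ B] {a : ℂ} (ha : a ≠ 0)
    (p : HahnSeries ℤ ℂ) (M : Matrix m n (HahnSeries ℤ B)) :
    (scal B p • M).map (shift a) = scal B (shift a p) • M.map (shift a) := by
  rw [← shift_scal]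
  ext1 i j
  exact map_mul (shiftHom ha) _ _

theorem scalHom_single {A : Type*} [Ring A] [Algebra ℂ A] (n : ℤ) (c : ℂ) :
    scalHom A (HahnSeries.single n c) = HahnSeries.single n (algebraMap ℂ A c) :=
  coeffMap_single _ _ _

/-- Fusion of dressed operators. -/
theorem algF_dressed_algE {Y : Type*} [Ring Y] [Algebra ℂ Y] (hs : s ≠ 0)
    (hq : ∀ n : ℕ, 0 < n → (s ^ 2) ^ n ≠ 1) {N : ℕ} {a₁ b₁ k₁ : Matrix (Fin 2) (Fin 2) Y}
    {a b k : Matrix (Fin (N + 1)) (Fin (N + 1)) Y}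
    {r : Matrix (Fin 2 × Fin (N + 1)) (Fin 2 × Fin (N + 1)) Y}
    {a' b' k' : Matrix (Fin (N + 2)) (Fin (N + 2)) Y}
    (h : aLeg (Fin (N + 1)) b₁ * r * vLeg a = vLeg a * r * aLeg (Fin (N + 1)) b₁)
    (c₁ : aLeg (Fin (N + 1)) k₁ * vLeg a = vLeg a * aLeg (Fin (N + 1)) k₁)
    (c₂ : aLeg (Fin (N + 1)) b₁ * vLeg k = vLeg k * aLeg (Fin (N + 1)) b₁)
    (ha : aLeg (Fin (N + 1)) a₁ * vLeg a * algE Y s N = algE Y s N * a')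
    (hb : aLeg (Fin (N + 1)) b₁ * vLeg b * algE Y s N = algE Y s N * b')
    (hk : aLeg (Fin (N + 1)) k₁ * r * vLeg k * algE Y s N = algE Y s N * k') :
    algF Y s N * (aLeg (Fin (N + 1)) (a₁ * k₁ * b₁) * r * vLeg (a * k * b) * algE Y s N) =
      a' * k' * b' := by
  have e : aLeg (Fin (N + 1)) (a₁ * k₁ * b₁) * r * vLeg (a * k * b) =
      aLeg (Fin (N + 1)) a₁ * vLeg a * (aLeg (Fin (N + 1)) k₁ * r * vLeg k) *
        (aLeg (Fin (N + 1)) b₁ * vLeg b) := by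
    rw [aLeg_mul, aLeg_mul, vLeg_mul, vLeg_mul]
    calc aLeg (Fin (N + 1)) a₁ * aLeg (Fin (N + 1)) k₁ * aLeg (Fin (N + 1)) b₁ * r *
          (vLeg a * vLeg k * vLeg b)
        = aLeg (Fin (N + 1)) a₁ * aLeg (Fin (N + 1)) k₁ * (aLeg (Fin (N + 1)) b₁ * r * vLeg a) *
          vLeg k * vLeg b := by simp only [mul_assoc]
      _ = aLeg (Fin (N + 1)) a₁ * (aLeg (Fin (N + 1)) k₁ * vLeg a) * r *
          (aLeg (Fin (N + 1)) b₁ * vLeg k) * vLeg b := by rw [h]; simp only [mul_assoc]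
      _ = _ := by rw [c₁, c₂]; simp only [mul_assoc]
  rw [e, Matrix.mul_assoc _ (_ * _) (algE Y s N), hb, ← Matrix.mul_assoc _ (algE Y s N) b',
    Matrix.mul_assoc _ (_ * _) (algE Y s N), hk, ← Matrix.mul_assoc _ (algE Y s N) k', ha]
  simp only [← Matrix.mul_assoc]
  rw [algF_mul_algE hs hq, Matrix.one_mul]

theorem algF_dressed_shift_algE {T : Type*} [Ring T] [Algebra ℂ T] (hs : s ≠ 0)
    (hq : ∀ n : ℕ, 0 < n → (s ^ 2) ^ n ≠ 1) {N : ℕ} {c d : ℂ} (hc : c ≠ 0) (hd : d ≠ 0)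
    (p₁ p : HahnSeries ℤ ℂ) {a₁ b₁ k₁ : Matrix (Fin 2) (Fin 2) (HahnSeries ℤ T)}
    {a b k : Matrix (Fin (N + 1)) (Fin (N + 1)) (HahnSeries ℤ T)}
    {r : Matrix (Fin 2 × Fin (N + 1)) (Fin 2 × Fin (N + 1)) (HahnSeries ℤ T)}
    {a' b' k' : Matrix (Fin (N + 2)) (Fin (N + 2)) (HahnSeries ℤ T)}
    (h : aLeg (Fin (N + 1)) (b₁.map (shift c)) * r * vLeg (a.map (shift d)) =
      vLeg (a.map (shift d)) * r * aLeg (Fin (N + 1)) (b₁.map (shift c)))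
    (c₁ : aLeg (Fin (N + 1)) (k₁.map (shift c)) * vLeg (a.map (shift d)) =
      vLeg (a.map (shift d)) * aLeg (Fin (N + 1)) (k₁.map (shift c)))
    (c₂ : aLeg (Fin (N + 1)) (b₁.map (shift c)) * vLeg (k.map (shift d)) =
      vLeg (k.map (shift d)) * aLeg (Fin (N + 1)) (b₁.map (shift c)))
    (ha : aLeg (Fin (N + 1)) (a₁.map (shift c)) * vLeg (a.map (shift d)) * algE (HahnSeries ℤ T) s N =
      algE (HahnSeries ℤ T) s N * a')
    (hb : aLeg (Fin (N + 1)) (b₁.map (shift c)) * vLeg (b.map (shift d)) * algE (HahnSeries ℤ T) s N =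
      algE (HahnSeries ℤ T) s N * b')
    (hk : aLeg (Fin (N + 1)) (k₁.map (shift c)) * r * vLeg (k.map (shift d)) * algE (HahnSeries ℤ T) s N =
      algE (HahnSeries ℤ T) s N * k') :
    algF (HahnSeries ℤ T) s N * (aLeg (Fin (N + 1)) ((scal T p₁ • (a₁ * k₁ * b₁)).map (shift c)) * r *
        vLeg ((scal T p • (a * k * b)).map (shift d)) * algE (HahnSeries ℤ T) s N) =
      scal T (shift c p₁ * shift d p) • (a' * k' * b') := by
  have hcen := fun p : HahnSeries ℤ ℂ => scal_mem_center (A := T) p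
  rw [map_shift_scal_smul hc, map_shift_scal_smul hd, aLeg_smul, vLeg_smul, mul_smul_matrix (hcen _),
    smul_mul_matrix, smul_mul_matrix, smul_mul_matrix, smul_mul_matrix, mul_smul_matrix (hcen _),
    mul_smul_matrix (hcen _), map_shift_mul hc, map_shift_mul hc, map_shift_mul hd,
    map_shift_mul hd, algF_dressed_algE hs hq h c₁ c₂ ha hb hk, smul_smul, mul_comm (shift c p₁)]
  congr 1
  exact (map_mul (scalHom T) _ _).symm

theorem map_map_shift {X T m n : Type*} [Ring X] [Algebra ℂ X] [Ring T] [Algebra ℂ T]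
    {σ : HahnSeries ℤ X →+* HahnSeries ℤ T} (hσ : ∀ a x, σ (shift a x) = shift a (σ x)) (a : ℂ)
    (M : Matrix m n (HahnSeries ℤ X)) : (M.map (shift a)).map σ = (M.map σ).map (shift a) := by
  ext1 i j
  exact hσ _ _

section

variable (hs : s ≠ 0) (hq : ∀ n : ℕ, 0 < n → (s ^ 2) ^ n ≠ 1)
  {T : Type*} [Ring T] [Algebra ℂ T] {σ τ : HahnSeries ℤ (Uq s) →+* HahnSeries ℤ T}
  (hσ : ∀ a x, σ (shift a x) = shift a (σ x)) (hτ : ∀ a x, τ (shift a x) = shift a (τ x))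
  {ι : Uq s →ₐ[ℂ] HahnSeries ℤ T} {x x' y y' : Subring.center (HahnSeries ℤ T)}
  (hx : LEval σ ι x x') (hy : LEval τ ι y y')
include hs hq hσ hx

theorem aLeg_lHalf_mul_map (N : ℕ) :
    aLeg (Fin (N + 1)) (((lHalf s).map σ).map (shift (s ^ (-(N : ℤ))))) *
        vLeg (((fusedL s N).map σ).map (shift s)) * algE (HahnSeries ℤ T) s N =
      algE (HahnSeries ℤ T) s N * (fusedL s (N + 1)).map σ := by
  have h := congrArg (fun M => M.map σ) (aLeg_lHalf_mul hs hq N)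
  have hE := algE_map σ hx.map_algebraMap s N
  simp only [Matrix.map_mul, aLeg_map, vLeg_map, map_map_shift hσ, hE] at h
  exact h

include hτ hy

/-- The two evaluation points multiply to u², as (uw)(u/w) does, so the R-matrix of the exchange
relation is the scalar one of the 𝒦-recursion. -/
theorem lHalf_rMat_fusedL_map (hxy : (y * x : HahnSeries ℤ T) = HahnSeries.single (-2) 1)
    (hxy' : (y' * x' : HahnSeries ℤ T) = HahnSeries.single 2 1) {N : ℕ} (hN : 1 ≤ N) :
    aLeg (Fin (N + 1)) (((lHalf s).map τ).map (shift (s ^ (-(N : ℤ))))) *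
      (rMat s N (HahnSeries.single (-2) (s ^ (1 - (N : ℤ))))).map (scalHom T) *
      vLeg (((fusedL s N).map σ).map (shift s)) =
    vLeg (((fusedL s N).map σ).map (shift s)) *
      (rMat s N (HahnSeries.single (-2) (s ^ (1 - (N : ℤ))))).map (scalHom T) *
      aLeg (Fin (N + 1)) (((lHalf s).map τ).map (shift (s ^ (-(N : ℤ))))) := by
  have hsN : s ^ (-(N : ℤ)) ≠ 0 := zpow_ne_zero _ hs
  have e : s ^ (-(N : ℤ)) * s = s ^ (1 - (N : ℤ)) := by
    rw [← zpow_add_one₀ hs, neg_add_eq_sub]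
  have h := lHalf_rMat_fusedL hs hq (t := HahnSeries.single (-2) (s ^ (1 - (N : ℤ))))
    (θ := scalHom T) scal_algebraMap
    scal_mem_center (hy.comp_shift hsN) (hx.comp_shift hs)
    (HahnSeries.single_ne_zero (zpow_ne_zero (1 - (N : ℤ)) hs)) ?_ ?_ N hN
  · rw [← map_map_shift hτ, ← map_map_shift hσ]
    exact h
  · rw [mul_mul_mul_comm, cst_mul, Subring.coe_mul, Subring.coe_mul, hxy, cst_coe, e,
      algebraMap_eq_single, HahnSeries.single_mul_single, zero_add, mul_one, scalHom_single]
  · rw [mul_mul_mul_comm, cst_mul, Subring.coe_mul, Subring.coe_mul, hxy', cst_coe, ← mul_inv, e,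
      algebraMap_eq_single, HahnSeries.single_mul_single, zero_add, mul_one,
      single_neg_two_inv (zpow_ne_zero _ hs), scalHom_single]

/-- A dressing formula for the fundamental K-operator extends to the fused K-operators. -/
theorem map_fusedK {A : Type*} [Ring A] [Algebra ℂ A]
    (hxy : (y * x : HahnSeries ℤ T) = HahnSeries.single (-2) 1)
    (hxy' : (y' * x' : HahnSeries ℤ T) = HahnSeries.single 2 1) {δ κ : A →ₐ[ℂ] T}
    (hκσ : ∀ z w, mapHom κ z * σ w = σ w * mapHom κ z)
    (hκτ : ∀ z w, mapHom κ z * τ w = τ w * mapHom κ z)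
    {K : Matrix (Fin 2) (Fin 2) (HahnSeries ℤ A)} (hK : reLHS s K = reRHS s K)
    (hδ : K.map (mapHom δ) =
      scal T (prefactor s 1) • ((lHalf s).map σ * K.map (mapHom κ) * (lHalf s).map τ))
    {N : ℕ} (hN : 1 ≤ N) :
    (fusedK s K N).map (mapHom δ) = scal T (prefactor s N) •
      ((fusedL s N).map σ * (fusedK s K N).map (mapHom κ) * (fusedL s N).map τ) := by
  induction N, hN using Nat.le_induction with
  | base => exact hδ
  | succ N hN ih =>
    have hsN : s ^ (-(N : ℤ)) ≠ 0 := zpow_ne_zero _ hs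
    have hF : (fusedK s K (N + 1)).map (mapHom δ) = algF (HahnSeries ℤ T) s N *
        ((kStep s K N).map (mapHom δ) * algE (HahnSeries ℤ T) s N) := by
      rw [fusedK_succ s K hN, Matrix.map_mul, Matrix.map_mul,
        algE_map (mapHom δ) (mapHom_algebraMap δ), algF_map (mapHom δ) (mapHom_algebraMap δ)]
    have hB := congrArg (fun M => M.map (mapHom κ)) (algE_mul_fusedK hs hq hK hN)
    simp only [Matrix.map_mul] at hB
    rw [algE_map (mapHom κ) (mapHom_algebraMap κ), kStep_map] at hB
    have c₁ : aLeg (Fin (N + 1)) ((K.map (mapHom κ)).map (shift (s ^ (-(N : ℤ))))) *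
        vLeg (((fusedL s N).map σ).map (shift s)) =
        vLeg (((fusedL s N).map σ).map (shift s)) *
        aLeg (Fin (N + 1)) ((K.map (mapHom κ)).map (shift (s ^ (-(N : ℤ))))) := by
      rw [← map_map_shift hσ, ← map_mapHom_map_shift]
      exact aLeg_vLeg_comm fun i j v w => hκσ _ _
    have c₂ : aLeg (Fin (N + 1)) (((lHalf s).map τ).map (shift (s ^ (-(N : ℤ))))) *
        vLeg (((fusedK s K N).map (mapHom κ)).map (shift s)) =
        vLeg (((fusedK s K N).map (mapHom κ)).map (shift s)) *
        aLeg (Fin (N + 1)) (((lHalf s).map τ).map (shift (s ^ (-(N : ℤ))))) := by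
      rw [← map_map_shift hτ, ← map_mapHom_map_shift]
      exact aLeg_vLeg_comm fun i j v w => (hκτ _ _).symm
    rw [hF, kStep_map, hδ, ih, prefactor_succ hs N]
    exact algF_dressed_shift_algE hs hq hsN hs _ _
      (lHalf_rMat_fusedL_map hs hq hσ hτ hx hy hxy hxy' hN) c₁ c₂
      (aLeg_lHalf_mul_map hs hq hσ hx N) (aLeg_lHalf_mul_map hs hq hτ hy N) hB.symm

end

/-- The evaluated coaction of the fused K-operators. -/
theorem IsEvaluatedCoaction.map_aqK (hs : s ≠ 0) (hq : ∀ n : ℕ, 0 < n → (s ^ 2) ^ n ≠ 1)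
    (hkp : kp ≠ 0) (hkm : km ≠ 0) {δ : Aq s kp km →ₐ[ℂ] CoactTarget s kp km}
    (hδ : IsEvaluatedCoaction s kp km δ) {N : ℕ} (hN : 1 ≤ N) :
    (aqK s kp km N).map (mapCoeff δ) = scal (CoactTarget s kp km) (prefactor s N) •
      ((fusedL s N).map (second s kp km (-1)) * (aqK s kp km N).map (first s kp km) *
        (fusedL s N).map (second s kp km 1)) := by
  have hxy : ∀ m n e f : ℤ, e + f = 0 →
      (uw s kp km m e * uw s kp km n f : HahnSeries ℤ (CoactTarget s kp km)) =
        HahnSeries.single (m + n) 1 := by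
    intro m n e f h
    rw [← Subring.coe_mul, uw_mul]
    change HahnSeries.single (m + n) (wT s kp km (e + f)) = _
    rw [h, wT_zero]
  exact map_fusedK hs hq (second_shift (-1)) (second_shift 1) (second_eval (-1)) (second_eval 1)
    (hxy (-1) (-1) 1 (-1) rfl) (hxy 1 1 (-1) (- -1) rfl)
    (δ := δ) (κ := Algebra.TensorProduct.includeLeft)
    (fun z w => hahn_commute fun m n => first_second_coeff_commute z w (-1) m n)
    (fun z w => hahn_commute fun m n => first_second_coeff_commute z w 1 m n)
    aq_reflection (hδ.map_kHalf hs (qSq_sub_ne hs hq) (qSq_add_ne hs hq) hkp hkm) hN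

end FusedCoaction

end QOnsager

end

theorem proposition5p9 (s kp km : ℂ) (hs : s ≠ 0) (hq : ∀ n : ℕ, 0 < n → (s ^ 2) ^ n ≠ 1)
    (hkp : kp ≠ 0) (hkm : km ≠ 0) :
    (∃! δ : QOnsager.Aq s kp km →ₐ[ℂ] QOnsager.CoactTarget s kp km,
      QOnsager.IsEvaluatedCoaction s kp km δ) ∧
    ∀ δ : QOnsager.Aq s kp km →ₐ[ℂ] QOnsager.CoactTarget s kp km,
      QOnsager.IsEvaluatedCoaction s kp km δ →
      ∀ N : ℕ, 1 ≤ N →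
        (QOnsager.aqK s kp km N).map (QOnsager.mapCoeff δ) =
          QOnsager.scal (QOnsager.CoactTarget s kp km) (QOnsager.prefactor s N) •
            ((QOnsager.fusedL s N).map (QOnsager.second s kp km (-1))
              * (QOnsager.aqK s kp km N).map (QOnsager.first s kp km)
              * (QOnsager.fusedL s N).map (QOnsager.second s kp km 1)) := by
  have h1 := QOnsager.qSq_sub_ne hs hq
  have h2 := QOnsager.qSq_add_ne hs hq
  refine ⟨QOnsager.existsUnique_isEvaluatedCoaction hs h1 h2 hkp hkm, fun δ hδ N hN => ?_⟩
  exact QOnsager.IsEvaluatedCoaction.map_aqK hs hq hkp hkm hδ hN
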